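/- **Setting.** Let $\mathcal F_m=\mathrm{Frac}\,\mathbb Q[[x_1,\dots,x_m]]$. A mould is a family $M=(M^m)_{m\ge 0}$ with $M^m=M^m(x_1,\dots,x_m)\in\mathcal F_m$; sums and rational multiples are taken componentwise. Let $\mathbf x_m=(x_1,\dots,x_m)$, viewed as a word in integral linear forms. For a word $w=(u_1,\dots,u_k)$ of linearly independent integral linear forms, $M(w)=M^k(u_1,\dots,u_k)$. In the sums over decompositions of a word below, empty words are allowed unless excluded. For words $\alpha=(a_1,\dots,a_p)$, $\beta=(b_1,\dots,b_q)$ with $p\ge1$ put $$\beta\rceil\alpha=(b_1+\cdots+b_q+a_1,a_2,\dots,a_p),\qquad \alpha\lceil\beta=(a_1,\dots,a_{p-1},a_p+b_1+\cdots+b_q),$$ and let both be $\emptyset$ if $\alpha=\emptyset$. Let $\mathsf{ARI}$ (resp. $\mathsf{GARI}$) be the set of moulds with $M^0=0$ (resp. $M^0=1$), and let $1$ denote the mould with $1^0=1$ and $1^m=0$ for $m\ge1$. Define, for moulds $M,N$, $$(M\times N)^m=\sum_{\mathbf x_m=\alpha\beta}M(\alpha)N(\beta),\qquad \mathsf{neg}(M)(x_1,\dots,x_m)=M(-x_1,\dots,-x_m),$$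 $$(\mathsf{arit}(N)(M))^m=\sum_{\mathbf x_m=\alpha\beta\gamma,\ \beta,\gamma\ne\emptyset}M(\alpha\,(\beta\rceil\gamma))N(\beta)-\sum_{\mathbf x_m=\alpha\beta\gamma,\ \alpha,\beta\ne\emptyset}M((\alpha\lceil\beta)\,\gamma)N(\beta),$$ $$\mathsf{preari}(M,N)=\mathsf{arit}(N)(M)+M\times N .$$ For $A\in\mathsf{ARI}$ let $\mathsf{preari}_0(A)=1$, $\mathsf{preari}_1(A)=A$, $\mathsf{preari}_n(A)=\mathsf{preari}(\mathsf{preari}_{n-1}(A),A)$ for $n\ge2$, and $$\mathsf{expari}(A)=\sum_{n\ge0}\tfrac1{n!}\mathsf{preari}_n(A);$$ $\mathsf{expari}:\mathsf{ARI}\to\mathsf{GARI}$ is bijective, with inverse $\mathsf{logari}$. For $S,T\in\mathsf{GARI}$, with $T^{\times-1}$ the inverse of $T$ in the group $(\mathsf{GARI},\times)$, let $(\mathsf{garit}(T)(S))^0=1$ and, for $m\ge1$, $$(\mathsf{garit}(T)(S))^m=\sum_{s\ge1}\ \sum_{\substack{\mathbf x_m=a_1b_1c_1\cdots a_sb_sc_s\\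 b_i\ne\emptyset\ (1\le i\le s),\ c_ia_{i+1}\neq\emptyset\ (1\le i<s)}}S\big(a_1\rceil(b_1\lceil c_1)\cdots a_s\rceil(b_s\lceil c_s)\big)\prod_{i=1}^sT(a_i)\,T^{\times-1}(c_i),$$ and let $\mathsf{gari}(S,T)=\mathsf{garit}(T)(S)\times T$, which is a group law on $\mathsf{GARI}$; write $\mathsf{invgari}(S)$ for the inverse of $S$ in this group. For $S\in\mathsf{GARI}$, $A\in\mathsf{ARI}$ let $$\mathsf{adari}(S)(A)=\mathsf{logari}\big(\mathsf{gari}(\mathsf{gari}(S,\mathsf{expari}(A)),\mathsf{invgari}(S))\big);$$ $\mathsf{adari}(S)$ is a bijection of $\mathsf{ARI}$. Let $$\mathsf{paj}(x_1,\dots,x_m)=\frac1{x_1(x_1+x_2)\cdots(x_1+\cdots+x_m)},\qquad \mathsf{dupal}^m=\frac{B_m}{m!}\frac1{x_1\cdots x_m}\sum_{k=0}^{m-1}(-1)^k\binom{m-1}kx_{k+1}\ \ (m\ge 1),$$ $\mathsf{dupal}^0=0$, where $\frac x{e^x-1}=\sum_m\frac{B_m}{m!}x^m$, and let $\mathsf{pal}\in\mathsf{GARI}$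 be the unique element with $(x_1+\cdots+x_m)\,\mathsf{pal}^m=(\mathsf{pal}\times\mathsf{dupal})^m$ for all $m\ge1$. For $A\in\mathsf{ARI}$ the singulator and its components ($r\ge 1$) are $$\mathsf{sang}(A)=\tfrac12\big(\mathsf{id}+\mathsf{neg}\circ\mathsf{adari}(\mathsf{paj})\big)\big(\mathsf{paj}^{\times-1}\times A\times\mathsf{paj}\big),\qquad \mathsf{slang}_r(A)=\mathsf{adari}(\mathsf{pal})\circ\mathsf{leng}_r\circ\mathsf{adari}(\mathsf{pal})^{-1}\circ\mathsf{sang}(A),$$ where $\mathsf{leng}_r$ keeps the length $r$ component and replaces all others by $0$. For $s\ge1$ let $\mathsf{sa}_s$ be the mould concentrated in length $1$ with $\mathsf{sa}_s(x_1)=x_1^{s-1}$. For $n\ge1$ let $\psi_{2n+1}=(\psi_{2n+1}^{(d)})_{d\ge0}$ be Brown's polar solution: with $x_0=0$ and $x_{A,B}=\prod_{a\in A,\,b\in B}(x_a-x_b)$ (equal to $1$ if $A$ or $B$ is empty), $\psi^{(0)}_{2n+1}=0$ and, for $d\ge 1$, $$\begin{aligned}\psi^{(d)}_{2n+1}={}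&\frac12\sum_{i=1}^d\Big(\frac{(x_i-x_{i-1})^{2n}}{x_{\{0,\dots,i-2\},\{i-1\}}\,x_{\{i+1,\dots,d\},\{i\}}}+\frac{x_d^{2n}}{x_{\{1,\dots,i-1\},\{0\}}\,x_{\{i,\dots,d-1\},\{d\}}}\Big)\\&-\frac12\sum_{i=1}^{d-1}\Big(\frac{(x_1-x_d)^{2n}}{x_{\{2,\dots,i\},\{1\}}\,x_{\{i+1,\dots,d-1,0\},\{d\}}}+\frac{x_{d-1}^{2n}}{x_{\{d,1,\dots,i-1\},\{0\}}\,x_{\{i,\dots,d-2\},\{d-1\}}}\Big).\end{aligned}$$ Let $f^\sharp(x_1,\dots,x_d)=f(x_1,x_1+x_2,\dots,x_1+\cdots+x_d)$, applied in each length. **Theorem.** For every $n\ge1$, $$\psi_{2n+1}^\sharp=\mathsf{sang}(\mathsf{sa}_{2n+1})=\sum_{r=1}^\infty\mathsf{slang}_r(\mathsf{sa}_{2n+1}),$$ where the infinite sum is understood length by length: in each length its partial sums are eventually constant. -/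

import Mathlib

open scoped BigOperators

noncomputable section

namespace MouldTheory

/-! ## Laurent series and substitution of linear forms -/

instance instIsDomainSeries (m : ℕ) : IsDomain (MvPowerSeries (Fin m) ℚ) :=
  NoZeroDivisors.to_isDomain _

/-- The field of Laurent series in `m` variables: the fraction field of `ℚ[[x₁, …, x_m]]`.
The variable `x_i` of the mathematics is indexed by `i - 1 : Fin m`. -/
abbrev Lau (m : ℕ) : Type := FractionRing (MvPowerSeries (Fin m) ℚ)

/-- The variable `x_{i+1}` as an element of `Lau m`. -/
def Lau.X {m : ℕ} (i : Fin m) : Lau m :=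
  algebraMap (MvPowerSeries (Fin m) ℚ) (Lau m) (MvPowerSeries.X i)

/-- An integral linear form `∑ vᵢ xᵢ` in the variables `x₁, …, x_m`, given by its coefficients. -/
abbrev LinForm (m : ℕ) : Type := Fin m → ℤ

/-- A linear form as a power series. -/
def LinForm.toSeries {m : ℕ} (v : LinForm m) : MvPowerSeries (Fin m) ℚ :=
  ∑ i, (v i : ℚ) • MvPowerSeries.X i

theorem hasSubst_linForm {k m : ℕ} (u : Fin k → LinForm m) :
    MvPowerSeries.HasSubst (fun i => (u i).toSeries) := by
  apply MvPowerSeries.hasSubst_of_constantCoeff_zero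
  intro i
  simp [LinForm.toSeries, map_sum]

/-- Substitution of `k` linear forms in `m` variables into power series in `k` variables:
`f ↦ f(u₁, …, u_k)`. -/
def substSeries {k m : ℕ} (u : Fin k → LinForm m) :
    MvPowerSeries (Fin k) ℚ →+* MvPowerSeries (Fin m) ℚ :=
  (MvPowerSeries.substAlgHom (hasSubst_linForm u) :
    MvPowerSeries (Fin k) ℚ →ₐ[ℚ] MvPowerSeries (Fin m) ℚ).toRingHom

open Classical in
/-- Substitution of `k` linear forms in `m` variables into a Laurent series in `k` variables.
It is the unique extension of `substSeries u` to the fraction fields, which exists when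
`substSeries u` is injective (e.g. when the linear forms are linearly independent, as are all
those that occur below); the value is `0` otherwise. -/
def substLau {k m : ℕ} (u : Fin k → LinForm m) (f : Lau k) : Lau m :=
  if h : Function.Injective (substSeries u) then
    IsFractionRing.map (A := MvPowerSeries (Fin k) ℚ) (B := MvPowerSeries (Fin m) ℚ)
      (K := Lau k) (L := Lau m) h f
  else 0

/-! ## Words, flexions and decompositions of words -/

/-- Words whose letters are integral linear forms in `x₁, …, x_m`. -/
abbrev Word (m : ℕ) : Type := List (LinForm m)

/-- The word `(x₁, …, x_m)`. -/
def xWord (m : ℕ) : Word m := List.ofFn fun i : Fin m => (Pi.single i 1 : LinForm m)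

/-- The flexion adding the sum of the letters of `β` to the first letter of `α`
(the empty word if `α` is empty). -/
def urflex {m : ℕ} (β α : Word m) : Word m :=
  match α with
  | [] => []
  | a :: α' => (β.sum + a) :: α'

/-- The flexion adding the sum of the letters of `β` to the last letter of `α`
(the empty word if `α` is empty). -/
def ulflex {m : ℕ} (α β : Word m) : Word m :=
  if h : α = [] then [] else α.dropLast ++ [α.getLast h + β.sum]

/-- All pairs `(α, β)` of words with `αβ = w`. -/
def splits {A : Type} : List A → List (List A × List A)
  | [] => [([], [])]
  | a :: w => ([], a :: w) :: (splits w).map fun p => (a :: p.1, p.2)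

theorem mem_splits {A : Type} (w : List A) (p : List A × List A) :
    p ∈ splits w ↔ p.1 ++ p.2 = w := by
  induction w generalizing p with
  | nil =>
    obtain ⟨α, β⟩ := p
    simp [splits]
  | cons a w ih =>
    obtain ⟨α, β⟩ := p
    cases α with
    | nil => simp [splits]
    | cons b α => simp [splits, ih]; tauto

/-- All triples `(α, β, γ)` of words with `αβγ = w`. -/
def triples {A : Type} (w : List A) : List (List A × List A × List A) :=
  (splits w).flatMap fun p => (splits p.2).map fun q => (p.1, q.1, q.2)

/-- All sequences `(a₁, b₁, c₁), …, (a_s, b_s, c_s)` of triples of words with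
`a₁ b₁ c₁ ⋯ a_s b_s c_s = w`. -/
def tripleSeqs {A : Type} : ℕ → List A → List (List (List A × List A × List A))
  | 0, [] => [[]]
  | 0, _ :: _ => []
  | s + 1, w => (splits w).flatMap fun p => (triples p.1).flatMap fun t =>
      (tripleSeqs s p.2).map fun l => t :: l

/-- The condition `b_i ≠ ∅` for all `i` and `c_i a_{i+1} ≠ ∅` for all consecutive `i, i + 1`. -/
def Admissible {A : Type} (l : List (List A × List A × List A)) : Prop :=
  (∀ t ∈ l, t.2.1 ≠ []) ∧ l.IsChain fun t t' => t.2.2 ++ t'.1 ≠ []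

/-! ## Moulds -/

/-- Moulds with values in Laurent series: families `(M^m(x₁, …, x_m))_{m ≥ 0}`. They are added
and multiplied by rational scalars componentwise. -/
abbrev Mould : Type := (m : ℕ) → Lau m

namespace Mould

/-- The value `M(u₁, …, u_k) ∈ Lau m` of a mould on a word of linear forms in `x₁, …, x_m`. -/
def eval {m : ℕ} (M : Mould) (w : Word m) : Lau m :=
  substLau (fun i : Fin w.length => w.get i) (M w.length)

/-- The unit mould. -/
def unit : Mould
  | 0 => 1
  | _ + 1 => 0

/-- The product `M × N`. -/
def mul (M N : Mould) : Mould := fun m =>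
  ((splits (xWord m)).map fun p => M.eval p.1 * N.eval p.2).sum

/-- Moulds vanishing on the empty word. -/
def ARI : Set Mould := {M | M 0 = 0}

/-- Moulds taking the value `1` on the empty word. -/
def GARI : Set Mould := {M | M 0 = 1}

/-- The inverse of `T` in the group `(GARI, ×)`. -/
def mulInv (T : Mould) : Mould :=
  Classical.epsilon fun T' => T' ∈ GARI ∧ mul T T' = unit ∧ mul T' T = unit

open Classical in
/-- The map `arit(N)`. The sums are empty in lengths `0` and `1`. -/
def arit (N M : Mould) : Mould := fun m =>
  (((triples (xWord m)).filter fun t => t.2.1 ≠ [] ∧ t.2.2 ≠ []).map fun t =>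
      M.eval (t.1 ++ urflex t.2.1 t.2.2) * N.eval t.2.1).sum
  - (((triples (xWord m)).filter fun t => t.1 ≠ [] ∧ t.2.1 ≠ []).map fun t =>
      M.eval (ulflex t.1 t.2.1 ++ t.2.2) * N.eval t.2.1).sum

/-- `preari(M, N) = arit(N)(M) + M × N`. -/
def preari (M N : Mould) : Mould := arit N M + mul M N

/-- `preari_n(A)`. -/
def preariPow (A : Mould) : ℕ → Mould
  | 0 => unit
  | 1 => A
  | n + 2 => preari (preariPow A (n + 1)) A

/-- The exponential `∑_{n ≥ 0} preari_n(A) / n!` for `A ∈ ARI`. In length `m` the terms with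
`n > m` vanish, so that the sum stops at `n = m`. -/
def expari (A : Mould) : Mould := fun m =>
  ∑ n ∈ Finset.range (m + 1), (1 / (n.factorial : ℚ)) • preariPow A n m

/-- The inverse of the bijection `expari : ARI → GARI`. -/
def logari (G : Mould) : Mould :=
  Classical.epsilon fun A => A ∈ ARI ∧ expari A = G

open Classical in
/-- The map `garit(T)`. The sum over the number `s ≥ 1` of triples stops at the length `m`, since
the `s` words `b_i` are non-empty. -/
def garit (T S : Mould) : Mould
  | 0 => 1
  | m + 1 => ∑ s ∈ Finset.Icc 1 (m + 1),
      (((tripleSeqs s (xWord (m + 1))).filter fun l => Admissible l).map fun l =>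
        S.eval (l.flatMap fun t => urflex t.1 (ulflex t.2.1 t.2.2))
          * (l.map fun t => T.eval t.1).prod
          * (l.map fun t => (mulInv T).eval t.2.2).prod).sum

/-- The group law `gari(S, T) = garit(T)(S) × T` on `GARI`. -/
def gari (S T : Mould) : Mould := mul (garit T S) T

/-- The inverse of `S` in the group `(GARI, gari)`. -/
def invgari (S : Mould) : Mould :=
  Classical.epsilon fun T => T ∈ GARI ∧ gari S T = unit ∧ gari T S = unit

/-- The adjoint action `adari(S)` of `S ∈ GARI` on `ARI`. -/
def adari (S A : Mould) : Mould := logari (gari (gari S (expari A)) (invgari S))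

/-- The inverse of the bijection `adari(S) : ARI → ARI`. -/
def adariInv (S B : Mould) : Mould :=
  Classical.epsilon fun A => A ∈ ARI ∧ adari S A = B

/-- `neg(M)(x₁, …, x_m) = M(-x₁, …, -x_m)`. -/
def neg (M : Mould) : Mould := fun m =>
  substLau (fun i : Fin m => (-Pi.single i 1 : LinForm m)) (M m)

/-- `M^♯(x₁, …, x_m) = M(x₁, x₁ + x₂, …, x₁ + ⋯ + x_m)`. -/
def sharp (M : Mould) : Mould := fun m =>
  substLau (fun i : Fin m => (∑ j ∈ Finset.Iic i, Pi.single j 1 : LinForm m)) (M m)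

/-- The map keeping only the length `r` component. -/
def leng (r : ℕ) (M : Mould) : Mould := fun m => if m = r then M m else 0

/-- `∑_{r ≥ 1} f r = M`, convergence being that of moulds: in each length, the partial sums are
eventually equal to the component of `M`. -/
def IsSum (f : ℕ → Mould) (M : Mould) : Prop :=
  ∀ m, ∃ N₀, ∀ N ≥ N₀, ∑ r ∈ Finset.Icc 1 N, f r m = M m

end Mould

open Mould

/-! ## Special moulds, the singulator and the singulands -/

/-- `paj(x₁, …, x_m) = 1 / (x₁ (x₁ + x₂) ⋯ (x₁ + ⋯ + x_m))`. -/
def paj : Mould := fun m => 1 / ∏ i : Fin m, ∑ j ∈ Finset.Iic i, Lau.X j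

/-- `dupal(x₁, …, x_m) =
(B_m / m!) (1 / (x₁ ⋯ x_m)) ∑_{k < m} (-1)^k binom(m-1, k) x_{k+1}`, where `B₁ = -1/2`. -/
def dupal : Mould := fun m =>
  (bernoulli m / (m.factorial : ℚ)) •
    ((1 / ∏ i : Fin m, Lau.X i) *
      ∑ k : Fin m, (-1) ^ (k : ℕ) * ((m - 1).choose k : Lau m) * Lau.X k)

/-- `dur(x₁, …, x_m) = x₁ + ⋯ + x_m`. -/
def dur : Mould := fun m => ∑ i : Fin m, Lau.X i

/-- The mould `pal ∈ GARI` determined by `dur · pal = pal × dupal` (with the lengthwise product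
on the left), a relation that expresses each component through those of smaller length. -/
def pal : Mould :=
  Classical.epsilon fun P => P ∈ GARI ∧ (fun m => dur m * P m) = mul P dupal

/-- The singulator. -/
def sang (M : Mould) : Mould :=
  (1 / 2 : ℚ) • (mul (mul (mulInv paj) M) paj
    + neg (adari paj (mul (mul (mulInv paj) M) paj)))

/-- The component `slang_r` of the singulator. -/
def slang (r : ℕ) (A : Mould) : Mould := adari pal (leng r (adariInv pal (sang A)))

/-- The mould `sa_s`, concentrated in length one, with `sa_s(u) = u^(s-1)` for `s ≥ 1`. -/
def sa (s : ℕ) : Mould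
  | 1 => Lau.X 0 ^ (s - 1)
  | _ => 0

/-! ## Brown's polar solution -/

/-- The elements `x_0 = 0, x_1, …, x_d` of `Lau d` (and `0` beyond the index `d`). -/
def brownX (d a : ℕ) : Lau d :=
  if h : 1 ≤ a ∧ a ≤ d then Lau.X ⟨a - 1, by omega⟩ else 0

/-- `x_{A,B} = ∏_{a ∈ A, b ∈ B} (x_a - x_b)`. -/
def brownProd (d : ℕ) (A B : Finset ℕ) : Lau d :=
  ∏ a ∈ A, ∏ b ∈ B, (brownX d a - brownX d b)

/-- Brown's polar solution `ψ_{2n+1}`. Here `Finset.range (i - 1)` is `{0, …, i - 2}`. -/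
def brownPsi (n : ℕ) : Mould := fun d =>
  (1 / 2 : ℚ) • ∑ i ∈ Finset.Icc 1 d,
    ((brownX d i - brownX d (i - 1)) ^ (2 * n)
        / (brownProd d (Finset.range (i - 1)) {i - 1}
            * brownProd d (Finset.Icc (i + 1) d) {i})
      + brownX d d ^ (2 * n)
        / (brownProd d (Finset.Icc 1 (i - 1)) {0}
            * brownProd d (Finset.Icc i (d - 1)) {d}))
  - (1 / 2 : ℚ) • ∑ i ∈ Finset.Icc 1 (d - 1),
    ((brownX d 1 - brownX d d) ^ (2 * n)
        / (brownProd d (Finset.Icc 2 i) {1}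
            * brownProd d (insert 0 (Finset.Icc (i + 1) (d - 1))) {d})
      + brownX d (d - 1) ^ (2 * n)
        / (brownProd d (insert d (Finset.Icc 1 (i - 1))) {0}
            * brownProd d (Finset.Icc i (d - 2)) {d - 1}))

end MouldTheory

end

open scoped BigOperators

noncomputable section

namespace MouldTheory

/-! ## Functions on words -/

/-! Moulds are read as functions on words of linear forms, with `×` as the concatenation product.
Write `I` for `letters`, the indicator of one-letter words. In this language the flexions disappear.
For `N` in ARI, `arit(N)` is the derivation sending `I` to `[N, I]`. For `T` in GARI, `garit(T)`,
extended linearly, is the algebra endomorphism sending `I` to `T × I × T⁻¹`. Both commute with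
multiplication by any function of the sum of the letters (`sum_flexions_eq_der`,
`sum_flexions_eq_subst`). Such maps are determined by their value on `I`, so identities between them
are checked on `I` alone (`res_hom_congr`, `res_subst_der`).

Consequently right gari-multiplication by `expari(A)` is the exponential of the operator `preari(·,
A)` (`res_expo_pre`). The adjoint action can then be computed without logarithms: `B = adari(S)(A)`
as soon as the linear equation `garit(S)(B) × S = preari(S, A)` holds (`AdRel`, `adari_eq`).

For the first equality, let `D` be multiplication by the sum of the letters, which is a derivation.
Then `D paj = paj × I`, and `Q = neg(paj)` satisfies `D Q = -Q × I`. Hence `garit(paj)` sends `Q` to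
`paj⁻¹`, and sends `T`, the function `Q × I × Q⁻¹` multiplied by the `2n`-th power of the sum, to
`sa`. Put `Y = paj⁻¹ × sa × paj`. If `D Z = D T - [I, T]`, the two sides of the equation for `Z =
adari(paj)(Y)` differ by some `G` with `D G = G × I` and no constant term; by recursion on the
length `G = 0` (`res_subst_mul_eq_pre`). On the other side, the operation `♯` turns the products in
Brown's formula into values of `paj` and `paj⁻¹` on factors of the word, so that `2ψ^♯ = Y + R` with
an explicit `R` (`polarSum_eq`), and `neg(R)` solves the equation for `Z` (`adRel_paj_conjSa`). Thus
`sang(sa) = (Y + R) / 2 = ψ^♯`.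

The second equality is formal: `adari(pal)` is additive and its value up to length `N` depends only
on the argument up to length `N`, so it may be applied component by component (`isSum_adari_leng`).
Of `pal` only the membership in GARI matters.

Values of moulds on linearly dependent words carry no meaning, so identities are stated after
restriction (`res`) to a set of words closed under factors and under merging neighbouring letters.
-/

/-- The sum of `A α β` over all decompositions `αβ` of a word. -/
def splitSum {Λ M : Type} [AddCommMonoid M] (A : List Λ → List Λ → M) (w : List Λ) : M :=
  ((splits w).map fun p => A p.1 p.2).sum

section SplitSum

variable {Λ M : Type} [AddCommMonoid M]

@[simp] theorem splitSum_nil (A : List Λ → List Λ → M) : splitSum A [] = A [] [] := by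
  simp [splitSum, splits]

@[simp] theorem splitSum_cons (A : List Λ → List Λ → M) (x : Λ) (v : List Λ) :
    splitSum A (x :: v) = A [] (x :: v) + splitSum (fun a b => A (x :: a) b) v := by
  simp [splitSum, splits, List.map_map, Function.comp_def]

theorem splitSum_congr {A B : List Λ → List Λ → M} {w : List Λ}
    (h : ∀ a b, a ++ b = w → A a b = B a b) : splitSum A w = splitSum B w := by
  unfold splitSum
  congr 1
  exact List.map_congr_left fun p hp => h _ _ ((mem_splits w p).1 hp)

theorem splitSum_add (A B : List Λ → List Λ → M) (w : List Λ) :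
    splitSum (fun a b => A a b + B a b) w = splitSum A w + splitSum B w := by
  simp [splitSum, List.sum_map_add]

@[simp] theorem splitSum_zero (w : List Λ) : splitSum (fun _ _ => (0 : M)) w = 0 := by
  simp [splitSum]

theorem splitSum_eq_zero {A : List Λ → List Λ → M} {w : List Λ}
    (h : ∀ a b, a ++ b = w → A a b = 0) : splitSum A w = 0 := by
  rw [splitSum_congr h, splitSum_zero]

theorem map_splitSum {N F : Type} [AddCommMonoid N] [FunLike F M N] [AddMonoidHomClass F M N]
    (f : F) (A : List Λ → List Λ → M) (w : List Λ) :
    f (splitSum A w) = splitSum (fun a b => f (A a b)) w := by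
  simp [splitSum, map_list_sum, Function.comp_def]

theorem splitSum_mul_left {K : Type} [CommRing K] (c : K) (A : List Λ → List Λ → K)
    (w : List Λ) : splitSum (fun a b => c * A a b) w = c * splitSum A w :=
  (map_splitSum (AddMonoidHom.mulLeft c) A w).symm

theorem splitSum_mul_right {K : Type} [CommRing K] (c : K) (A : List Λ → List Λ → K)
    (w : List Λ) : splitSum (fun a b => A a b * c) w = splitSum A w * c :=
  (map_splitSum (AddMonoidHom.mulRight c) A w).symm

/-- Both sides run over the ways to cut the word into three factors; this is the source of the
associativity of the product of word functions. -/
theorem splitSum_assoc (A : List Λ → List Λ → List Λ → M) (w : List Λ) :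
    splitSum (fun a u => splitSum (fun b c => A a b c) u) w
      = splitSum (fun u c => splitSum (fun a b => A a b c) u) w := by
  induction w generalizing A with
  | nil => simp
  | cons x v ih =>
    simp only [splitSum_cons, splitSum_nil, splitSum_add]
    rw [ih, add_assoc]

theorem splitSum_map {Λ' : Type} (φ : Λ → Λ') (A : List Λ' → List Λ' → M) (w : List Λ) :
    splitSum A (w.map φ) = splitSum (fun a b => A (a.map φ) (b.map φ)) w := by
  induction w generalizing A with
  | nil => simp
  | cons x v ih => simp [ih]

theorem splitSum_concat (A : List Λ → List Λ → M) (v : List Λ) (x : Λ) :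
    splitSum A (v ++ [x]) = splitSum (fun a b => A a (b ++ [x])) v + A (v ++ [x]) [] := by
  induction v generalizing A with
  | nil => simp
  | cons y v ih => simp [ih, add_assoc]

theorem splitSum_eq_last {A : List Λ → List Λ → M} {w : List Λ}
    (h : ∀ a b, b ≠ [] → A a b = 0) : splitSum A w = A w [] := by
  induction w generalizing A with
  | nil => simp
  | cons x v ih =>
    rw [splitSum_cons, h _ _ (by simp), zero_add, ih fun a b hb => h _ _ hb]

theorem splitSum_eq_first {A : List Λ → List Λ → M} {w : List Λ}
    (h : ∀ a b, a ≠ [] → A a b = 0) : splitSum A w = A [] w := by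
  cases w with
  | nil => simp
  | cons x v =>
    rw [splitSum_cons, splitSum_eq_zero, add_zero]
    exact fun a b _ => h _ _ (by simp)

end SplitSum

/-! ### The concatenation algebra of functions on words. -/

/-- Functions on words with letters in `Λ`, with values in `K`. -/
def WordFun (Λ K : Type) : Type := List Λ → K

namespace WordFun

variable {Λ K : Type}

@[ext] theorem ext {F G : WordFun Λ K} (h : ∀ w, F w = G w) : F = G := funext h

/-- A function on words, as an element of `WordFun Λ K`. -/
def ofFun (f : List Λ → K) : WordFun Λ K := f

@[simp] theorem ofFun_apply (f : List Λ → K) (w : List Λ) : ofFun f w = f w := rfl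

/-- The function `v ↦ F (xv)`. -/
def shift (x : Λ) (F : WordFun Λ K) : WordFun Λ K := fun v => F (x :: v)

@[simp] theorem shift_apply (x : Λ) (F : WordFun Λ K) (v : List Λ) :
    shift x F v = F (x :: v) := rfl

variable [CommRing K]

instance : AddCommGroup (WordFun Λ K) := inferInstanceAs (AddCommGroup (List Λ → K))

instance : Module K (WordFun Λ K) := inferInstanceAs (Module K (List Λ → K))

@[simp] theorem zero_apply (w : List Λ) : (0 : WordFun Λ K) w = 0 := rfl
@[simp] theorem add_apply (F G : WordFun Λ K) (w : List Λ) : (F + G) w = F w + G w := rfl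
@[simp] theorem sub_apply (F G : WordFun Λ K) (w : List Λ) : (F - G) w = F w - G w := rfl
@[simp] theorem neg_apply (F : WordFun Λ K) (w : List Λ) : (-F) w = -F w := rfl
@[simp] theorem smul_apply (c : K) (F : WordFun Λ K) (w : List Λ) : (c • F) w = c * F w := rfl

instance : One (WordFun Λ K) := ⟨fun w => match w with | [] => 1 | _ :: _ => 0⟩

instance : Mul (WordFun Λ K) := ⟨fun F G w => splitSum (fun a b => F a * G b) w⟩

@[simp] theorem one_nil : (1 : WordFun Λ K) [] = 1 := rfl
@[simp] theorem one_cons (x : Λ) (v : List Λ) : (1 : WordFun Λ K) (x :: v) = 0 := rfl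

theorem mul_apply (F G : WordFun Λ K) (w : List Λ) :
    (F * G) w = splitSum (fun a b => F a * G b) w := rfl

@[simp] theorem mul_nil (F G : WordFun Λ K) : (F * G) [] = F [] * G [] := by
  simp [mul_apply]

theorem mul_cons (F G : WordFun Λ K) (x : Λ) (v : List Λ) :
    (F * G) (x :: v) = F [] * G (x :: v) + (shift x F * G) v := by
  simp [mul_apply]

theorem one_ne_nil {w : List Λ} (h : w ≠ []) : (1 : WordFun Λ K) w = 0 := by
  cases w with
  | nil => exact absurd rfl h
  | cons => rfl

instance : Ring (WordFun Λ K) :=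
  { (inferInstance : AddCommGroup (WordFun Λ K)) with
    mul := (· * ·)
    one := 1
    mul_assoc := fun F G H => by
      ext w
      simp only [mul_apply, ← splitSum_mul_left, ← splitSum_mul_right]
      rw [splitSum_assoc]
      simp only [mul_assoc]
    one_mul := fun F => by
      ext w
      rw [mul_apply, splitSum_eq_first fun a b h => by rw [one_ne_nil h, zero_mul]]
      simp
    mul_one := fun F => by
      ext w
      rw [mul_apply, splitSum_eq_last fun a b h => by rw [one_ne_nil h, mul_zero]]
      simp
    left_distrib := fun F G H => by
      ext w
      simp only [mul_apply, add_apply, mul_add, splitSum_add]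
    right_distrib := fun F G H => by
      ext w
      simp only [mul_apply, add_apply, add_mul, splitSum_add]
    zero_mul := fun F => by
      ext w
      simp [mul_apply]
    mul_zero := fun F => by
      ext w
      simp [mul_apply] }

instance : Algebra K (WordFun Λ K) :=
  Algebra.ofModule
    (fun c F G => by
      ext w
      simp only [mul_apply, smul_apply, mul_assoc, splitSum_mul_left])
    (fun c F G => by
      ext w
      simp only [mul_apply, smul_apply, mul_left_comm _ c, splitSum_mul_left])

/-- The function equal to `1` on words of length one and to `0` on all other words. -/
def letters : WordFun Λ K
  | [_] => 1
  | _ => 0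

@[simp] theorem letters_nil : (letters : WordFun Λ K) [] = 0 := rfl
@[simp] theorem letters_singleton (x : Λ) : (letters : WordFun Λ K) [x] = 1 := rfl
@[simp] theorem letters_cons_cons (x y : Λ) (v : List Λ) :
    (letters : WordFun Λ K) (x :: y :: v) = 0 := rfl

theorem shift_letters (x : Λ) : shift x (letters : WordFun Λ K) = 1 := by
  ext w
  cases w <;> rfl

theorem letters_mul_cons (F : WordFun Λ K) (x : Λ) (v : List Λ) :
    (letters * F : WordFun Λ K) (x :: v) = F v := by
  simp [mul_cons, shift_letters]

theorem letters_eq_zero {w : List Λ} (h : w.length ≠ 1) : (letters : WordFun Λ K) w = 0 := by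
  match w, h with
  | [], _ => rfl
  | [_], h => simp at h
  | _ :: _ :: _, _ => rfl

theorem mul_letters_concat (F : WordFun Λ K) (v : List Λ) (x : Λ) :
    (F * letters : WordFun Λ K) (v ++ [x]) = F v := by
  rw [mul_apply, splitSum_concat, splitSum_eq_last]
  · simp
  · intro a b hb
    rw [letters_eq_zero, mul_zero]
    have := List.length_pos_iff.2 hb
    simp
    omega

variable [AddCommMonoid Λ]

/-- Multiplication by a function of the sum of the letters. -/
def scale (h : Λ → K) (F : WordFun Λ K) : WordFun Λ K := fun w => h w.sum * F w

@[simp] theorem scale_apply (h : Λ → K) (F : WordFun Λ K) (w : List Λ) :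
    scale h F w = h w.sum * F w := rfl

theorem shift_scale (h : Λ → K) (F : WordFun Λ K) (x : Λ) :
    shift x (scale h F) = scale (fun s => h (x + s)) (shift x F) := by
  ext w
  simp

theorem scale_add (h : Λ → K) (F G : WordFun Λ K) : scale h (F + G) = scale h F + scale h G := by
  ext w
  simp [mul_add]

theorem scale_sub (h : Λ → K) (F G : WordFun Λ K) : scale h (F - G) = scale h F - scale h G := by
  ext w
  simp [mul_sub]

/-- Multiplication by an additive function of the sum of the letters is a derivation. -/
theorem scale_mul (h : Λ →+ K) (F G : WordFun Λ K) :
    scale h (F * G) = scale h F * G + F * scale h G := by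
  ext w
  simp only [scale_apply, mul_apply, add_apply, ← splitSum_mul_left, ← splitSum_add]
  refine splitSum_congr fun a b hab => ?_
  rw [← hab, List.sum_append, map_add]
  ring

/-! ### Derivations -/

/-- The value on a word of the derivation that maps a function `f` of one letter to
`w ↦ f (∑ w) L w`. -/
def derAux (L : WordFun Λ K) : List Λ → WordFun Λ K → K
  | [], _ => 0
  -- A block is contracted to the sum of its letters with weight `L`. Either the block starts after
  -- `x`, and `x` is passed on to `F`, or it starts with `x` and is `x :: b`.
  | x :: v, F => derAux L v (shift x F)
      + splitSum (fun b c => L (x :: b) * F ((x + b.sum) :: c)) v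

theorem derAux_add (L : WordFun Λ K) (w : List Λ) (F G : WordFun Λ K) :
    derAux L w (F + G) = derAux L w F + derAux L w G := by
  induction w generalizing F G with
  | nil => simp [derAux]
  | cons x v ih =>
    have : shift x (F + G) = shift x F + shift x G := rfl
    simp only [derAux, this, ih, add_apply, mul_add, splitSum_add]
    ring

theorem derAux_smul (L : WordFun Λ K) (w : List Λ) (c : K) (F : WordFun Λ K) :
    derAux L w (c • F) = c * derAux L w F := by
  induction w generalizing F with
  | nil => simp [derAux]
  | cons x v ih =>
    have : shift x (c • F) = c • shift x F := rfl
    simp only [derAux, this, ih, smul_apply, mul_left_comm _ c, splitSum_mul_left, mul_add]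

/-- The derivation that maps a function `f` of one letter to `w ↦ f (∑ w) L w`. -/
def der (L : WordFun Λ K) : Module.End K (WordFun Λ K) where
  toFun F := fun w => derAux L w F
  map_add' F G := by
    ext w
    exact derAux_add L w F G
  map_smul' c F := by
    ext w
    exact derAux_smul L w c F

@[simp] theorem der_nil (L F : WordFun Λ K) : der L F [] = 0 := rfl

theorem der_cons (L F : WordFun Λ K) (x : Λ) (v : List Λ) :
    der L F (x :: v) = der L (shift x F) v
      + splitSum (fun b c => L (x :: b) * F ((x + b.sum) :: c)) v := rfl

theorem der_add_left (L L' F : WordFun Λ K) (w : List Λ) :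
    der (L + L') F w = der L F w + der L' F w := by
  induction w generalizing F with
  | nil => simp
  | cons x v ih =>
    simp only [der_cons, ih, add_apply, add_mul, splitSum_add]
    abel

/-- A cut of the word with one contracted letter lies before or after that letter, so the contracted
block belongs to exactly one of the two factors. -/
theorem der_mul (L F G : WordFun Λ K) : der L (F * G) = der L F * G + F * der L G := by
  ext w
  induction w generalizing F G with
  | nil => simp
  | cons x v ih =>
    have h1 : shift x (F * G) = F [] • shift x G + shift x F * G := by
      ext t
      simp [mul_cons]
    have h2 : shift x (der L F) = der L (shift x F)
        + ofFun (splitSum fun b c => L (x :: b) * F ((x + b.sum) :: c)) := by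
      ext t
      simp [der_cons]
    have h3 : splitSum (fun b c => L (x :: b) * (F * G) ((x + b.sum) :: c)) v
        = F [] * splitSum (fun b c => L (x :: b) * G ((x + b.sum) :: c)) v
        + (ofFun (splitSum fun b c => L (x :: b) * F ((x + b.sum) :: c)) * G) v := by
      simp only [mul_cons, mul_add, splitSum_add]
      simp only [mul_apply, ofFun_apply, ← splitSum_mul_left,
        ← splitSum_mul_right]
      rw [splitSum_assoc]
      simp only [shift_apply, mul_left_comm, mul_assoc]
    rw [der_cons, h1, map_add, map_smul, add_apply, smul_apply, ih, h3]
    simp only [add_apply, mul_cons, der_nil, h2, add_mul, der_cons L G]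
    ring

theorem der_one (L : WordFun Λ K) : der L 1 = 0 := by
  have h := der_mul L 1 1
  simp only [mul_one, one_mul] at h
  simpa using h

/-- Contracting a block does not change the sum of all the letters. -/
theorem der_scale (L : WordFun Λ K) (h : Λ → K) (F : WordFun Λ K) :
    der L (scale h F) = scale h (der L F) := by
  ext w
  induction w generalizing F h with
  | nil => simp
  | cons x v ih =>
    rw [der_cons, shift_scale, ih, scale_apply, scale_apply, der_cons, mul_add,
      ← splitSum_mul_left, List.sum_cons]
    congr 1
    refine splitSum_congr fun b c hbc => ?_
    simp only [scale_apply, List.sum_cons, ← hbc, List.sum_append, add_assoc]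
    ring

/-- The only contraction of a word to a single letter contracts the whole word. The value of `L` on
the empty word is never read, hence the hypothesis. -/
theorem der_letters {L : WordFun Λ K} (hL : L [] = 0) : der L letters = L := by
  ext w
  cases w with
  | nil => simp [hL]
  | cons x v =>
    rw [der_cons, shift_letters, der_one, splitSum_eq_last]
    · simp
    · intro a b hb
      rw [letters_eq_zero, mul_zero]
      simpa using hb

/-! ### Substitutions -/

/-- Auxiliary function for `substAux`; the word `p` is the current block. -/
def substBlock (L : WordFun Λ K) : List Λ → List Λ → WordFun Λ K → K
  | [], p, F => L p * F [p.sum]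
  -- Either the block `p` is closed before `x`, contributing `L p` and the letter `p.sum`, or it
  -- absorbs `x`.
  | x :: v, p, F => L p * substBlock L v [x] (shift p.sum F) + substBlock L v (p ++ [x]) F

/-- The value on a word of the algebra endomorphism that maps a function `f` of one letter to
`w ↦ f (∑ w) L w`. -/
def substAux (L : WordFun Λ K) : List Λ → WordFun Λ K → K
  | [], F => F []
  | x :: v, F => substBlock L v [x] F

theorem substBlock_eq (L : WordFun Λ K) (v p : List Λ) (F : WordFun Λ K) :
    substBlock L v p F
      = splitSum (fun b c => L (p ++ b) * substAux L c (shift (p ++ b).sum F)) v := by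
  induction v generalizing p F with
  | nil => simp [substBlock, substAux]
  | cons x v ih => simp [substBlock, substAux, ih (p ++ [x])]

theorem substAux_cons (L : WordFun Λ K) (x : Λ) (v : List Λ) (F : WordFun Λ K) :
    substAux L (x :: v) F
      = splitSum (fun b c => L (x :: b) * substAux L c (shift (x + b.sum) F)) v := by
  rw [substAux, substBlock_eq]
  simp

theorem substAux_add (L : WordFun Λ K) (w : List Λ) (F G : WordFun Λ K) :
    substAux L w (F + G) = substAux L w F + substAux L w G := by
  match w with
  | [] => rfl
  | x :: v =>
    simp only [substAux_cons, ← splitSum_add]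
    refine splitSum_congr fun b c hbc => ?_
    have : c.length < (x :: v).length := by simp [← hbc]
    have h : shift (x + b.sum) (F + G) = shift (x + b.sum) F + shift (x + b.sum) G := rfl
    rw [h, substAux_add L c, mul_add]
termination_by w.length

theorem substAux_smul (L : WordFun Λ K) (w : List Λ) (k : K) (F : WordFun Λ K) :
    substAux L w (k • F) = k * substAux L w F := by
  match w with
  | [] => rfl
  | x :: v =>
    simp only [substAux_cons, ← splitSum_mul_left]
    refine splitSum_congr fun b c hbc => ?_
    have : c.length < (x :: v).length := by simp [← hbc]
    have h : shift (x + b.sum) (k • F) = k • shift (x + b.sum) F := rfl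
    rw [h, substAux_smul L c, mul_left_comm]
termination_by w.length

/-- The algebra endomorphism that maps a function `f` of one letter to `w ↦ f (∑ w) L w`. -/
def subst (L : WordFun Λ K) : Module.End K (WordFun Λ K) where
  toFun F := fun w => substAux L w F
  map_add' F G := by
    ext w
    exact substAux_add L w F G
  map_smul' c F := by
    ext w
    exact substAux_smul L w c F

@[simp] theorem subst_nil (L F : WordFun Λ K) : subst L F [] = F [] := rfl

theorem subst_cons (L F : WordFun Λ K) (x : Λ) (v : List Λ) :
    subst L F (x :: v)
      = splitSum (fun b c => L (x :: b) * subst L (shift (x + b.sum) F) c) v :=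
  substAux_cons L x v F

theorem subst_one (L : WordFun Λ K) : subst L 1 = 1 := by
  ext w
  cases w with
  | nil => rfl
  | cons x v =>
    rw [subst_cons]
    refine splitSum_eq_zero fun b c _ => ?_
    have : shift (x + b.sum) (1 : WordFun Λ K) = 0 := rfl
    simp [this]

/-- The substitution sums over all divisions of the word into non-empty contracted blocks, and a cut
of the contracted word is a cut of the original one between two blocks. -/
theorem subst_mul (L F G : WordFun Λ K) : subst L (F * G) = subst L F * subst L G := by
  ext w
  induction hn : w.length using Nat.strong_induction_on generalizing w F G with
  | _ n ih =>
  cases w with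
  | nil => simp
  | cons x v =>
    have h1 : ∀ y, shift y (F * G) = F [] • shift y G + shift y F * G := by
      intro y
      ext t
      simp [mul_cons]
    have h2 : shift x (subst L F) = ofFun (splitSum
        fun b c => L (x :: b) * subst L (shift (x + b.sum) F) c) := by
      ext t
      simp [subst_cons]
    rw [subst_cons, mul_cons, subst_nil, subst_cons, h2, mul_apply, ← splitSum_mul_left]
    simp only [ofFun_apply, ← splitSum_mul_right]
    rw [← splitSum_assoc (fun b c d => L (x :: b) * subst L (shift (x + b.sum) F) c * subst L G d),
      ← splitSum_add]
    refine splitSum_congr fun b c hbc => ?_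
    rw [h1, map_add, map_smul, add_apply, smul_apply,
      ih c.length (by rw [← hn, ← hbc]; simp) _ _ c rfl, mul_apply, mul_add,
      ← splitSum_mul_left]
    simp only [mul_assoc, mul_left_comm]

theorem subst_scale (L : WordFun Λ K) (h : Λ → K) (F : WordFun Λ K) :
    subst L (scale h F) = scale h (subst L F) := by
  ext w
  induction hn : w.length using Nat.strong_induction_on generalizing w F h with
  | _ n ih =>
  cases w with
  | nil => simp
  | cons x v =>
    rw [subst_cons, scale_apply, subst_cons, ← splitSum_mul_left]
    refine splitSum_congr fun b c hbc => ?_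
    rw [shift_scale, ih c.length (by rw [← hn, ← hbc]; simp) _ _ c rfl, scale_apply,
      ← hbc]
    simp only [List.sum_cons, List.sum_append, add_assoc]
    ring

theorem subst_letters {L : WordFun Λ K} (hL : L [] = 0) : subst L letters = L := by
  ext w
  cases w with
  | nil => simp [hL]
  | cons x v =>
    rw [subst_cons]
    simp only [shift_letters, subst_one]
    rw [splitSum_eq_last]
    · simp
    · intro a b hb
      rw [one_ne_nil hb, mul_zero]


/-! ### Restriction to a set of words -/

/-- A set of words closed under passing to factors and under adding neighbouring letters. -/
structure Closed {Λ : Type} [Add Λ] (V : Set (List Λ)) : Prop where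
  left : ∀ {a b}, a ++ b ∈ V → a ∈ V
  right : ∀ {a b}, a ++ b ∈ V → b ∈ V
  merge : ∀ {a x y b}, a ++ x :: y :: b ∈ V → a ++ (x + y) :: b ∈ V

theorem Closed.merge_sum {Λ : Type} [AddCommMonoid Λ] {V : Set (List Λ)} (hV : Closed V)
    {a : List Λ} {x : Λ} {b c : List Λ} (h : a ++ x :: (b ++ c) ∈ V) :
    a ++ (x + b.sum) :: c ∈ V := by
  induction b generalizing x with
  | nil => simpa using h
  | cons y b ih =>
    rw [List.sum_cons, ← add_assoc]
    exact ih (hV.merge h)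

theorem Closed.of_append_cons {Λ : Type} [AddCommMonoid Λ] {V : Set (List Λ)} (hV : Closed V)
    {a : List Λ} {x : Λ} {b c : List Λ} (h : a ++ x :: (b ++ c) ∈ V) : x :: b ∈ V :=
  hV.left (b := c) (by simpa using hV.right h)

theorem closed_length {Λ : Type} [Add Λ] (N : ℕ) : Closed {w : List Λ | w.length < N} where
  left h := by
    simp only [Set.mem_ofPred_eq, List.length_append] at h ⊢
    omega
  right h := by
    simp only [Set.mem_ofPred_eq, List.length_append] at h ⊢
    omega
  merge h := by
    simp only [Set.mem_ofPred_eq, List.length_append, List.length_cons] at h ⊢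
    omega

/-! ### Compatibility of the operations with additive maps of letters and ring homomorphisms of
values. -/

section Natural

variable {Λ K Λ' K' : Type} [CommRing K] [CommRing K'] [AddCommMonoid Λ] [AddCommMonoid Λ']
  {V : Set (List Λ)} (hV : Closed V) (φ : Λ →+ Λ') (σ : K →+* K')
include hV

theorem mul_natural {F G : WordFun Λ K} {F' G' : WordFun Λ' K'}
    (hF : ∀ v ∈ V, F' (v.map φ) = σ (F v)) (hG : ∀ v ∈ V, G' (v.map φ) = σ (G v)) :
    ∀ w ∈ V, (F' * G') (w.map φ) = σ ((F * G) w) := by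
  intro w hw
  rw [mul_apply, mul_apply, map_splitSum, splitSum_map]
  refine splitSum_congr fun a b hab => ?_
  subst hab
  rw [hF a (hV.left hw), hG b (hV.right hw), map_mul]

theorem der_natural {L F : WordFun Λ K} {L' F' : WordFun Λ' K'}
    (hL : ∀ v ∈ V, L' (v.map φ) = σ (L v)) (hF : ∀ v ∈ V, F' (v.map φ) = σ (F v)) :
    ∀ w ∈ V, der L' F' (w.map φ) = σ (der L F w) := by
  -- Membership in `V` concerns the whole word, while the recursion strips its first letters. The
  -- prefix `p` keeps the letters already stripped.
  suffices H : ∀ (w p : List Λ) (F : WordFun Λ K) (F' : WordFun Λ' K'), p ++ w ∈ V →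
      (∀ u, p ++ u ∈ V → F' (u.map φ) = σ (F u)) →
      der L' F' (w.map φ) = σ (der L F w) from fun w hw => H w [] F F' hw hF
  intro w
  induction w with
  | nil => simp
  | cons x v ih =>
    intro p F F' hp hF
    rw [List.map_cons, der_cons, der_cons, map_add,
      ih (p ++ [x]) (shift x F) (shift (φ x) F') (by simpa using hp)
        fun u hu => by simpa using hF (x :: u) (by simpa using hu), splitSum_map, map_splitSum]
    congr 1
    refine splitSum_congr fun b c hbc => ?_
    subst hbc
    rw [map_mul, ← hL _ (hV.of_append_cons hp), ← hF _ (hV.merge_sum hp)]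
    simp [map_list_sum]

theorem subst_natural {L F : WordFun Λ K} {L' F' : WordFun Λ' K'}
    (hL : ∀ v ∈ V, L' (v.map φ) = σ (L v)) (hF : ∀ v ∈ V, F' (v.map φ) = σ (F v)) :
    ∀ w ∈ V, subst L' F' (w.map φ) = σ (subst L F w) := by
  suffices H : ∀ (n : ℕ) (w p : List Λ) (F : WordFun Λ K) (F' : WordFun Λ' K'), w.length = n →
      p ++ w ∈ V → (∀ u, p ++ u ∈ V → F' (u.map φ) = σ (F u)) →
      subst L' F' (w.map φ) = σ (subst L F w) from fun w hw => H _ w [] F F' rfl hw hF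
  intro n
  induction n using Nat.strong_induction_on with
  | _ n ih =>
  intro w p F F' hn hp hF
  cases w with
  | nil => simpa using hF [] hp
  | cons x v =>
    rw [List.map_cons, subst_cons, subst_cons, splitSum_map, map_splitSum]
    refine splitSum_congr fun b c hbc => ?_
    subst hbc
    have hs : φ x + (b.map φ).sum = φ (x + b.sum) := by simp [map_list_sum]
    rw [map_mul, ← hL _ (hV.of_append_cons hp), List.map_cons, hs,
      ih c.length (by rw [← hn]; simp) c (p ++ [x + b.sum]) (shift (x + b.sum) F) _ rfl
        (by simpa using hV.merge_sum hp)
        fun u hu => by simpa using hF ((x + b.sum) :: u) (by simpa using hu)]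

end Natural

/-! ### The quotient ring of functions on a closed set of words. -/

section Quotient

variable {Λ K : Type} [CommRing K] [AddCommMonoid Λ] {V : Set (List Λ)} (hV : Closed V)

/-- The congruence identifying functions that agree on `V`. -/
def con : RingCon (WordFun Λ K) where
  r F G := ∀ w ∈ V, F w = G w
  iseqv := ⟨fun _ _ _ => rfl, fun h w hw => (h w hw).symm,
    fun h h' w hw => (h w hw).trans (h' w hw)⟩
  add' h h' w hw := by rw [add_apply, add_apply, h w hw, h' w hw]
  mul' h h' w hw := by
    have := mul_natural hV (AddMonoidHom.id Λ) (RingHom.id K)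
      (fun v hv => by simpa using h v hv) (fun v hv => by simpa using h' v hv) w hw
    simpa using this

/-- Restriction of functions to `V`. -/
def res : WordFun Λ K →+* (con (K := K) hV).Quotient := (con hV).mk'

theorem res_eq {F G : WordFun Λ K} : res hV F = res hV G ↔ ∀ w ∈ V, F w = G w :=
  (con hV).eq

theorem res_scale_congr (h : Λ → K) {F G : WordFun Λ K} (hFG : res hV F = res hV G) :
    res hV (scale h F) = res hV (scale h G) := by
  rw [res_eq] at hFG ⊢
  intro w hw
  simp [hFG w hw]

/-- On a word of `V` only values at blocks and contractions are used, and these stay in `V`; this is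
`der_natural` for the identity maps. -/
theorem res_der_congr {L L' F F' : WordFun Λ K} (hL : res hV L = res hV L')
    (hF : res hV F = res hV F') : res hV (der L F) = res hV (der L' F') := by
  rw [res_eq] at hL hF ⊢
  intro w hw
  simpa using (der_natural hV (AddMonoidHom.id Λ) (RingHom.id K)
    (fun v hv => by simpa using (hL v hv).symm) (fun v hv => by simpa using (hF v hv).symm)
    w hw).symm

theorem res_subst_congr {L L' F F' : WordFun Λ K} (hL : res hV L = res hV L')
    (hF : res hV F = res hV F') : res hV (subst L F) = res hV (subst L' F') := by
  rw [res_eq] at hL hF ⊢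
  intro w hw
  simpa using (subst_natural hV (AddMonoidHom.id Λ) (RingHom.id K)
    (fun v hv => by simpa using (hL v hv).symm) (fun v hv => by simpa using (hF v hv).symm)
    w hw).symm

end Quotient

/-! ### Row finite operators -/

section RowFinite

variable (Λ K : Type) [CommRing K]

/-- The linear combinations of evaluations at words. -/
def evals : Submodule K (WordFun Λ K → K) :=
  Submodule.span K (Set.range fun (v : List Λ) (F : WordFun Λ K) => F v)

variable {Λ K}

theorem eval_mem_evals (v : List Λ) : (fun F : WordFun Λ K => F v) ∈ evals Λ K :=
  Submodule.subset_span ⟨v, rfl⟩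

theorem evals_comp {φ : WordFun Λ K → K} (hφ : φ ∈ evals Λ K) {θ : WordFun Λ K → WordFun Λ K}
    (hθ : ∀ v, (fun F => θ F v) ∈ evals Λ K) : (fun F => φ (θ F)) ∈ evals Λ K := by
  unfold evals at hφ
  induction hφ using Submodule.span_induction with
  | mem φ h =>
    obtain ⟨v, rfl⟩ := h
    exact hθ v
  | zero => exact (evals Λ K).zero_mem
  | add _ _ _ _ h h' => exact (evals Λ K).add_mem h h'
  | smul c _ _ h => exact (evals Λ K).smul_mem c h

theorem evals_shift {φ : WordFun Λ K → K} (hφ : φ ∈ evals Λ K) (x : Λ) :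
    (fun F => φ (shift x F)) ∈ evals Λ K :=
  evals_comp hφ fun v => eval_mem_evals (x :: v)

theorem evals_splitSum {A : List Λ → List Λ → WordFun Λ K → K} {w : List Λ}
    (h : ∀ a b, a ++ b = w → A a b ∈ evals Λ K) :
    (fun F => splitSum (fun a b => A a b F) w) ∈ evals Λ K := by
  induction w generalizing A with
  | nil => simpa using h [] [] rfl
  | cons x v ih =>
    simp only [splitSum_cons]
    exact (evals Λ K).add_mem (h _ _ rfl) (ih fun a b hab => h _ _ (by simp [hab]))

/-- A finite combination of evaluations has finitely many coefficients, and the indicator function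
of a word reads off the coefficient there. -/
theorem eq_zero_of_mem_evals {φ : WordFun Λ K → K} (hφ : φ ∈ evals Λ K)
    {δ : List Λ → WordFun Λ K} (hδ : ∀ v, δ v v = 1) (hδ' : ∀ v w, w ≠ v → δ v w = 0)
    (h : ∀ v, φ (δ v) = 0) (F : WordFun Λ K) : φ F = 0 := by
  obtain ⟨c, rfl⟩ := (Finsupp.mem_span_range_iff_exists_finsupp).1 hφ
  have key : ∀ G : WordFun Λ K,
      (c.sum fun i a => a • fun F : WordFun Λ K => F i) G = c.sum fun i a => a * G i := by
    intro G
    simp [Finsupp.sum, Finset.sum_apply]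
  have hc : c = 0 := by
    ext v
    have := h v
    rw [key] at this
    rw [Finsupp.sum, Finset.sum_eq_single v (fun w _ hw => by rw [hδ' v w hw, mul_zero])
      (fun hv => by rw [Finsupp.notMem_support_iff.1 hv, zero_mul]), hδ, mul_one] at this
    simpa using this
  rw [key, hc, Finsupp.sum_zero_index]

/-- All the components of the operator are linear combinations of evaluations at words. -/
def RowFinite (θ : Module.End K (WordFun Λ K)) : Prop := ∀ w, (fun F => θ F w) ∈ evals Λ K

theorem RowFinite.mul {θ θ' : Module.End K (WordFun Λ K)} (h : RowFinite θ)
    (h' : RowFinite θ') : RowFinite (θ * θ') := fun w => evals_comp (h w) h'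

theorem RowFinite.one : RowFinite (1 : Module.End K (WordFun Λ K)) := eval_mem_evals

theorem RowFinite.pow {θ : Module.End K (WordFun Λ K)} (h : RowFinite θ) (n : ℕ) :
    RowFinite (θ ^ n) := by
  induction n with
  | zero => exact RowFinite.one
  | succ n ih =>
    rw [pow_succ]
    exact ih.mul h

theorem RowFinite.sub {θ θ' : Module.End K (WordFun Λ K)} (h : RowFinite θ)
    (h' : RowFinite θ') : RowFinite (θ - θ') := fun w => (evals Λ K).sub_mem (h w) (h' w)

variable [AddCommMonoid Λ]

theorem rowFinite_der (L : WordFun Λ K) : RowFinite (der L) := by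
  intro w
  induction w with
  | nil => exact (evals Λ K).zero_mem
  | cons x v ih =>
    exact (evals Λ K).add_mem (evals_shift ih x) (evals_splitSum fun b c _ =>
      (evals Λ K).smul_mem _ (eval_mem_evals _))

theorem rowFinite_subst (L : WordFun Λ K) : RowFinite (subst L) := by
  intro w
  induction hn : w.length using Nat.strong_induction_on generalizing w with
  | _ n ih =>
  cases w with
  | nil => exact eval_mem_evals []
  | cons x v =>
    simp only [subst_cons]
    exact evals_splitSum fun b c hbc => (evals Λ K).smul_mem _
      (evals_shift (ih c.length (by rw [← hn, ← hbc]; simp) c rfl) _)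

open Classical in
/-- The indicator function of a word. -/
def single : List Λ → WordFun Λ K
  | [] => 1
  -- Writing the indicator as a product of rescaled copies of `letters` is what reduces
  -- multiplicative maps and derivations to their value on `letters`.
  | x :: v => scale (fun s => if s = x then 1 else 0) letters * single v

theorem single_apply (v w : List Λ) [Decidable (w = v)] :
    (single v : WordFun Λ K) w = if w = v then 1 else 0 := by
  induction v generalizing w with
  | nil => cases w <;> simp [single]
  | cons x v ih =>
    classical
    cases w with
    | nil => simp [single]
    | cons y u =>
      have h : shift y (scale (fun s => if s = x then (1 : K) else 0) letters)
          = (if y = x then (1 : K) else 0) • 1 := by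
        ext t
        cases t <;> simp
      rw [single, mul_cons, h, smul_mul_assoc, one_mul, smul_apply, ih u, scale_apply, letters_nil,
        mul_zero, zero_mul, zero_add]
      by_cases h1 : y = x <;> by_cases h2 : u = v <;> simp [h1, h2]

theorem RowFinite.eq_zero {θ : Module.End K (WordFun Λ K)} (hθ : RowFinite θ) {w : List Λ}
    (h : ∀ v, θ (single v) w = 0) (F : WordFun Λ K) : θ F w = 0 := by
  classical
  exact eq_zero_of_mem_evals (hθ w) (fun v => by simp [single_apply])
    (fun v w hw => by simp [single_apply, hw]) h F

variable {V : Set (List Λ)} (hV : Closed V)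

/-- Indicator functions do not span all functions on words, but each component of a row finite
operator reads only finitely many values, so testing on indicators suffices. -/
theorem RowFinite.res_congr {θ θ' : Module.End K (WordFun Λ K)} (hθ : RowFinite θ)
    (hθ' : RowFinite θ') (h : ∀ v, res hV (θ (single v)) = res hV (θ' (single v)))
    (F : WordFun Λ K) : res hV (θ F) = res hV (θ' F) := by
  rw [res_eq]
  intro w hw
  refine sub_eq_zero.1 ((hθ.sub hθ').eq_zero (w := w) (fun v => ?_) F)
  exact sub_eq_zero.2 ((res_eq hV).1 (h v) w hw)

/-- Two row finite algebra endomorphisms that commute with the maps `scale h` are equal as soon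
as they agree on `letters`. -/
theorem res_hom_congr {θ θ' : Module.End K (WordFun Λ K)} (hθ : RowFinite θ)
    (hθ' : RowFinite θ') (h1 : θ 1 = 1) (h1' : θ' 1 = 1)
    (hm : ∀ F G, θ (F * G) = θ F * θ G) (hm' : ∀ F G, θ' (F * G) = θ' F * θ' G)
    (hs : ∀ h F, θ (scale h F) = scale h (θ F)) (hs' : ∀ h F, θ' (scale h F) = scale h (θ' F))
    (hI : res hV (θ letters) = res hV (θ' letters)) (F : WordFun Λ K) :
    res hV (θ F) = res hV (θ' F) := by
  refine hθ.res_congr hV hθ' (fun v => ?_) F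
  induction v with
  | nil => rw [single, h1, h1']
  | cons x v ih =>
    rw [single, hm, hm', map_mul, map_mul, ih, hs, hs', res_scale_congr hV _ hI]

/-- Both sides are derivations in `F` relative to the homomorphism `subst L` and commute with every
`scale`. It is therefore enough to compare them on `letters`, which is the hypothesis `h`. -/
theorem res_subst_der {L P Q : WordFun Λ K} (hL : L [] = 0) (hP : P [] = 0)
    (h : res hV (subst L P) = res hV (der Q L)) (F : WordFun Λ K) :
    res hV (subst L (der P F)) = res hV (der Q (subst L F)) := by
  refine ((rowFinite_subst L).mul (rowFinite_der P)).res_congr hV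
    ((rowFinite_der Q).mul (rowFinite_subst L)) (fun v => ?_) F
  simp only [Module.End.mul_apply]
  induction v with
  | nil => simp [single, der_one, subst_one]
  | cons x v ih =>
    have h2 : ∀ e : Λ → K, res hV (subst L (der P (scale e letters)))
        = res hV (der Q (subst L (scale e letters))) := by
      intro e
      rw [der_scale, subst_scale, der_letters hP, subst_scale, der_scale, subst_letters hL]
      exact res_scale_congr hV _ h
    rw [single]
    simp only [der_mul, map_add, subst_mul, map_mul, ih, h2]

/-- The composite of the two endomorphisms is again determined by its value on `letters`, namely
`subst L L'`. -/
theorem subst_subst (L : WordFun Λ K) {L' : WordFun Λ K} (hL' : L' [] = 0)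
    (F : WordFun Λ K) : subst L (subst L' F) = subst (subst L L') F := by
  have hV : Closed (Set.univ : Set (List Λ)) := ⟨by simp, by simp, by simp⟩
  have := res_hom_congr hV ((rowFinite_subst L).mul (rowFinite_subst L'))
    (rowFinite_subst (subst L L')) (by simp [subst_one]) (subst_one _)
    (by simp [subst_mul]) (subst_mul _) (by simp [subst_scale]) (subst_scale _)
    (by simp [subst_letters, hL']) F
  ext w
  exact (res_eq hV).1 this w trivial

end RowFinite

/-! ### Exponentials of operators -/

section Exp

variable {Λ K : Type}

/-- The function vanishes on all words with fewer than `n` letters. -/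
def VanishBelow [CommRing K] (n : ℕ) (F : WordFun Λ K) : Prop :=
  ∀ w : List Λ, w.length < n → F w = 0

theorem VanishBelow.mul [CommRing K] {m n : ℕ} {F G : WordFun Λ K} (hF : VanishBelow m F)
    (hG : VanishBelow n G) : VanishBelow (m + n) (F * G) := by
  intro w hw
  refine splitSum_eq_zero fun a b hab => ?_
  rw [← hab, List.length_append] at hw
  by_cases h : a.length < m
  · rw [hF a h, zero_mul]
  · rw [hG b (by omega), mul_zero]

/-- The operator maps functions vanishing on words of length `< n` to functions vanishing on
words of length `≤ n`. -/
def Raising [CommRing K] (θ : Module.End K (WordFun Λ K)) : Prop :=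
  ∀ n F, VanishBelow n F → VanishBelow (n + 1) (θ F)

theorem Raising.pow [CommRing K] {θ : Module.End K (WordFun Λ K)} (hθ : Raising θ) (n : ℕ)
    (F : WordFun Λ K) : VanishBelow n ((θ ^ n) F) := by
  induction n with
  | zero => exact fun w hw => absurd hw (by omega)
  | succ n ih =>
    rw [pow_succ']
    exact hθ n _ ih

theorem sum_apply [CommRing K] {ι : Type} (s : Finset ι) (F : ι → WordFun Λ K) (w : List Λ) :
    (∑ i ∈ s, F i) w = ∑ i ∈ s, F i w :=
  Finset.sum_apply (M := fun _ : List Λ => K) w s F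

variable [Field K]

/-- The exponential of a raising operator. -/
def expo (θ : Module.End K (WordFun Λ K)) : Module.End K (WordFun Λ K) where
  toFun F := fun w => ∑ n ∈ Finset.range (w.length + 1), ((n.factorial : K)⁻¹ • (θ ^ n) F) w
  map_add' F G := by
    ext w
    simp only [map_add, smul_add, add_apply, Finset.sum_add_distrib]
    rfl
  map_smul' c F := by
    ext w
    simp only [map_smul, smul_comm _ c]
    exact (Finset.mul_sum _ _ c).symm

/-- The powers of a raising operator beyond the length of the word vanish on it, so one cutoff `N`
serves all words of length below `N`. -/
theorem expo_apply {θ : Module.End K (WordFun Λ K)} (hθ : Raising θ) (F : WordFun Λ K) {N : ℕ}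
    {w : List Λ} (hw : w.length < N) :
    expo θ F w = (∑ n ∈ Finset.range N, (n.factorial : K)⁻¹ • (θ ^ n) F) w := by
  rw [sum_apply]
  change ∑ n ∈ Finset.range (w.length + 1), ((n.factorial : K)⁻¹ • (θ ^ n) F) w = _
  refine Finset.sum_subset (f := fun n => ((n.factorial : K)⁻¹ • (θ ^ n) F) w) (fun n hn => ?_)
    fun n _ hn => ?_
  · simp only [Finset.mem_range] at hn ⊢
    omega
  · simp only [Finset.mem_range] at hn
    rw [smul_apply, hθ.pow n F w (by omega), mul_zero]

theorem rowFinite_expo {θ : Module.End K (WordFun Λ K)} (h : RowFinite θ) :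
    RowFinite (expo θ) := by
  intro w
  have : (fun F => expo θ F w) = ∑ n ∈ Finset.range (w.length + 1),
      (n.factorial : K)⁻¹ • fun F => (θ ^ n) F w := by
    ext F
    rw [Finset.sum_apply]
    rfl
  rw [this]
  exact (evals Λ K).sum_mem fun n _ => (evals Λ K).smul_mem _ (h.pow n w)

variable [CharZero K]

theorem pow_mul_apply {θ φ χ : Module.End K (WordFun Λ K)}
    (h : ∀ F G, θ (F * G) = φ F * G + F * χ G) (n : ℕ) (F G : WordFun Λ K) :
    (n.factorial : K)⁻¹ • (θ ^ n) (F * G) = ∑ p ∈ Finset.HasAntidiagonal.antidiagonal n,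
      ((p.1.factorial : K)⁻¹ • (φ ^ p.1) F) * ((p.2.factorial : K)⁻¹ • (χ ^ p.2) G) := by
  have key : ∀ n (F G : WordFun Λ K), (θ ^ n) (F * G) = ∑ p ∈ Finset.HasAntidiagonal.antidiagonal n,
      (n.choose p.1 : K) • ((φ ^ p.1) F * (χ ^ p.2) G) := by
    intro n F G
    -- On the tensor square the operators `φ ⊗ 1` and `1 ⊗ χ` commute, so the binomial theorem
    -- applies there and is carried over by the multiplication map.
    let μ := LinearMap.mul' K (WordFun Λ K)
    let a : Module.End K (TensorProduct K (WordFun Λ K) (WordFun Λ K)) := φ.rTensor _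
    let b : Module.End K (TensorProduct K (WordFun Λ K) (WordFun Λ K)) := χ.lTensor _
    have hab : Commute a b := by
      refine TensorProduct.ext' fun x y => ?_
      simp [a, b]
    have hμ : θ ∘ₗ μ = μ ∘ₗ (a + b) := by
      refine TensorProduct.ext' fun x y => ?_
      simp [a, b, μ, h]
    have hpow : ∀ n, (θ ^ n) ∘ₗ μ = μ ∘ₗ ((a + b) ^ n) := by
      intro n
      induction n with
      | zero => rfl
      | succ n ih =>
        rw [pow_succ, pow_succ, Module.End.mul_eq_comp, LinearMap.comp_assoc, hμ,
          ← LinearMap.comp_assoc, ih]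
        rfl
    have h1 := LinearMap.congr_fun (hpow n) (TensorProduct.tmul K F G)
    have ha : ∀ (i : ℕ) x y, (a ^ i) (TensorProduct.tmul K x y)
        = TensorProduct.tmul K ((φ ^ i) x) y := by
      intro i
      induction i with
      | zero => simp
      | succ i ih =>
        intro x y
        rw [pow_succ, pow_succ]
        exact ih (φ x) y
    have hb : ∀ (i : ℕ) x y, (b ^ i) (TensorProduct.tmul K x y)
        = TensorProduct.tmul K x ((χ ^ i) y) := by
      intro i
      induction i with
      | zero => simp
      | succ i ih =>
        intro x y
        rw [pow_succ, pow_succ]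
        exact ih x (χ y)
    rw [hab.add_pow'] at h1
    simp only [LinearMap.comp_apply, LinearMap.sum_apply, map_sum, LinearMap.smul_apply,
      Module.End.mul_apply, hb, ha, map_nsmul, μ, LinearMap.mul'_apply] at h1
    rw [h1]
    simp [← Nat.cast_smul_eq_nsmul K]
  rw [key, Finset.smul_sum]
  refine Finset.sum_congr rfl fun p hp => ?_
  rw [Finset.HasAntidiagonal.mem_antidiagonal] at hp
  rw [smul_smul, smul_mul_assoc, mul_smul_comm, smul_smul]
  congr 1
  rw [← hp, Nat.cast_add_choose]
  have : ((p.1 + p.2).factorial : K) ≠ 0 := Nat.cast_ne_zero.2 (Nat.factorial_ne_zero _)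
  field_simp

/-- Three operators are allowed because `preari(·, A)` is not a derivation: on a product it acts by
its derivation part on the left factor and by itself on the right one. -/
theorem expo_mul [AddCommMonoid Λ] {θ φ χ : Module.End K (WordFun Λ K)} (hθ : Raising θ)
    (hφ : Raising φ) (hχ : Raising χ) (h : ∀ F G, θ (F * G) = φ F * G + F * χ G) (F G : WordFun Λ K) :
    expo θ (F * G) = expo φ F * expo χ G := by
  ext w
  set N := w.length + 1
  have hN : w.length < N := Nat.lt_succ_self _
  have hV := closed_length (Λ := Λ) N
  have h1 : res hV (expo φ F * expo χ G)
      = res hV ((∑ n ∈ Finset.range N, (n.factorial : K)⁻¹ • (φ ^ n) F)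
        * ∑ n ∈ Finset.range N, (n.factorial : K)⁻¹ • (χ ^ n) G) := by
    rw [map_mul, map_mul]
    congr 1
    · exact (res_eq hV).2 fun v hv => expo_apply hφ F hv
    · exact (res_eq hV).2 fun v hv => expo_apply hχ G hv
  rw [(res_eq hV).1 h1 w hN, expo_apply hθ _ hN, Finset.sum_mul_sum, ← Finset.sum_product',
    sum_apply, sum_apply]
  simp only [pow_mul_apply h, sum_apply]
  rw [Finset.sum_sigma']
  refine Finset.sum_bij_ne_zero (fun p _ _ => p.2) ?_ ?_ ?_ ?_
  · rintro ⟨n, i, j⟩ hp _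
    simp only [Finset.mem_sigma, Finset.mem_range, Finset.HasAntidiagonal.mem_antidiagonal,
      Finset.mem_product] at hp ⊢
    omega
  · rintro ⟨n, i, j⟩ hp _ ⟨n', i', j'⟩ hp' _ hh
    simp only [Finset.mem_sigma, Finset.HasAntidiagonal.mem_antidiagonal, Prod.mk.injEq] at hp hp' hh
    obtain ⟨rfl, rfl⟩ := hh
    obtain rfl : n = n' := by omega
    rfl
  · rintro ⟨i, j⟩ _ hne
    refine ⟨⟨i + j, i, j⟩, ?_, hne, rfl⟩
    simp only [Finset.mem_sigma, Finset.mem_range, Finset.HasAntidiagonal.mem_antidiagonal, and_true]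
    -- The square of indices exceeds the triangle `i + j < N`, but the extra products vanish on all
    -- words of length below `i + j`.
    by_contra hij
    refine hne ?_
    rw [smul_mul_assoc, mul_smul_comm, smul_apply, smul_apply,
      (hφ.pow i F).mul (hχ.pow j G) w (by omega), mul_zero, mul_zero]
  · intro p _ _
    rfl

end Exp


/-! ### The operators `preari(·, A)` and the adjoint action -/

variable {Λ K : Type} [AddCommMonoid Λ]

section CommRing

variable [CommRing K]

/-- The commutator with `letters`. -/
def bracket (N : WordFun Λ K) : WordFun Λ K := N * letters - letters * N

/-- The map `F ↦ arit(A)(F) + F × A`. -/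
def pre (A : WordFun Λ K) : Module.End K (WordFun Λ K) :=
  der (bracket A) + LinearMap.mulRight K A

theorem pre_apply (A F : WordFun Λ K) : pre A F = der (bracket A) F + F * A := rfl

omit [AddCommMonoid Λ] in
@[simp] theorem bracket_nil (N : WordFun Λ K) : bracket N [] = 0 := by
  simp [bracket]

theorem pre_mul (A F G : WordFun Λ K) :
    pre A (F * G) = der (bracket A) F * G + F * pre A G := by
  rw [pre_apply, pre_apply, der_mul]
  noncomm_ring

theorem pre_one (A : WordFun Λ K) : pre A 1 = A := by
  rw [pre_apply, der_one, one_mul, zero_add]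

/-- The derivation sends `letters` to `A × I - I × A`; the term `I × A` coming from right
multiplication cancels the second part, so `I` passes through on the right. -/
theorem pre_mul_letters (A F : WordFun Λ K) : pre A (F * letters) = pre A F * letters := by
  rw [pre_mul, pre_apply, pre_apply, der_letters (bracket_nil A), bracket]
  noncomm_ring

omit [AddCommMonoid Λ] in
theorem vanishBelow_one {F : WordFun Λ K} (h : F [] = 0) : VanishBelow 1 F := by
  intro w hw
  rw [List.length_eq_zero_iff.1 (Nat.lt_one_iff.1 hw), h]

omit [AddCommMonoid Λ] in
theorem vanishBelow_bracket {A : WordFun Λ K} {n : ℕ} (h : VanishBelow n A) :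
    VanishBelow (n + 1) (bracket A) := by
  have hl : VanishBelow 1 (letters : WordFun Λ K) := vanishBelow_one rfl
  intro w hw
  rw [bracket, sub_apply, h.mul hl w hw, hl.mul h w (by omega), sub_zero]

/-- Only blocks of at least two letters carry weight, so every contraction shortens the word. -/
theorem raising_der {L : WordFun Λ K} (hL : VanishBelow 2 L) : Raising (der L) := by
  intro n F hF w hw
  induction w generalizing n F with
  | nil => rfl
  | cons x v ih =>
    rw [List.length_cons] at hw
    obtain ⟨m, rfl⟩ : ∃ m, n = m + 1 := ⟨n - 1, by omega⟩
    rw [der_cons, ih m (shift x F) (fun u hu => hF (x :: u) (by simpa using hu)) (by omega),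
      zero_add]
    refine splitSum_eq_zero fun b c hbc => ?_
    have := congrArg List.length hbc
    rw [List.length_append] at this
    by_cases hb : b.length = 0
    · rw [hL _ (by simp [hb]), zero_mul]
    · rw [hF _ (by simp; omega), mul_zero]

theorem raising_pre {A : WordFun Λ K} (hA : A [] = 0) : Raising (pre A) := by
  intro n F hF w hw
  rw [pre_apply, add_apply,
    raising_der (vanishBelow_bracket (vanishBelow_one hA)) n F hF w hw,
    hF.mul (vanishBelow_one hA) w hw, zero_add]

variable {V : Set (List Λ)} (hV : Closed V)

theorem res_bracket_congr {A B : WordFun Λ K} (h : res hV A = res hV B) :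
    res hV (bracket A) = res hV (bracket B) := by
  simp only [bracket, map_sub, map_mul, h]

theorem res_pre_congr {A B F G : WordFun Λ K} (h : res hV A = res hV B)
    (h' : res hV F = res hV G) : res hV (pre A F) = res hV (pre B G) := by
  simp only [pre_apply, map_add, map_mul, h, h', res_der_congr hV (res_bracket_congr hV h) h']

/-- The infinitesimal intertwining relation gives an intertwining relation of operators. -/
theorem res_subst_pre {S S' A B : WordFun Λ K} (hS : res hV S * res hV S' = 1)
    (hS' : res hV S' * res hV S = 1)
    (h : res hV (subst (S * letters * S') B) * res hV S = res hV (pre A S))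
    (F : WordFun Λ K) :
    res hV (subst (S * letters * S') (pre B F)) * res hV S
      = res hV (pre A (subst (S * letters * S') F * S)) := by
  obtain ⟨L, hL⟩ : ∃ L, L = S * letters * S' := ⟨_, rfl⟩
  rw [← hL] at h ⊢
  have hL0 : L [] = 0 := by simp [hL]
  have hB : res hV (subst L B) = res hV (pre A S) * res hV S' := by
    rw [← h, mul_assoc, hS, mul_one]
  -- The derivative of an inverse, obtained by differentiating `S' × S = 1`.
  have hder : res hV (der (bracket A) S')
      = -(res hV S' * res hV (der (bracket A) S) * res hV S') := by
    have h1 : res hV (der (bracket A) (S' * S)) = res hV (der (bracket A) 1) :=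
      res_der_congr hV rfl (by rw [map_mul, hS', map_one])
    rw [der_one, map_zero, der_mul, map_add, map_mul, map_mul] at h1
    calc res hV (der (bracket A) S')
        = res hV (der (bracket A) S') * res hV S * res hV S' := by rw [mul_assoc, hS, mul_one]
      _ = _ := by rw [eq_neg_of_add_eq_zero_left h1]; noncomm_ring
  -- This is the comparison on `letters`. The relation `h` expresses the image of `B` as `(der S + S
  -- × A) × S'`, and the commutator of that with `L` is the derivative of `S × I × S'`.
  have key : res hV (subst L (bracket B)) = res hV (der (bracket A) L) := by
    rw [bracket, map_sub, subst_mul, subst_mul, subst_letters hL0, map_sub, map_mul, map_mul, hB]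
    have : res hV (der (bracket A) L) = res hV (der (bracket A) S) * res hV letters * res hV S'
        + res hV S * res hV (bracket A) * res hV S'
        + res hV S * res hV letters * res hV (der (bracket A) S') := by
      rw [hL, der_mul, der_mul, der_letters (bracket_nil A)]
      simp only [map_add, map_mul]
      noncomm_ring
    rw [this, hder, hL, pre_apply]
    simp only [map_add, map_mul]
    generalize res hV (der (bracket A) S) = d
    simp only [bracket, map_mul, map_sub]
    have e1 : ∀ y, res hV S' * (res hV S * y) = y := by
      intro y
      rw [← mul_assoc, hS', one_mul]
    simp only [add_mul, mul_add, mul_sub, sub_mul, mul_assoc, e1, mul_neg]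
    abel
  have h2 := res_subst_der hV hL0 (bracket_nil B) key F
  rw [pre_mul, pre_apply, map_add, map_add, subst_mul, map_add, map_mul, map_mul, map_mul, h2,
    add_mul, mul_assoc (res hV (subst L F)), h]

/-- Composition law of the substitutions attached to invertible functions. -/
theorem res_subst_comp {S T T' U U' G G' : WordFun Λ K}
    (hT : res hV T * res hV T' = 1) (hU : res hV U * res hV U' = 1)
    (hG' : res hV G' * res hV G = 1)
    (hG : res hV G = res hV (subst (U * letters * U') T * U)) :
    res hV (subst (U * letters * U') (subst (T * letters * T') S))
      = res hV (subst (G * letters * G') S) := by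
  set L := U * letters * U' with hL
  have hL0 : L [] = 0 := by simp [hL]
  rw [subst_subst L (by simp)]
  refine res_subst_congr hV ?_ rfl
  have hTL : res hV (subst L T) * res hV (subst L T') = 1 := by
    rw [← map_mul, ← subst_mul, ← map_one (res hV), ← subst_one L]
    exact res_subst_congr hV rfl (by rw [map_mul, hT, map_one])
  -- `G` is the product of `subst L T` and `U`, so its inverse is the product of the inverses in the
  -- opposite order.
  have hG2 : res hV U' * res hV (subst L T') = res hV G' := by
    calc _ = res hV G' * (res hV G * (res hV U' * res hV (subst L T'))) := by
          rw [← mul_assoc, hG', one_mul]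
      _ = res hV G' * (res hV (subst L T) * (res hV U * res hV U') * res hV (subst L T')) := by
          rw [hG, map_mul]
          noncomm_ring
      _ = _ := by rw [hU, mul_one, hTL, mul_one]
  rw [subst_mul, subst_mul, subst_letters hL0, hL]
  rw [← hL]
  simp only [map_mul, hG, ← hG2, hL]
  noncomm_ring

end CommRing

/-! ### The exponential of `preari(·, A)` and conjugation. -/

section Field

variable [Field K] [CharZero K] {V : Set (List Λ)} (hV : Closed V)

omit [AddCommMonoid Λ] [CharZero K] in
theorem expo_nil (θ : Module.End K (WordFun Λ K)) (F : WordFun Λ K) : expo θ F [] = F [] := by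
  change ∑ n ∈ Finset.range 1, ((n.factorial : K)⁻¹ • (θ ^ n) F) [] = F []
  simp

omit [AddCommMonoid Λ] [CharZero K] in
theorem expo_of_eq_zero {θ : Module.End K (WordFun Λ K)} (hθ : Raising θ) {F : WordFun Λ K}
    (h : θ F = 0) : expo θ F = F := by
  ext w
  rw [expo_apply hθ F (Nat.lt_succ_self _), sum_apply, Finset.sum_range_succ',
    Finset.sum_eq_zero fun n _ => by rw [pow_succ, Module.End.mul_apply, h, map_zero]; simp]
  simp

/-- The gari exponential of `A`. -/
def expPre (A : WordFun Λ K) : WordFun Λ K := expo (pre A) 1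

omit [CharZero K] in
@[simp] theorem expPre_nil (A : WordFun Λ K) : expPre A [] = 1 := expo_nil _ _

omit [CharZero K] in
theorem expo_pre_letters {A : WordFun Λ K} (hA : A [] = 0) :
    expo (pre A) letters = expPre A * letters := by
  have hpow : ∀ n, (pre A ^ n) letters = (pre A ^ n) 1 * letters := by
    intro n
    induction n with
    | zero => simp
    | succ n ih => rw [pow_succ', Module.End.mul_apply, ih, pre_mul_letters]; rfl
  ext w
  have hN : w.length < w.length + 1 := Nat.lt_succ_self _
  have hW := closed_length (Λ := Λ) (w.length + 1)
  have h1 : res hW (expPre A * letters)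
      = res hW ((∑ n ∈ Finset.range (w.length + 1), (n.factorial : K)⁻¹ • (pre A ^ n) 1)
        * letters) := by
    rw [map_mul, map_mul]
    congr 1
    exact (res_eq hW).2 fun v hv => expo_apply (raising_pre hA) 1 hv
  rw [(res_eq hW).1 h1 w hN, expo_apply (raising_pre hA) _ hN, Finset.sum_mul]
  simp only [hpow, smul_mul_assoc]

omit [CharZero K] in
theorem expo_der_scale (L : WordFun Λ K) (h : Λ → K) (F : WordFun Λ K) :
    expo (der L) (scale h F) = scale h (expo (der L) F) := by
  have hpow : ∀ n, (der L ^ n) (scale h F) = scale h ((der L ^ n) F) := by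
    intro n
    induction n with
    | zero => simp
    | succ n ih => rw [pow_succ', Module.End.mul_apply, ih, der_scale]; rfl
  ext w
  change ∑ n ∈ Finset.range (w.length + 1), ((n.factorial : K)⁻¹ • (der L ^ n) (scale h F)) w
    = h w.sum * ∑ n ∈ Finset.range (w.length + 1), ((n.factorial : K)⁻¹ • (der L ^ n) F) w
  simp only [hpow, smul_apply, scale_apply, Finset.mul_sum, mul_left_comm]

/-- Right multiplication by the exponential of `A` is the exponential of `preari(·, A)`. -/
theorem res_expo_pre {A E' : WordFun Λ K} (hA : A [] = 0)
    (hE : res hV (expPre A) * res hV E' = 1) (F : WordFun Λ K) :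
    res hV (expo (pre A) F)
      = res hV (subst (expPre A * letters * E') F) * res hV (expPre A) := by
  have hrp := raising_pre hA
  have hrd : Raising (der (bracket A)) :=
    raising_der (vanishBelow_bracket (vanishBelow_one hA))
  have hmul := expo_mul hrp hrd hrp (pre_mul A)
  -- The exponential of a derivation is an algebra endomorphism, and it commutes with `scale`; it is
  -- thus determined by the image of `letters`.
  have hder : res hV (expo (der (bracket A)) F) = res hV (subst (expPre A * letters * E') F) := by
    refine res_hom_congr hV (rowFinite_expo (rowFinite_der _)) (rowFinite_subst _)
      (expo_of_eq_zero hrd (der_one _)) (subst_one _)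
      (expo_mul hrd hrd hrd (der_mul _)) (subst_mul _) (expo_der_scale _) (subst_scale _) ?_ F
    -- The exponential of `pre A` on `letters = letters × 1` is computed twice: by `hmul`, and by
    -- moving `letters` out on the right. Comparing gives `expPre A × I × E'`.
    have h1 := hmul letters 1
    rw [mul_one, expo_pre_letters hA] at h1
    have h2 := congrArg (fun x => res hV x * res hV E') h1
    simp only [map_mul] at h2
    rw [mul_assoc _ (res hV (expo (pre A) 1))] at h2
    rw [subst_letters (by simp), map_mul, map_mul, h2]
    exact (mul_one _).symm.trans (by rw [← hE]; rfl)
  have h3 := hmul F 1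
  rw [mul_one] at h3
  rw [h3, map_mul, hder]
  rfl

/-- The adjoint action at the group level, `gari(expari B, S) = gari(S, expari A)`, follows from
the infinitesimal relation `gari(B, S) = preari(S, A)`. -/
theorem res_expPre_conj {S S' A B E' : WordFun Λ K} (hS : res hV S * res hV S' = 1)
    (hS' : res hV S' * res hV S = 1) (hA : A [] = 0) (hB : B [] = 0)
    (hE : res hV (expPre A) * res hV E' = 1)
    (h : res hV (subst (S * letters * S') B) * res hV S = res hV (pre A S)) :
    res hV (subst (S * letters * S') (expPre B)) * res hV S
      = res hV (subst (expPre A * letters * E') S) * res hV (expPre A) := by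
  rw [← res_expo_pre hV hA hE]
  -- The intertwining relation of operators, iterated from the function `1`.
  have hpow : ∀ n, res hV (subst (S * letters * S') ((pre B ^ n) 1) * S)
      = res hV ((pre A ^ n) S) := by
    intro n
    induction n with
    | zero => simp [subst_one]
    | succ n ih =>
      rw [pow_succ', pow_succ', map_mul, Module.End.mul_apply, Module.End.mul_apply,
        res_subst_pre hV hS hS' h]
      exact res_pre_congr hV rfl ih
  rw [← map_mul, res_eq]
  intro w hw
  have hN : w.length < w.length + 1 := Nat.lt_succ_self _
  have hW := closed_length (Λ := Λ) (w.length + 1)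
  have h1 : res hW (subst (S * letters * S') (expPre B) * S)
      = res hW (subst (S * letters * S') (∑ n ∈ Finset.range (w.length + 1),
        (n.factorial : K)⁻¹ • (pre B ^ n) 1) * S) := by
    rw [map_mul, map_mul]
    congr 1
    exact res_subst_congr hW rfl
      ((res_eq hW).2 fun v hv => expo_apply (raising_pre hB) 1 hv)
  rw [(res_eq hW).1 h1 w hN, expo_apply (raising_pre hA) _ hN, map_sum, Finset.sum_mul,
    sum_apply, sum_apply]
  refine Finset.sum_congr rfl fun n _ => ?_
  rw [map_smul, smul_mul_assoc, smul_apply, smul_apply, (res_eq hV).1 (hpow n) w hw]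

end Field

end WordFun

/-! ### The sums over decompositions with flexions -/

theorem sum_map_filter {A M : Type} [AddCommMonoid M] (p : A → Prop) [DecidablePred p]
    (l : List A) (f : A → M) :
    ((l.filter fun t => p t).map f).sum = (l.map fun t => if p t then f t else 0).sum := by
  induction l with
  | nil => rfl
  | cons a l ih =>
    by_cases h : p a <;> simp [h, ih]

theorem sum_map_flatMap {A B M : Type} [AddCommMonoid M] (l : List A) (g : A → List B)
    (f : B → M) : ((l.flatMap g).map f).sum = (l.map fun a => ((g a).map f).sum).sum := by
  induction l with
  | nil => rfl
  | cons a l ih => simp [ih]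

theorem sum_map_splits {Λ M : Type} [AddCommMonoid M] (w : List Λ) (f : List Λ × List Λ → M) :
    ((splits w).map f).sum = splitSum (fun a b => f (a, b)) w := rfl

theorem sum_map_triples {Λ M : Type} [AddCommMonoid M] (w : List Λ)
    (f : List Λ × List Λ × List Λ → M) :
    ((triples w).map f).sum
      = splitSum (fun a u => splitSum (fun b c => f (a, b, c)) u) w := by
  rw [triples, sum_map_flatMap]
  simp only [List.map_map]
  rfl

/-- Moving the cut one letter to the right matches all terms except the last of `f` and the first of
`g`. -/
theorem splitSum_move {Λ M : Type} [AddCommMonoid M] {f g : List Λ → List Λ → M}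
    (h : ∀ b y c, f b (y :: c) = g (b ++ [y]) c) (v : List Λ) :
    splitSum f v + g [] v = splitSum g v + f v [] := by
  induction v generalizing f g with
  | nil => simp [add_comm]
  | cons x v ih =>
    have h1 := ih (f := fun a b => f (x :: a) b) (g := fun a b => g (x :: a) b)
      fun b y c => h (x :: b) y c
    have h2 : f [] (x :: v) = g [x] v := h [] x v
    rw [splitSum_cons, splitSum_cons, add_assoc (g [] (x :: v)), ← h1, h2]
    abel

open Classical in
theorem splitSum_split_nil {Λ M : Type} [AddCommMonoid M] (A : List Λ → List Λ → M)
    (v : List Λ) :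
    splitSum A v = A [] v + splitSum (fun a b => if a = [] then 0 else A a b) v := by
  cases v with
  | nil => simp
  | cons x v => simp

section Flexions

variable {m : ℕ}

theorem urflex_cons (b : Word m) (x : LinForm m) (c : Word m) :
    urflex b (x :: c) = (b.sum + x) :: c := rfl

theorem urflex_append (a : Word m) {u : Word m} (hu : u ≠ []) (v : Word m) :
    urflex a (u ++ v) = urflex a u ++ v := by
  cases u with
  | nil => exact absurd rfl hu
  | cons => rfl

theorem urflex_nil_left (v : Word m) : urflex [] v = v := by
  cases v <;> simp [urflex]

theorem ulflex_singleton (x : LinForm m) (b : Word m) : ulflex [x] b = [x + b.sum] := by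
  simp [ulflex]

theorem ulflex_cons (x : LinForm m) {a : Word m} (ha : a ≠ []) (b : Word m) :
    ulflex (x :: a) b = x :: ulflex a b := by
  simp [ulflex, ha, List.dropLast_cons_of_ne_nil ha, List.getLast_cons ha]

theorem ulflex_ne_nil {a : Word m} (ha : a ≠ []) (b : Word m) : ulflex a b ≠ [] := by
  simp [ulflex, ha]

end Flexions

namespace WordFun

variable {m : ℕ} {K : Type} [CommRing K]

-- If `c = y c'`, then `b` is added to `y`: the block `b y` is contracted, with weight `N b`, which
-- is the value of `N × I` on that block.
open Classical in
theorem splitSum_urflex {N : WordFun (LinForm m) K} (hN : N [] = 0) (F : WordFun (LinForm m) K)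
    (w : Word m) :
    splitSum (fun a u => splitSum (fun b c =>
      if b ≠ [] ∧ c ≠ [] then F (a ++ urflex b c) * N b else 0) u) w
      = der (N * letters) F w := by
  induction w generalizing F with
  | nil => simp
  | cons x v ih =>
    rw [splitSum_cons, der_cons, ← ih (shift x F), add_comm]
    simp only [List.cons_append, shift_apply, List.nil_append]
    congr 1
    rw [splitSum_cons]
    simp only [ne_eq, not_true_eq_false, false_and, if_false, zero_add, reduceCtorEq,
      not_false_eq_true, true_and]
    have h := splitSum_move
      (f := fun b c => if c = [] then 0 else F (urflex (x :: b) c) * N (x :: b))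
      (g := fun b c => (N * letters : WordFun (LinForm m) K) (x :: b) * F ((x + b.sum) :: c)) (fun b y c => by
        have h1 : (N * letters : WordFun (LinForm m) K) (x :: (b ++ [y])) = N (x :: b) :=
          mul_letters_concat N (x :: b) y
        simp only [reduceCtorEq, if_false, h1, urflex_cons, List.sum_cons, List.sum_append,
          List.sum_nil, add_zero, add_assoc]
        ring) v
    have h0 : (N * letters : WordFun (LinForm m) K) [x] = 0 := by
      have h2 := mul_letters_concat N [] x
      rw [hN] at h2
      exact h2
    simp only [h0, zero_mul, add_zero, if_true] at h
    rw [← h]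
    refine splitSum_congr fun b c _ => ?_
    by_cases hc : c = [] <;> simp [hc]

-- The last letter `x` of `a` absorbs `b`: the block `x b` is contracted, with weight `N b`, the
-- value of `I × N` there.
open Classical in
theorem splitSum_ulflex {N : WordFun (LinForm m) K} (hN : N [] = 0) (F : WordFun (LinForm m) K)
    (w : Word m) :
    splitSum (fun a u => splitSum (fun b c =>
      if a ≠ [] ∧ b ≠ [] then F (ulflex a b ++ c) * N b else 0) u) w
      = der (letters * N) F w := by
  induction w generalizing F with
  | nil => simp
  | cons x v ih =>
    rw [splitSum_cons, der_cons, ← ih (shift x F), splitSum_eq_zero (w := x :: v) (by simp),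
      zero_add, splitSum_split_nil, add_comm]
    congr 1
    · refine splitSum_congr fun a u _ => ?_
      by_cases ha : a = []
      · simp [ha]
      · simp only [ha, if_false]
        refine splitSum_congr fun b c _ => ?_
        by_cases hb : b = [] <;> simp [ulflex_cons x ha, ha, hb]
    · refine splitSum_congr fun b c _ => ?_
      by_cases hb : b = []
      · simp [hb, letters_mul_cons, hN]
      · simp [hb, letters_mul_cons, ulflex_singleton, mul_comm]

open Classical in
/-- The flexion formula for `arit(N)`. -/
theorem sum_flexions_eq_der {N : WordFun (LinForm m) K} (hN : N [] = 0)
    (F : WordFun (LinForm m) K) (w : Word m) :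
    (((triples w).filter fun t => t.2.1 ≠ [] ∧ t.2.2 ≠ []).map fun t =>
        F (t.1 ++ urflex t.2.1 t.2.2) * N t.2.1).sum
      - (((triples w).filter fun t => t.1 ≠ [] ∧ t.2.1 ≠ []).map fun t =>
        F (ulflex t.1 t.2.1 ++ t.2.2) * N t.2.1).sum = der (bracket N) F w := by
  have hsub : der (N * letters - letters * N) F w
      = der (N * letters) F w - der (letters * N) F w := by
    rw [eq_sub_iff_add_eq, ← der_add_left, sub_add_cancel]
  rw [sum_map_filter, sum_map_filter, sum_map_triples, sum_map_triples, bracket, hsub,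
    ← splitSum_urflex hN, ← splitSum_ulflex hN]

/-! ### The flexion formula for `garit` -/

section Garit

variable (T T' : WordFun (LinForm m) K)

/-- The term of the formula for `garit` that belongs to a sequence of triples. -/
def gariTerm (F : WordFun (LinForm m) K) (l : List (Word m × Word m × Word m)) : K :=
  F (l.flatMap fun t => urflex t.1 (ulflex t.2.1 t.2.2))
    * (l.map fun t => T t.1).prod * (l.map fun t => T' t.2.2).prod

open Classical in
/-- The sum over admissible sequences of `s` triples; if `e` is true, then the first word of the
first triple is required to be non-empty. -/
def gariSum (s : ℕ) (e : Prop) (F : WordFun (LinForm m) K) (w : Word m) : K :=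
  ((tripleSeqs s w).map fun l =>
    if Admissible l ∧ ∀ t ∈ l.head?, e → t.1 ≠ [] then gariTerm T T' F l else 0).sum

theorem gariSum_zero (e : Prop) (F : WordFun (LinForm m) K) (w : Word m) :
    gariSum T T' 0 e F w = (1 : WordFun (LinForm m) K) w * F [] := by
  cases w <;> simp [gariSum, tripleSeqs, Admissible, gariTerm]

-- Peeling off the first triple turns the condition linking it to the next one into the flag `c =
-- []` on the remaining sequence.
open Classical in
theorem gariSum_succ (s : ℕ) (e : Prop) (F : WordFun (LinForm m) K) (w : Word m) :
    gariSum T T' (s + 1) e F w = splitSum (fun p q => splitSum (fun a u => splitSum (fun b c =>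
      if b ≠ [] ∧ (e → a ≠ []) then T a * (T' c * gariSum T T' s (c = [])
        (ofFun fun v => F (urflex a (ulflex b c) ++ v)) q) else 0) u) p) w := by
  rw [gariSum, tripleSeqs, sum_map_flatMap, sum_map_splits]
  refine splitSum_congr fun p q _ => ?_
  rw [sum_map_flatMap, sum_map_triples]
  refine splitSum_congr fun a u _ => splitSum_congr fun b c _ => ?_
  rw [List.map_map]
  split_ifs with h
  · rw [gariSum, ← List.sum_map_mul_left, ← List.sum_map_mul_left]
    congr 1
    refine List.map_congr_left fun l _ => ?_
    have hiff : (Admissible ((a, b, c) :: l) ∧ ∀ t ∈ ((a, b, c) :: l).head?, e → t.1 ≠ [])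
        ↔ (Admissible l ∧ ∀ t ∈ l.head?, c = [] → t.1 ≠ []) := by
      simp only [Admissible, List.isChain_cons, List.mem_cons, forall_eq_or_imp, List.head?_cons,
        Option.mem_def, Option.some.injEq, forall_eq', ne_eq, List.append_eq_nil_iff, not_and]
      constructor
      · rintro ⟨⟨⟨_, h1⟩, h2, h3⟩, _⟩
        exact ⟨⟨h1, h3⟩, h2⟩
      · rintro ⟨⟨h1, h3⟩, h2⟩
        exact ⟨⟨⟨h.1, h1⟩, h2, h3⟩, h.2⟩
    simp only [Function.comp_apply, hiff]
    split_ifs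
    · simp only [gariTerm, List.flatMap_cons, List.map_cons, List.prod_cons, ofFun_apply]
      ring
    · simp
  · apply List.sum_eq_zero
    simp only [List.mem_map, Function.comp_apply]
    rintro _ ⟨l, _, rfl⟩
    rw [if_neg]
    rintro ⟨⟨h1, _⟩, h2⟩
    exact h ⟨h1 _ List.mem_cons_self, h2 (a, b, c) rfl⟩

theorem gariSum_eq_zero (s : ℕ) (e : Prop) (F : WordFun (LinForm m) K) {w : Word m}
    (hw : w.length < s) : gariSum T T' s e F w = 0 := by
  classical
  induction s generalizing e F w with
  | zero => omega
  | succ s ih =>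
    rw [gariSum_succ]
    refine splitSum_eq_zero fun p q h1 => splitSum_eq_zero fun a u h2 =>
      splitSum_eq_zero fun b c h3 => ?_
    split_ifs with h
    · have := List.length_pos_iff.2 h.1
      subst h1 h2 h3
      simp only [List.length_append] at hw
      rw [ih _ _ (by omega), mul_zero, mul_zero]
    · rfl

/-- The sum over all admissible sequences of triples. -/
def gariTotal (e : Prop) (F : WordFun (LinForm m) K) (w : Word m) : K :=
  ∑ s ∈ Finset.range (w.length + 1), gariSum T T' s e F w

theorem gariTotal_eq (e : Prop) (F : WordFun (LinForm m) K) {w : Word m} {N : ℕ}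
    (h : w.length < N) : gariTotal T T' e F w = ∑ s ∈ Finset.range N, gariSum T T' s e F w := by
  refine Finset.sum_subset (fun n hn => ?_) fun n _ hn => ?_
  · simp only [Finset.mem_range] at hn ⊢
    omega
  · simp only [Finset.mem_range] at hn
    exact gariSum_eq_zero T T' n e F (by omega)

open Classical in
/-- The part of the sum over all admissible sequences whose first triple begins with the empty
word. -/
def gariInitial (F : WordFun (LinForm m) K) (w : Word m) : K :=
  splitSum (fun b u => if b = [] then 0 else splitSum (fun c q =>
    T' c * gariTotal T T' (c = []) (ofFun fun v => F (ulflex b c ++ v)) q) u) w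

theorem finset_sum_splitSum {ι Λ M : Type} [AddCommMonoid M] (s : Finset ι)
    (A : ι → List Λ → List Λ → M) (w : List Λ) :
    ∑ i ∈ s, splitSum (A i) w = splitSum (fun a b => ∑ i ∈ s, A i a b) w := by
  induction w generalizing A with
  | nil => simp
  | cons x v ih => simp only [splitSum_cons, Finset.sum_add_distrib, ih]

open Classical in
theorem gariTotal_succ (e : Prop) (F : WordFun (LinForm m) K) (w : Word m) :
    gariTotal T T' e F w = (1 : WordFun (LinForm m) K) w * F []
      + splitSum (fun a u => if e ∧ a = [] then 0 else
        T a * gariInitial T T' (ofFun fun v => F (urflex a v)) u) w := by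
  rw [gariTotal, Finset.sum_range_succ', gariSum_zero, add_comm]
  congr 1
  simp only [gariSum_succ]
  rw [finset_sum_splitSum]
  simp only [finset_sum_splitSum]
  rw [← splitSum_assoc (fun a u q => splitSum (fun b c => ∑ s ∈ Finset.range w.length,
    if b ≠ [] ∧ (e → a ≠ []) then T a * (T' c * gariSum T T' s (c = [])
        (ofFun fun v => F (urflex a (ulflex b c) ++ v)) q) else 0) u)]
  refine splitSum_congr fun a u hau => ?_
  rw [← splitSum_assoc (fun b c q => ∑ s ∈ Finset.range w.length,
    if b ≠ [] ∧ (e → a ≠ []) then T a * (T' c * gariSum T T' s (c = [])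
        (ofFun fun v => F (urflex a (ulflex b c) ++ v)) q) else 0)]
  by_cases h : e ∧ a = []
  · rw [if_pos h]
    refine splitSum_eq_zero fun b u _ => splitSum_eq_zero fun c q _ => ?_
    rw [Finset.sum_eq_zero]
    intro s _
    rw [if_neg]
    rintro ⟨_, h2⟩
    exact h2 h.1 h.2
  · rw [if_neg h, gariInitial, ← splitSum_mul_left]
    refine splitSum_congr fun b u' hu => ?_
    by_cases hb : b = []
    · simp [hb]
    · rw [if_neg hb, ← splitSum_mul_left]
      refine splitSum_congr fun c q hcq => ?_
      have := List.length_pos_iff.2 hb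
      rw [gariTotal_eq (N := w.length) _ _ _ _ (by
        subst hau hu hcq
        simp
        omega), Finset.mul_sum, Finset.mul_sum]
      refine Finset.sum_congr rfl fun s _ => ?_
      rw [if_pos ⟨hb, fun he ha => h ⟨he, ha⟩⟩]
      congr 3
      ext v
      simp [urflex_append a (ulflex_ne_nil hb c)]

variable {T T'}

/-- Dropping the condition on the first triple adds the sequences beginning with an empty `a`, where
`T a = 1`. -/
theorem gariTotal_false (hT : T [] = 1) (F : WordFun (LinForm m) K) (w : Word m) :
    gariTotal T T' False F w = gariTotal T T' True F w + gariInitial T T' F w := by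
  classical
  rw [gariTotal_succ, gariTotal_succ T T' True]
  simp only [false_and, if_false, true_and]
  rw [splitSum_split_nil, hT, one_mul]
  simp only [urflex_nil_left]
  rw [add_comm (gariInitial _ _ _ _), add_assoc]
  rfl

/-- This step removes the admissibility condition. A word `b` with several letters leaves its first
letter `x` alone, which looks like a triple with `c` empty followed by one with `a` empty. That is
exactly the configuration excluded by admissibility, so together both cases give the unrestricted
sum. -/
theorem gariInitial_cons (hT : T [] = 1) (hT' : T' [] = 1) (F : WordFun (LinForm m) K)
    (x : LinForm m) (v : Word m) :
    gariInitial T T' F (x :: v) = splitSum (fun c q =>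
      T' c * gariTotal T T' False (shift (x + c.sum) F) q) v := by
  classical
  rw [gariInitial, splitSum_cons, if_pos rfl, zero_add]
  simp only [reduceCtorEq, if_false]
  rw [splitSum_split_nil]
  have h1 : splitSum (fun b u => if b = [] then 0 else splitSum (fun c q =>
      T' c * gariTotal T T' (c = []) (ofFun fun t => F (ulflex (x :: b) c ++ t)) q) u) v
      = gariInitial T T' (shift x F) v := by
    rw [gariInitial]
    refine splitSum_congr fun b u _ => ?_
    by_cases hb : b = []
    · simp [hb]
    · simp only [hb, if_false, ulflex_cons x hb]
      rfl
  rw [h1, splitSum_split_nil, splitSum_split_nil (fun c q =>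
      T' c * gariTotal T T' False (shift (x + c.sum) F) q)]
  simp only [ulflex_singleton, List.sum_nil, add_zero, gariTotal_false hT (shift x F) v, hT',
    one_mul]
  have h2 : splitSum (fun c q => if c = [] then 0 else
      T' c * gariTotal T T' (c = []) (ofFun fun t => F ([x + c.sum] ++ t)) q) v
      = splitSum (fun c q => if c = [] then 0 else
        T' c * gariTotal T T' False (shift (x + c.sum) F) q) v := by
    refine splitSum_congr fun c q _ => ?_
    by_cases hc : c = []
    · simp [hc]
    · simp only [hc, if_false]
      rfl
  rw [h2]
  have h3 : gariTotal T T' True (ofFun fun t => F ([x] ++ t)) v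
      = gariTotal T T' True (shift x F) v := rfl
  rw [h3]
  abel

/-- By `gariInitial_cons` the words `b` may be taken to be single letters `y`. A block is then `a y
c` with weight `T a * T' c`, and summing over the position of `y` gives `T × I × T'`. -/
theorem gariTotal_eq_subst (hT : T [] = 1) (hT' : T' [] = 1) (F : WordFun (LinForm m) K)
    (w : Word m) : gariTotal T T' False F w = subst (T * letters * T') F w := by
  classical
  induction hn : w.length using Nat.strong_induction_on generalizing w F with
  | _ n ih =>
  rw [gariTotal_succ]
  simp only [false_and, if_false]
  cases w with
  | nil => simp [gariInitial]
  | cons x v =>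
    have h0 : (T * letters * T' : WordFun (LinForm m) K) [] = 0 := by simp
    have h1 : subst (T * letters * T') F (x :: v) = splitSum (fun b q =>
        (T * letters * T' : WordFun (LinForm m) K) b * subst (T * letters * T') (shift b.sum F) q) (x :: v) := by
      rw [subst_cons, splitSum_cons, h0, zero_mul, zero_add]
      simp only [List.sum_cons]
    rw [h1, one_cons, zero_mul, zero_add, mul_assoc]
    simp only [mul_apply T, ← splitSum_mul_right]
    rw [splitSum_congr (w := x :: v) (B := fun a b => splitSum (fun a' u => T a' *
      (letters * T' : WordFun (LinForm m) K) u * subst (T * (letters * T')) (shift (a' ++ u).sum F) b) a)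
      fun a b _ => splitSum_congr fun a' u h => by rw [h],
      ← splitSum_assoc (fun a' u b => T a' * (letters * T' : WordFun (LinForm m) K) u *
        subst (T * (letters * T')) (shift (a' ++ u).sum F) b)]
    refine splitSum_congr fun a u hau => ?_
    simp only [mul_assoc (T a), splitSum_mul_left]
    congr 1
    cases u with
    | nil => simp [gariInitial]
    | cons y u =>
      rw [gariInitial_cons hT hT', splitSum_cons, mul_nil, letters_nil, zero_mul, zero_mul,
        zero_add]
      refine splitSum_congr fun c q hcq => ?_
      rw [letters_mul_cons, ← mul_assoc T letters T', ← ih q.length ?_ _ q rfl]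
      · congr 2
        ext t
        simp [urflex_cons]
      · rw [← hn, ← hau, ← hcq]
        simp
        omega

/-- The flexion formula for `garit(T)`. -/
theorem sum_flexions_eq_subst (hT : T [] = 1) (hT' : T' [] = 1) (F : WordFun (LinForm m) K)
    {w : Word m} (hw : w ≠ []) [DecidablePred (Admissible (A := LinForm m))] :
    ∑ s ∈ Finset.Icc 1 w.length,
      (((tripleSeqs s w).filter fun l => Admissible l).map fun l =>
        F (l.flatMap fun t => urflex t.1 (ulflex t.2.1 t.2.2))
          * (l.map fun t => T t.1).prod * (l.map fun t => T' t.2.2).prod).sum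
      = subst (T * letters * T') F w := by
  rw [← gariTotal_eq_subst hT hT', gariTotal, Finset.range_eq_Ico,
    Finset.sum_eq_sum_Ico_succ_bot (by omega), gariSum_zero, one_ne_nil hw, zero_mul, zero_add]
  refine Finset.sum_congr rfl fun s _ => ?_
  rw [sum_map_filter, gariSum]
  congr 1
  refine List.map_congr_left fun l _ => ?_
  simp [gariTerm]

end Garit

end WordFun

/-! ## Words of linearly independent linear forms -/

/-- The linear combination of the letters of a word. -/
def lincomb {m : ℕ} : (ℕ → ℤ) → Word m → LinForm m
  | _, [] => 0
  | c, x :: v => c 0 • x + lincomb (fun i => c (i + 1)) v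

section Lincomb

variable {m : ℕ}

theorem lincomb_append (c : ℕ → ℤ) (a b : Word m) :
    lincomb c (a ++ b) = lincomb c a + lincomb (fun i => c (i + a.length)) b := by
  induction a generalizing c with
  | nil => simp [lincomb]
  | cons x v ih => simp [lincomb, ih, add_assoc]

theorem lincomb_congr {c d : ℕ → ℤ} {w : Word m} (h : ∀ i < w.length, c i = d i) :
    lincomb c w = lincomb d w := by
  induction w generalizing c d with
  | nil => rfl
  | cons x v ih =>
    rw [lincomb, lincomb, h 0 (by simp), ih fun i hi => h (i + 1) (by simpa using hi)]

theorem lincomb_zero (w : Word m) : lincomb (fun _ => 0) w = 0 := by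
  induction w with
  | nil => rfl
  | cons x v ih => simp [lincomb, ih]

theorem lincomb_one (w : Word m) : lincomb (fun _ => 1) w = w.sum := by
  induction w with
  | nil => rfl
  | cons x v ih => simp [lincomb, ih]

theorem lincomb_eq_sum (c : ℕ → ℤ) (w : Word m) :
    lincomb c w = ∑ i : Fin w.length, c i • w.get i := by
  induction w generalizing c with
  | nil => simp [lincomb]
  | cons x v ih =>
    rw [lincomb, ih]
    exact (Fin.sum_univ_succ (n := v.length) fun i => c i • (x :: v).get i).symm

variable (m) in
/-- The words consisting of linearly independent linear forms. -/
def indepWords : Set (Word m) := {w | ∀ c, lincomb c w = 0 → ∀ i < w.length, c i = 0}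

theorem closed_indepWords : WordFun.Closed (indepWords m) where
  left := by
    intro a b h c hc i hi
    have h1 := h (fun j => if j < a.length then c j else 0) (by
      rw [lincomb_append, lincomb_congr (d := c) fun j hj => by simp [hj], hc,
        lincomb_congr (d := fun _ => 0) fun j hj => by simp, lincomb_zero, add_zero]) i (by
      rw [List.length_append]
      omega)
    simpa [hi] using h1
  right := by
    intro a b h c hc i hi
    have h1 := h (fun j => if j < a.length then 0 else c (j - a.length)) (by
      rw [lincomb_append, lincomb_congr (d := fun _ => 0) fun j hj => by simp [hj], lincomb_zero,
        lincomb_congr (d := c) fun j hj => by simp, hc, add_zero]) (i + a.length) (by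
      rw [List.length_append]
      omega)
    simpa using h1
  merge := by
    intro a x y b h c hc i hi
    -- The coefficient of the merged letter is used for both `x` and `y`, and the later ones move by
    -- one place.
    have h1 := h (fun j => if j ≤ a.length then c j else c (j - 1)) (by
      rw [← hc, lincomb_append, lincomb_append, lincomb_congr (w := a) (d := c) fun j hj => by
        simp [hj.le]]
      simp only [lincomb, zero_add, le_refl, if_true, smul_add, add_assoc]
      have h2 : lincomb (fun j => if j + (1 + (1 + a.length)) ≤ a.length then
          c (j + (1 + (1 + a.length))) else c (j + (1 + (1 + a.length)) - 1)) b
          = lincomb (fun j => c (j + (1 + a.length))) b := by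
        refine lincomb_congr fun j _ => ?_
        rw [if_neg (by omega)]
        exact congrArg c (by omega)
      rw [h2, if_neg (by omega), Nat.add_sub_cancel_left])
    simp only [List.length_append, List.length_cons] at h1 hi
    by_cases hia : i ≤ a.length
    · simpa [hia] using h1 i (by omega)
    · have h3 := h1 (i + 1) (by omega)
      rwa [if_neg (by omega), Nat.add_sub_cancel] at h3

theorem sum_ne_zero_of_mem_indepWords {w : Word m} (hw : w ∈ indepWords m) (h : w ≠ []) :
    w.sum ≠ 0 := by
  intro h0
  rw [← lincomb_one] at h0
  exact one_ne_zero (hw _ h0 0 (List.length_pos_iff.2 h))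

end Lincomb

/-! ## Evaluation of moulds on words -/

theorem charZero_lau (m : ℕ) : CharZero (Lau m) := algebraRat.charZero (Lau m)

theorem rat_smul_eq {m : ℕ} (q : ℚ) (x : Lau m) : q • x = (q : Lau m) * x := by
  rw [Algebra.smul_def, eq_ratCast]

section Subst

/-- Composition of linear forms. -/
def push {k m : ℕ} (u : Fin k → LinForm m) : LinForm k →+ LinForm m where
  toFun c := ∑ j, c j • u j
  map_zero' := by simp
  map_add' := by simp [add_smul, Finset.sum_add_distrib]

theorem push_apply {k m : ℕ} (u : Fin k → LinForm m) (c : LinForm k) :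
    push u c = ∑ j, c j • u j := rfl

theorem push_single {k m : ℕ} (u : Fin k → LinForm m) (i : Fin k) :
    push u (Pi.single i 1) = u i := by
  rw [push_apply, Finset.sum_eq_single i]
  · simp
  · intro j _ hj
    simp [hj]
  · simp

theorem push_xWord {m : ℕ} (w : Word m) : (xWord w.length).map (push w.get) = w := by
  rw [xWord, List.map_ofFn]
  conv_rhs => rw [← List.ofFn_get w]
  congr 1
  ext1 i
  exact push_single _ _

theorem toSeries_single {m : ℕ} (i : Fin m) :
    LinForm.toSeries (Pi.single i 1 : LinForm m) = MvPowerSeries.X i := by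
  rw [LinForm.toSeries, Finset.sum_eq_single i]
  · simp
  · intro j _ hj
    simp [hj]
  · simp

theorem toSeries_add {m : ℕ} (u v : LinForm m) :
    (u + v).toSeries = u.toSeries + v.toSeries := by
  simp [LinForm.toSeries, add_smul, Finset.sum_add_distrib]

/-- `LinForm.toSeries` as an additive homomorphism. -/
def toSeriesHom (m : ℕ) : LinForm m →+ MvPowerSeries (Fin m) ℚ :=
  AddMonoidHom.mk' LinForm.toSeries toSeries_add

theorem substSeries_apply {k m : ℕ} (u : Fin k → LinForm m) (f : MvPowerSeries (Fin k) ℚ) :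
    substSeries u f = MvPowerSeries.subst (fun i => (u i).toSeries) f := by
  change MvPowerSeries.substAlgHom (hasSubst_linForm u) f = _
  rw [MvPowerSeries.coe_substAlgHom]

theorem substSeries_X {k m : ℕ} (u : Fin k → LinForm m) (i : Fin k) :
    substSeries u (MvPowerSeries.X i) = (u i).toSeries := by
  rw [substSeries_apply, MvPowerSeries.subst_X (hasSubst_linForm u)]

theorem substSeries_toSeries {k m : ℕ} (u : Fin k → LinForm m) (c : LinForm k) :
    substSeries u c.toSeries = (push u c).toSeries := by
  have h1 : c.toSeries = ∑ i, c i • (MvPowerSeries.X i : MvPowerSeries (Fin k) ℚ) := by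
    simp only [LinForm.toSeries, Int.cast_smul_eq_zsmul]
  have h2 : (push u c).toSeries = ∑ i, c i • (u i).toSeries := by
    change toSeriesHom m (∑ j, c j • u j) = _
    rw [map_sum]
    simp only [map_zsmul]
    rfl
  rw [h1, h2, map_sum]
  simp only [map_zsmul, substSeries_X]

theorem substSeries_comp {l k m : ℕ} (u : Fin k → LinForm m) (v : Fin l → LinForm k)
    (f : MvPowerSeries (Fin l) ℚ) :
    substSeries u (substSeries v f) = substSeries (fun i => push u (v i)) f := by
  rw [substSeries_apply, substSeries_apply, substSeries_apply,
    MvPowerSeries.subst_comp_subst_apply (hasSubst_linForm v) (hasSubst_linForm u)]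
  congr 1
  ext1 i
  rw [← substSeries_apply, substSeries_toSeries]

theorem substSeries_single {m : ℕ} (f : MvPowerSeries (Fin m) ℚ) :
    substSeries (fun i : Fin m => (Pi.single i 1 : LinForm m)) f = f := by
  rw [substSeries_apply]
  simp only [toSeries_single]
  rw [MvPowerSeries.subst_self, id]

/-- Over `ℚ` the linear map defined by independent forms has a left inverse `g`, and substituting
the linear forms given by `g` undoes the original substitution. -/
theorem substSeries_injective_of_linearIndependent {k m : ℕ} {u : Fin k → LinForm m}
    (hu : LinearIndependent ℤ u) : Function.Injective (substSeries u) := by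
  let ι : LinForm m →ₗ[ℤ] (Fin m → ℚ) :=
    LinearMap.pi fun j => (Algebra.linearMap ℤ ℚ).comp (LinearMap.proj j)
  have hι : Function.Injective ι := by
    intro a b h
    ext j
    have hj : ((a j : ℤ) : ℚ) = ((b j : ℤ) : ℚ) := congrFun h j
    exact_mod_cast hj
  have h1 : LinearIndependent ℚ (ι ∘ u) :=
    (LinearIndependent.iff_fractionRing ℤ ℚ).1 (hu.map' ι (LinearMap.ker_eq_bot.2 hι))
  obtain ⟨g, hg⟩ := LinearMap.exists_leftInverse_of_injective
    (Fintype.linearCombination ℚ (ι ∘ u)) (LinearMap.ker_eq_bot'.2 fun c hc =>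
      funext (Fintype.linearIndependent_iff.1 h1 c hc))
  have hg' : ∀ i, g (ι (u i)) = Pi.single i 1 := by
    intro i
    have := LinearMap.congr_fun hg (Pi.single i 1)
    simpa [Fintype.linearCombination_apply_single] using this
  let ser : (Fin k → ℚ) →ₗ[ℚ] MvPowerSeries (Fin k) ℚ :=
    Fintype.linearCombination ℚ (fun i => MvPowerSeries.X i)
  have ha : MvPowerSeries.HasSubst (fun j : Fin m => ser (g (Pi.single j 1))) := by
    apply MvPowerSeries.hasSubst_of_constantCoeff_zero
    intro j
    simp [ser, Fintype.linearCombination_apply, map_sum]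
  have hlin : ∀ c : LinForm m, MvPowerSeries.subst (fun j : Fin m => ser (g (Pi.single j 1)))
      c.toSeries = ser (g (ι c)) := by
    intro c
    rw [← MvPowerSeries.coe_substAlgHom ha, LinForm.toSeries, map_sum]
    simp only [map_smul, MvPowerSeries.substAlgHom_X]
    have : ι c = ∑ j, (c j : ℚ) • (Pi.single j 1 : Fin m → ℚ) := by
      ext j
      simp [ι, Finset.sum_apply, Pi.single_apply]
    rw [this]
    simp only [map_sum, map_smul]
  refine Function.LeftInverse.injective
    (g := MvPowerSeries.subst fun j : Fin m => ser (g (Pi.single j 1))) fun f => ?_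
  rw [substSeries_apply, MvPowerSeries.subst_comp_subst_apply (hasSubst_linForm u) ha]
  simp only [hlin, hg']
  have : (fun i => ser (Pi.single i 1)) = (MvPowerSeries.X : Fin k → MvPowerSeries (Fin k) ℚ) := by
    ext1 i
    simp [ser, Fintype.linearCombination_apply_single]
  rw [this, MvPowerSeries.subst_self, id]

theorem substSeries_injective {m : ℕ} {w : Word m} (hw : w ∈ indepWords m) :
    Function.Injective (substSeries w.get) := by
  refine substSeries_injective_of_linearIndependent (Fintype.linearIndependent_iff.2 ?_)
  intro g hg i
  have := hw (fun j => if h : j < w.length then g ⟨j, h⟩ else 0) (by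
    rw [lincomb_eq_sum, ← hg]
    simp) i i.2
  simpa using this

/-- Substitution of linearly independent linear forms as a ring homomorphism. -/
def substHom {k m : ℕ} {u : Fin k → LinForm m} (hu : Function.Injective (substSeries u)) :
    Lau k →+* Lau m :=
  IsFractionRing.map (A := MvPowerSeries (Fin k) ℚ) (B := MvPowerSeries (Fin m) ℚ) hu

theorem substLau_eq {k m : ℕ} {u : Fin k → LinForm m} (hu : Function.Injective (substSeries u))
    (f : Lau k) : substLau u f = substHom hu f := dif_pos hu

theorem substHom_algebraMap {k m : ℕ} {u : Fin k → LinForm m}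
    (hu : Function.Injective (substSeries u)) (f : MvPowerSeries (Fin k) ℚ) :
    substHom hu (algebraMap _ (Lau k) f) = algebraMap _ (Lau m) (substSeries u f) :=
  IsLocalization.map_eq (M := nonZeroDivisors (MvPowerSeries (Fin k) ℚ))
    (T := nonZeroDivisors (MvPowerSeries (Fin m) ℚ)) (S := Lau k) (Q := Lau m)
    (nonZeroDivisors_le_comap_nonZeroDivisors_of_injective _ hu) f

theorem ringHom_ext_lau {k : ℕ} {R : Type} [CommRing R] {f g : Lau k →+* R}
    (h : ∀ x : MvPowerSeries (Fin k) ℚ,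
      f (algebraMap _ (Lau k) x) = g (algebraMap _ (Lau k) x)) : f = g :=
  IsLocalization.ringHom_ext (nonZeroDivisors (MvPowerSeries (Fin k) ℚ)) (RingHom.ext h)

theorem injective_comp {l k m : ℕ} {u : Fin k → LinForm m} {v : Fin l → LinForm k}
    (hu : Function.Injective (substSeries u)) (hv : Function.Injective (substSeries v)) :
    Function.Injective (substSeries fun i => push u (v i)) := by
  intro f g h
  rw [← substSeries_comp, ← substSeries_comp] at h
  exact hv (hu h)

theorem substLau_comp {l k m : ℕ} {u : Fin k → LinForm m} {v : Fin l → LinForm k}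
    (hu : Function.Injective (substSeries u)) (hv : Function.Injective (substSeries v))
    (f : Lau l) : substLau u (substLau v f) = substLau (fun i => push u (v i)) f := by
  rw [substLau_eq hu, substLau_eq hv, substLau_eq (injective_comp hu hv)]
  refine congrArg (· f) (congrArg DFunLike.coe (?_ : (substHom hu).comp (substHom hv) = _))
  refine ringHom_ext_lau fun x => ?_
  simp only [RingHom.comp_apply, substHom_algebraMap, substSeries_comp]

theorem injective_single {m : ℕ} :
    Function.Injective (substSeries fun i : Fin m => (Pi.single i 1 : LinForm m)) := by
  intro f g h
  simpa only [substSeries_single] using h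

theorem substLau_single {m : ℕ} (f : Lau m) :
    substLau (fun i : Fin m => (Pi.single i 1 : LinForm m)) f = f := by
  rw [substLau_eq injective_single]
  refine congrArg (· f) (congrArg DFunLike.coe (?_ : substHom injective_single = RingHom.id _))
  refine ringHom_ext_lau fun x => ?_
  simp only [substHom_algebraMap, substSeries_single, RingHom.id_apply]

theorem xWord_length (m : ℕ) : (xWord m).length = m := by simp [xWord]

theorem xWord_mem (m : ℕ) : xWord m ∈ indepWords m := by
  intro c hc i hi
  rw [lincomb_eq_sum] at hc
  rw [xWord_length] at hi
  have hget : ∀ j : Fin (xWord m).length,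
      (xWord m).get j = Pi.single (j.cast (xWord_length m)) 1 := by
    intro j
    exact List.get_ofFn _ j
  have h1 := congrFun hc ⟨i, hi⟩
  rw [Finset.sum_apply, Finset.sum_eq_single ⟨i, by rwa [xWord_length]⟩] at h1
  · rw [hget] at h1
    simpa using h1
  · intro j _ hj
    have : (⟨i, hi⟩ : Fin m) ≠ j.cast (xWord_length m) := by
      intro h
      apply hj
      ext
      exact (congrArg Fin.val h).symm
    rw [hget]
    simp [this]
  · simp

end Subst

/-! ### Moulds as functions on independent words. -/

namespace Mould

theorem eval_eq {k m : ℕ} (M : Mould) {w : Word m} (h : w.length = k) (u : Fin k → LinForm m)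
    (hu : ∀ i, u i = w.get (i.cast h.symm)) : M.eval w = substLau u (M k) := by
  subst h
  have : u = fun i => w.get i := funext hu
  rw [this]
  rfl

theorem eval_ofFn {k m : ℕ} (M : Mould) (u : Fin k → LinForm m) :
    M.eval (List.ofFn u) = substLau u (M k) :=
  M.eval_eq (List.length_ofFn) u fun i => by simp

theorem eval_xWord {m : ℕ} (M : Mould) : M.eval (xWord m) = M m := by
  rw [xWord, eval_ofFn, substLau_single]

theorem eval_map {m : ℕ} {w : Word m} (hw : w ∈ indepWords m) (M : Mould)
    {v : Word w.length} (hv : v ∈ indepWords w.length) :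
    M.eval (v.map (push w.get)) = substHom (substSeries_injective hw) (M.eval v) := by
  rw [← substLau_eq (substSeries_injective hw)]
  change _ = substLau w.get (substLau v.get (M v.length))
  rw [substLau_comp (substSeries_injective hw) (substSeries_injective hv)]
  exact eval_eq M (by simp) _ fun i => by simp

theorem eval_congr {m : ℕ} {M N : Mould} {w : Word m} (h : M w.length = N w.length) :
    M.eval w = N.eval w := by
  rw [eval, eval, h]

/-- A mould as a function on words. -/
def ev (m : ℕ) (M : Mould) : WordFun (LinForm m) (Lau m) := M.eval

/-- The restriction of a mould to words of independent linear forms in `m` variables. -/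
def cls (m : ℕ) (M : Mould) : (WordFun.con (K := Lau m) (closed_indepWords (m := m))).Quotient :=
  WordFun.res closed_indepWords (ev m M)

theorem eval_eq_hom {m : ℕ} {w : Word m} (hw : w ∈ indepWords m) (M : Mould) :
    M.eval w = substHom (substSeries_injective hw) (M w.length) := by
  rw [← substLau_eq]
  rfl

theorem cls_eq_iff {m : ℕ} {M : Mould} {F : WordFun (LinForm m) (Lau m)} :
    cls m M = WordFun.res closed_indepWords F ↔ ∀ w ∈ indepWords m, M.eval w = F w :=
  WordFun.res_eq _

/-- Each component is the value at `(x₁, …, x_m)`, which is an independent word. -/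
theorem ext_cls {M N : Mould} (h : ∀ m, cls m M = cls m N) : M = N := by
  ext m
  rw [← eval_xWord M, ← eval_xWord N]
  exact cls_eq_iff.1 (h m) _ (xWord_mem m)

/-- A mould whose components are the values at `x₁, …, x_m` of a family of functions on words
compatible with substitutions is represented by these functions. -/
theorem cls_eq_of_natural {M : Mould} (F : ∀ m, WordFun (LinForm m) (Lau m))
    (h0 : ∀ m, M m = F m (xWord m))
    (h : ∀ {m : ℕ} {w : Word m} (hw : w ∈ indepWords m), ∀ v ∈ indepWords w.length,
      F m (v.map (push w.get)) = substHom (substSeries_injective hw) (F w.length v)) (m : ℕ) :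
    cls m M = WordFun.res closed_indepWords (F m) := by
  refine cls_eq_iff.2 fun w hw => ?_
  rw [eval_eq_hom hw, h0, ← h hw _ (xWord_mem _), push_xWord]

theorem ev_natural {m : ℕ} {w : Word m} (hw : w ∈ indepWords m) (M : Mould) :
    ∀ v ∈ indepWords w.length,
      ev m M (v.map (push w.get)) = substHom (substSeries_injective hw) (ev w.length M v) :=
  fun _ hv => eval_map hw M hv

theorem letters_natural {m : ℕ} {w : Word m} (hw : w ∈ indepWords m) :
    ∀ v ∈ indepWords w.length, (WordFun.letters : WordFun (LinForm m) (Lau m))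
      (v.map (push w.get))
        = substHom (substSeries_injective hw) ((WordFun.letters : WordFun _ (Lau w.length)) v) := by
  intro v _
  match v with
  | [] => simp
  | [_] => simp
  | _ :: _ :: _ => simp

theorem mul_eq (M N : Mould) (m : ℕ) : mul M N m = (ev m M * ev m N) (xWord m) := rfl

@[simp] theorem cls_mul (M N : Mould) (m : ℕ) : cls m (mul M N) = cls m M * cls m N := by
  rw [cls_eq_of_natural (fun m => ev m M * ev m N) (mul_eq M N), map_mul]
  · rfl
  · intro m w hw
    exact WordFun.mul_natural closed_indepWords _ _ (ev_natural hw M) (ev_natural hw N)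

@[simp] theorem cls_unit (m : ℕ) : cls m unit = 1 := by
  rw [cls_eq_of_natural (fun m => 1), map_one]
  · intro m
    cases m with
    | zero => rfl
    | succ m => exact (WordFun.one_ne_nil (by simp [xWord])).symm
  · intro m w hw v _
    cases v
    · exact (map_one _).symm
    · exact (map_zero _).symm

@[simp] theorem cls_add (M N : Mould) (m : ℕ) : cls m (M + N) = cls m M + cls m N := by
  rw [cls, cls, cls, ← map_add]
  refine cls_eq_iff.2 fun w hw => ?_
  change (M + N).eval w = M.eval w + N.eval w
  simp only [eval_eq_hom hw, Pi.add_apply, map_add]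

@[simp] theorem cls_neg (M : Mould) (m : ℕ) : cls m (-M) = -cls m M := by
  rw [cls, cls, ← map_neg]
  refine cls_eq_iff.2 fun w hw => ?_
  change (-M).eval w = -M.eval w
  simp only [eval_eq_hom hw, Pi.neg_apply, map_neg]

@[simp] theorem cls_sub (M N : Mould) (m : ℕ) : cls m (M - N) = cls m M - cls m N := by
  rw [sub_eq_add_neg, cls_add, cls_neg, sub_eq_add_neg]

@[simp] theorem cls_zero (m : ℕ) : cls m 0 = 0 := by
  rw [cls, ← map_zero (WordFun.res closed_indepWords)]
  refine cls_eq_iff.2 fun w hw => ?_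
  simp only [WordFun.zero_apply, eval_eq_hom hw, Pi.zero_apply, map_zero]

theorem mul_assoc' (L M N : Mould) : mul (mul L M) N = mul L (mul M N) :=
  ext_cls fun m => by simp only [cls_mul, mul_assoc]

theorem unit_mul (M : Mould) : mul unit M = M := ext_cls fun m => by simp

theorem nil_mem_indepWords (m : ℕ) : [] ∈ indepWords m :=
  closed_indepWords.left (b := xWord m) (xWord_mem m)

theorem ev_nil_of_mem_GARI {M : Mould} (hM : M ∈ GARI) (m : ℕ) : ev m M [] = 1 := by
  rw [ev, eval_eq_hom (nil_mem_indepWords m), show M ([] : Word m).length = 1 from hM, map_one]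

theorem ev_nil_of_mem_ARI {M : Mould} (hM : M ∈ ARI) (m : ℕ) : ev m M [] = 0 := by
  rw [ev, eval_eq_hom (nil_mem_indepWords m), show M ([] : Word m).length = 0 from hM, map_zero]

theorem bracket_natural {m : ℕ} {w : Word m} (hw : w ∈ indepWords m) (N : Mould) :
    ∀ v ∈ indepWords w.length, WordFun.bracket (ev m N) (v.map (push w.get))
      = substHom (substSeries_injective hw) (WordFun.bracket (ev w.length N) v) := by
  intro v hv
  rw [WordFun.bracket, WordFun.bracket, WordFun.sub_apply, WordFun.sub_apply, map_sub,
    WordFun.mul_natural closed_indepWords _ _ (ev_natural hw N) (letters_natural hw) v hv,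
    WordFun.mul_natural closed_indepWords _ _ (letters_natural hw) (ev_natural hw N) v hv]

theorem arit_eq {N : Mould} (hN : N ∈ ARI) (M : Mould) (m : ℕ) :
    arit N M m = WordFun.der (WordFun.bracket (ev m N)) (ev m M) (xWord m) :=
  WordFun.sum_flexions_eq_der (ev_nil_of_mem_ARI hN m) (ev m M) (xWord m)

theorem cls_arit {N : Mould} (hN : N ∈ ARI) (M : Mould) (m : ℕ) :
    cls m (arit N M) = WordFun.res closed_indepWords
      (WordFun.der (WordFun.bracket (ev m N)) (ev m M)) :=
  cls_eq_of_natural (fun m => WordFun.der (WordFun.bracket (ev m N)) (ev m M)) (arit_eq hN M)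
    (fun hw => WordFun.der_natural closed_indepWords _ _ (bracket_natural hw N) (ev_natural hw M))
    m

theorem cls_preari {N : Mould} (hN : N ∈ ARI) (M : Mould) (m : ℕ) :
    cls m (preari M N) = WordFun.res closed_indepWords (WordFun.pre (ev m N) (ev m M)) := by
  rw [preari, cls_add, cls_arit hN, cls_mul, WordFun.pre_apply, map_add, map_mul]
  rfl

/-- The linear extension of `garit(T)` to moulds with an arbitrary constant term. -/
def garitLin (T S : Mould) : Mould
  | 0 => S 0
  | m + 1 => garit T S (m + 1)

theorem garitLin_of_mem_GARI (T : Mould) {S : Mould} (hS : S ∈ GARI) :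
    garitLin T S = garit T S := by
  ext m
  cases m with
  | zero => exact hS
  | succ m => rfl

/-- The image of `letters` under `garit(T)`. -/
def conjLetters (m : ℕ) (T : Mould) : WordFun (LinForm m) (Lau m) :=
  ev m T * WordFun.letters * ev m (mulInv T)

theorem garitLin_eq {T : Mould} (hT : T ∈ GARI) (hT' : mulInv T ∈ GARI) (S : Mould) (m : ℕ) :
    garitLin T S m = WordFun.subst (conjLetters m T) (ev m S) (xWord m) := by
  cases m with
  | zero =>
    change S 0 = S.eval (xWord 0)
    rw [eval_xWord]
  | succ m =>
    classical
    rw [conjLetters, ← WordFun.sum_flexions_eq_subst (ev_nil_of_mem_GARI hT _)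
      (ev_nil_of_mem_GARI hT' _) (ev (m + 1) S) (w := xWord (m + 1)) (by simp [xWord]),
      xWord_length]
    rfl

theorem cls_garitLin {T : Mould} (hT : T ∈ GARI) (hT' : mulInv T ∈ GARI) (S : Mould) (m : ℕ) :
    cls m (garitLin T S)
      = WordFun.res closed_indepWords (WordFun.subst (conjLetters m T) (ev m S)) :=
  cls_eq_of_natural (fun m => WordFun.subst (conjLetters m T) (ev m S)) (garitLin_eq hT hT' S)
    (fun hw => WordFun.subst_natural closed_indepWords _ _
      (WordFun.mul_natural closed_indepWords _ _
        (WordFun.mul_natural closed_indepWords _ _ (ev_natural hw T) (letters_natural hw))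
        (ev_natural hw (mulInv T)))
      (ev_natural hw S)) m

end Mould

namespace WordFun

/-! ### Leading terms -/

variable {Λ K : Type} [AddCommMonoid Λ] [CommRing K]

omit [AddCommMonoid Λ] in
theorem mul_apply_of_vanishBelow {S A : WordFun Λ K} {n : ℕ} (hA : VanishBelow n A) {w : List Λ}
    (hw : w.length ≤ n) : (S * A) w = S [] * A w := by
  rw [mul_apply]
  refine (splitSum_congr (B := fun a b => if a.isEmpty then S a * A b else 0)
    fun a b hab => ?_).trans ?_
  · cases a with
    | nil => simp
    | cons x a =>
      rw [hA b (by simp [← hab] at hw; omega)]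
      simp
  · rw [splitSum_eq_first]
    · simp
    · intro a b ha
      simp [ha]

omit [AddCommMonoid Λ] in
theorem apply_mul_of_vanishBelow {S A : WordFun Λ K} {n : ℕ} (hA : VanishBelow n A) {w : List Λ}
    (hw : w.length ≤ n) : (A * S) w = A w * S [] := by
  rw [mul_apply]
  refine (splitSum_congr (B := fun a b => if b.isEmpty then A a * S b else 0)
    fun a b hab => ?_).trans ?_
  · cases b with
    | nil => simp
    | cons x b =>
      rw [hA a (by simp [← hab] at hw; omega)]
      simp
  · rw [splitSum_eq_last]
    · simp
    · intro a b hb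
      simp [hb]

/-- A division with a block of two or more letters evaluates `A` on a shorter word, where it
vanishes. Only the division into single letters survives, with weight one. -/
theorem subst_apply_of_vanishBelow {L A : WordFun Λ K} (hL : ∀ x, L [x] = 1) {n : ℕ}
    (hA : VanishBelow n A) {w : List Λ} (hw : w.length ≤ n) : subst L A w = A w := by
  induction n generalizing A w with
  | zero => rw [List.length_eq_zero_iff.1 (Nat.le_zero.1 hw), subst_nil]
  | succ n ih =>
    cases w with
    | nil => rfl
    | cons x v =>
      have hs : ∀ y, VanishBelow n (shift y A) := fun y u hu => hA (y :: u) (by simpa using hu)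
      rw [List.length_cons] at hw
      rw [subst_cons]
      refine (splitSum_congr (B := fun b c => if b.isEmpty then A (x :: c) else 0)
        fun b c hbc => ?_).trans ?_
      · have hl : b.length + c.length = v.length := by rw [← hbc, List.length_append]
        rw [ih (hs _) (by omega)]
        cases b with
        | nil => simp [hL]
        | cons y b =>
          rw [List.length_cons] at hl
          rw [hs _ c (by omega)]
          simp
      · rw [splitSum_eq_first]
        · simp
        · intro a b ha
          simp [ha]

theorem der_apply_of_vanishBelow {L : WordFun Λ K} {n : ℕ} (hL : VanishBelow n L)
    (F : WordFun Λ K) {w : List Λ} (hw : w.length < n) : der L F w = 0 := by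
  induction w generalizing F with
  | nil => rfl
  | cons x v ih =>
    rw [List.length_cons] at hw
    rw [der_cons, ih _ (by omega), zero_add]
    refine splitSum_eq_zero fun b c hbc => ?_
    have hl : b.length + c.length = v.length := by rw [← hbc, List.length_append]
    rw [hL _ (by simp; omega), zero_mul]

theorem pre_add_left (A B F : WordFun Λ K) : pre (A + B) F = pre A F + pre B F := by
  have h : bracket (A + B) = bracket A + bracket B := by
    simp only [bracket, add_mul, mul_add]
    abel
  ext w
  simp only [pre_apply, add_apply, mul_add, h, der_add_left]
  ring

theorem pre_apply_of_vanishBelow {A : WordFun Λ K} {n : ℕ} (hA : VanishBelow n A)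
    (F : WordFun Λ K) {w : List Λ} (hw : w.length ≤ n) : pre A F w = F [] * A w := by
  rw [pre_apply, add_apply, der_apply_of_vanishBelow (vanishBelow_bracket hA) F (by omega),
    zero_add, mul_apply_of_vanishBelow hA hw]

theorem subst_letters_left (F : WordFun Λ K) : subst letters F = F := by
  have hV : Closed (Set.univ : Set (List Λ)) := ⟨by simp, by simp, by simp⟩
  have h := res_hom_congr hV (rowFinite_subst letters) RowFinite.one
    (subst_one _) rfl (subst_mul _) (fun _ _ => rfl) (subst_scale _) (fun _ _ => rfl)
    (by rw [subst_letters letters_nil]; rfl) F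
  ext w
  exact (res_eq hV).1 h w trivial

/-- The contribution of `A - A'` starts with its product by `G []`, which vanishes, and the
contribution of `G - G'` is raised by `pre A'`; both gain one length. -/
theorem pre_sub_vanishBelow {A A' G G' : WordFun Λ K} {n : ℕ} (hA' : A' [] = 0)
    (hG : G [] = 0) (hAA : VanishBelow n (A - A')) (hGG : VanishBelow n (G - G')) :
    VanishBelow (n + 1) (pre A G - pre A' G') := by
  have h1 : pre A G - pre A' G' = pre (A - A') G + pre A' (G - G') := by
    have h2 := pre_add_left (A - A') A' G
    rw [sub_add_cancel] at h2
    rw [h2, map_sub]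
    abel
  intro w hw
  rw [h1, add_apply, pre_apply_of_vanishBelow hAA G (by omega), hG, zero_mul,
    raising_pre hA' n _ hGG w hw, add_zero]

end WordFun

open WordFun

/-- In the first length where `A` and `A'` may differ, the powers from the second on still agree, so
only the linear terms of the exponentials contribute. -/
theorem expPre_sub_apply {Λ K : Type} [AddCommMonoid Λ] [Field K] {A A' : WordFun Λ K} {n : ℕ}
    (hA : A [] = 0) (hA' : A' [] = 0) (h : VanishBelow (n + 1) (A - A')) {w : List Λ}
    (hw : w.length = n + 1) : expPre A w - expPre A' w = A w - A' w := by
  have hpow : ∀ k, VanishBelow (n + 1) ((pre A ^ (k + 1)) 1 - (pre A' ^ (k + 1)) 1) ∧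
      VanishBelow (n + 2) ((pre A ^ (k + 2)) 1 - (pre A' ^ (k + 2)) 1) := by
    have hstep : ∀ k, VanishBelow (n + 1) ((pre A ^ (k + 1)) 1 - (pre A' ^ (k + 1)) 1) →
        VanishBelow (n + 2) ((pre A ^ (k + 2)) 1 - (pre A' ^ (k + 2)) 1) := by
      intro k hk
      rw [pow_succ' _ (k + 1), pow_succ' _ (k + 1)]
      exact pre_sub_vanishBelow hA' ((raising_pre hA).pow (k + 1) 1 [] (by simp)) h hk
    intro k
    induction k with
    | zero =>
      have h1 : VanishBelow (n + 1) ((pre A ^ (0 + 1)) 1 - (pre A' ^ (0 + 1)) 1) := by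
        simpa [pre_one] using h
      exact ⟨h1, hstep 0 h1⟩
    | succ k ih =>
      have h1 : VanishBelow (n + 1) ((pre A ^ (k + 1 + 1)) 1 - (pre A' ^ (k + 1 + 1)) 1) :=
        fun v hv => ih.2 v (by omega)
      exact ⟨h1, hstep (k + 1) h1⟩
  change ∑ k ∈ Finset.range (w.length + 1), ((k.factorial : K)⁻¹ • (pre A ^ k) 1) w
    - ∑ k ∈ Finset.range (w.length + 1), ((k.factorial : K)⁻¹ • (pre A' ^ k) 1) w = _
  rw [← Finset.sum_sub_distrib, hw, Finset.sum_range_succ', Finset.sum_range_succ',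
    Finset.sum_eq_zero]
  · simp [pre_one]
  · intro k _
    rw [WordFun.smul_apply, WordFun.smul_apply, ← mul_sub, ← WordFun.sub_apply, (hpow k).2 w (by omega), mul_zero]

namespace Mould

/-! ## Triangular equations between moulds -/

/-- A map on moulds is unitriangular if the difference of two values in length `m` is the
difference of the arguments in length `m`, provided that these agree in smaller lengths. -/
def Unitriangular (Ψ : Mould → Mould) : Prop :=
  ∀ M N m, (∀ k < m, M k = N k) → Ψ M m - Ψ N m = M m - N m

/-- A solution is a fixed point of `Φ M = M + C - Ψ M`, whose component in length `m` depends only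
on smaller lengths; the iterates of `Φ` stabilise in each length. -/
theorem Unitriangular.surjective {Ψ : Mould → Mould} (h : Unitriangular Ψ) :
    Function.Surjective Ψ := by
  intro C
  let Φ : Mould → Mould := fun M => M + C - Ψ M
  have hΦ : ∀ M N m, (∀ k < m, M k = N k) → Φ M m = Φ N m := by
    intro M N m hMN
    have h1 := h M N m hMN
    change M m + C m - Ψ M m = N m + C m - Ψ N m
    linear_combination -h1
  let X : ℕ → Mould := fun n => Φ^[n] 0
  have hX : ∀ n, X (n + 1) = Φ (X n) := fun n => Function.iterate_succ_apply' Φ n 0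
  have hstep : ∀ n, ∀ k < n, X (n + 1) k = X n k := by
    intro n
    induction n with
    | zero => intro k hk; omega
    | succ n ih =>
      intro k hk
      rw [hX (n + 1), hX n]
      refine hΦ _ _ k fun j hj => ?_
      rw [← hX]
      exact ih j (by omega)
  have hstab : ∀ m d, X (m + 1 + d) m = X (m + 1) m := by
    intro m d
    induction d with
    | zero => rfl
    | succ d ih => rw [← add_assoc, hstep (m + 1 + d) m (by omega), ih]
  let M : Mould := fun m => X (m + 1) m
  refine ⟨M, ?_⟩
  ext m
  have h1 : Φ M m = Φ (X m) m := by
    refine hΦ _ _ m fun k hk => ?_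
    obtain ⟨d, rfl⟩ := Nat.exists_eq_add_of_le (Nat.succ_le_of_lt hk)
    exact (hstab k d).symm
  rw [← hX] at h1
  have h2 : M m + C m - Ψ M m = M m := h1
  linear_combination -h2

theorem vanishBelow_ev_sub {M N : Mould} {n : ℕ} (m : ℕ) (h : ∀ k < n, M k = N k) :
    VanishBelow n (ev m M - ev m N) := by
  intro w hw
  rw [WordFun.sub_apply, sub_eq_zero]
  exact eval_congr (h _ hw)

theorem ev_xWord (M : Mould) (m : ℕ) : ev m M (xWord m) = M m := eval_xWord M

/-- The usual argument that left inverses for all elements are two-sided. It serves for both group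
laws on GARI. -/
theorem exists_left_inverse {G : Set Mould} {op : Mould → Mould → Mould} {e : Mould}
    (hop : ∀ S ∈ G, ∀ T ∈ G, op S T ∈ G)
    (hassoc : ∀ S ∈ G, ∀ T ∈ G, ∀ U ∈ G, op (op S T) U = op S (op T U))
    (hl : ∀ S ∈ G, op e S = S)
    (hinv : ∀ S ∈ G, ∃ T ∈ G, op T S = e) {S : Mould} (hS : S ∈ G) :
    ∃ T, T ∈ G ∧ op S T = e ∧ op T S = e := by
  obtain ⟨T, hT, hTS⟩ := hinv S hS
  obtain ⟨U, hU, hUT⟩ := hinv T hT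
  refine ⟨T, hT, ?_, hTS⟩
  rw [← hl _ (hop S hS T hT), ← hUT, hassoc U hU T hT _ (hop S hS T hT), ← hassoc T hT S hS T hT,
    hTS, hl T hT]

theorem mul_zero_apply (M N : Mould) : mul M N 0 = M 0 * N 0 := by
  rw [mul_eq]
  change (ev 0 M * ev 0 N) [] = _
  rw [mul_nil]
  exact congrArg₂ _ (eval_xWord M) (eval_xWord N)

theorem unit_mem_GARI : unit ∈ GARI := rfl

theorem mul_mem_GARI {S T : Mould} (hS : S ∈ GARI) (hT : T ∈ GARI) : mul S T ∈ GARI := by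
  change mul S T 0 = 1
  rw [mul_zero_apply, show S 0 = 1 from hS, show T 0 = 1 from hT, mul_one]

theorem unitriangular_mul_right {S : Mould} (hS : S ∈ GARI) :
    Unitriangular fun M => mul M S := by
  intro M N m h
  change mul M S m - mul N S m = _
  rw [mul_eq, mul_eq, ← WordFun.sub_apply, ← sub_mul,
    apply_mul_of_vanishBelow (vanishBelow_ev_sub m h) (xWord_length m).le,
    ev_nil_of_mem_GARI hS, mul_one, WordFun.sub_apply, ev_xWord, ev_xWord]

theorem mulInv_spec {T : Mould} (hT : T ∈ GARI) :
    mulInv T ∈ GARI ∧ mul T (mulInv T) = unit ∧ mul (mulInv T) T = unit := by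
  refine Classical.epsilon_spec (p := fun T' => T' ∈ GARI ∧ mul T T' = unit ∧ mul T' T = unit) ?_
  refine exists_left_inverse (fun S hS T hT => mul_mem_GARI hS hT)
    (fun S _ T _ U _ => mul_assoc' S T U) (fun S _ => unit_mul S)
    (fun S hS => ?_) hT
  obtain ⟨T, h⟩ := (unitriangular_mul_right hS).surjective unit
  refine ⟨T, ?_, h⟩
  have h0 := congrFun h 0
  change mul T S 0 = 1 at h0
  rw [mul_zero_apply, show S 0 = 1 from hS, mul_one] at h0
  exact h0

theorem mulInv_mem {T : Mould} (hT : T ∈ GARI) : mulInv T ∈ GARI := (mulInv_spec hT).1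

theorem cls_mul_mulInv {T : Mould} (hT : T ∈ GARI) (m : ℕ) :
    cls m T * cls m (mulInv T) = 1 := by
  rw [← cls_mul, (mulInv_spec hT).2.1, cls_unit]

theorem cls_mulInv_mul {T : Mould} (hT : T ∈ GARI) (m : ℕ) :
    cls m (mulInv T) * cls m T = 1 := by
  rw [← cls_mul, (mulInv_spec hT).2.2, cls_unit]

/-! ## The group `(GARI, gari)` -/

theorem gari_eq (S T : Mould) (hS : S ∈ GARI) : gari S T = mul (garitLin T S) T := by
  rw [gari, garitLin_of_mem_GARI T hS]

theorem cls_garitLin_mul {T : Mould} (hT : T ∈ GARI) (S : Mould) (m : ℕ) :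
    cls m (mul (garitLin T S) T)
      = res closed_indepWords (subst (conjLetters m T) (ev m S)) * cls m T := by
  rw [cls_mul, cls_garitLin hT (mulInv_mem hT)]

theorem garitLin_zero_apply (T S : Mould) : garitLin T S 0 = S 0 := rfl

theorem gari_mem {S T : Mould} (hS : S ∈ GARI) (hT : T ∈ GARI) : gari S T ∈ GARI := by
  rw [gari_eq S T hS]
  exact mul_mem_GARI hS hT

/-- Associativity amounts to the composition law `res_subst_comp` of the endomorphisms attached to
`T`, `U` and `gari T U`. -/
theorem gari_assoc {S T U : Mould} (hS : S ∈ GARI) (hT : T ∈ GARI) (hU : U ∈ GARI) :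
    gari (gari S T) U = gari S (gari T U) := by
  refine ext_cls fun m => ?_
  have hTU := gari_mem hT hU
  have h1 : cls m (gari T U) = res closed_indepWords
      (subst (conjLetters m U) (ev m T) * ev m U) := by
    rw [gari_eq T U hT, cls_garitLin_mul hU, map_mul]
    rfl
  have h2 : res closed_indepWords (ev m (gari S T)) = res closed_indepWords
      (subst (conjLetters m T) (ev m S) * ev m T) := by
    change cls m _ = _
    rw [gari_eq S T hS, cls_garitLin_mul hT, map_mul]
    rfl
  rw [gari_eq (gari S T) U (gari_mem hS hT), gari_eq S (gari T U) hS, cls_garitLin_mul hU, cls_garitLin_mul hTU,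
    res_subst_congr closed_indepWords rfl h2, subst_mul, map_mul]
  rw [show conjLetters m (gari T U) = ev m (gari T U) * letters * ev m (mulInv (gari T U)) from rfl,
    ← res_subst_comp closed_indepWords (cls_mul_mulInv hT m) (cls_mul_mulInv hU m)
      (cls_mulInv_mul hTU m) h1, h1, map_mul, mul_assoc]
  rfl

theorem unit_gari {T : Mould} (hT : T ∈ GARI) : gari unit T = T := by
  refine ext_cls fun m => ?_
  have h : res closed_indepWords (ev m unit) = res closed_indepWords 1 :=
    (cls_unit m).trans (map_one _).symm
  rw [gari_eq _ T unit_mem_GARI, cls_garitLin_mul hT, res_subst_congr closed_indepWords rfl h,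
    subst_one, map_one, one_mul]

theorem gari_unit {S : Mould} (hS : S ∈ GARI) : gari S unit = S := by
  refine ext_cls fun m => ?_
  have h : res closed_indepWords (conjLetters m unit) = res closed_indepWords letters := by
    have h1 : res closed_indepWords (ev m unit) = 1 := cls_unit m
    have h2 := cls_mul_mulInv unit_mem_GARI m
    rw [cls_unit, one_mul] at h2
    rw [conjLetters, map_mul, map_mul, h1, one_mul]
    exact (congrArg _ h2).trans (mul_one _)
  rw [gari_eq S _ hS, cls_garitLin_mul unit_mem_GARI, res_subst_congr closed_indepWords h rfl,
    subst_letters_left, cls_unit, mul_one]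
  rfl

theorem conjLetters_singleton {S : Mould} (hS : S ∈ GARI) (m : ℕ) (x : LinForm m) :
    conjLetters m S [x] = 1 := by
  have h : (ev m S * letters : WordFun (LinForm m) (Lau m)) [x] = ev m S [] :=
    mul_letters_concat (ev m S) [] x
  rw [conjLetters, mul_cons, mul_nil, mul_nil, shift_apply, h, ev_nil_of_mem_GARI hS,
    ev_nil_of_mem_GARI (mulInv_mem hS)]
  simp

theorem mul_garitLin_eq {S : Mould} (hS : S ∈ GARI) (B : Mould) (m : ℕ) :
    mul (garitLin S B) S m = (subst (conjLetters m S) (ev m B) * ev m S) (xWord m) := by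
  rw [← eval_xWord (mul (garitLin S B) S)]
  refine cls_eq_iff.1 ?_ _ (xWord_mem m)
  rw [cls_garitLin_mul hS, map_mul]
  rfl

theorem unitriangular_garitLin_mul {S : Mould} (hS : S ∈ GARI) :
    Unitriangular fun M => mul (garitLin S M) S := by
  intro M N m h
  change mul (garitLin S M) S m - mul (garitLin S N) S m = _
  have hv := vanishBelow_ev_sub m h
  have hL := conjLetters_singleton hS m
  have hv' : VanishBelow m (subst (conjLetters m S) (ev m M - ev m N)) := fun w hw => by
    rw [subst_apply_of_vanishBelow hL hv hw.le, hv w hw]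
  rw [mul_garitLin_eq hS, mul_garitLin_eq hS, ← WordFun.sub_apply, ← sub_mul, ← map_sub,
    apply_mul_of_vanishBelow hv' (xWord_length m).le,
    subst_apply_of_vanishBelow hL hv (xWord_length m).le, ev_nil_of_mem_GARI hS, mul_one,
    WordFun.sub_apply, ev_xWord, ev_xWord]

theorem invgari_spec {S : Mould} (hS : S ∈ GARI) :
    invgari S ∈ GARI ∧ gari S (invgari S) = unit ∧ gari (invgari S) S = unit := by
  refine Classical.epsilon_spec (p := fun T => T ∈ GARI ∧ gari S T = unit ∧ gari T S = unit) ?_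
  refine exists_left_inverse (fun S hS T hT => gari_mem hS hT)
    (fun S hS T hT U hU => gari_assoc hS hT hU) (fun S hS => unit_gari hS)
    (fun S hS => ?_) hS
  obtain ⟨T, h⟩ := (unitriangular_garitLin_mul hS).surjective unit
  have hT : T ∈ GARI := by
    have h0 := congrFun h 0
    change mul (garitLin S T) S 0 = 1 at h0
    rw [mul_zero_apply, show S 0 = 1 from hS, mul_one] at h0
    exact h0
  exact ⟨T, hT, (gari_eq T S hT).trans h⟩

/-! ## The exponential -/

theorem cls_preariPow {A : Mould} (hA : A ∈ ARI) (n m : ℕ) :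
    cls m (preariPow A n) = res closed_indepWords ((pre (ev m A) ^ n) 1) := by
  match n with
  | 0 => exact (cls_unit m).trans (map_one _).symm
  | 1 => rw [pow_one, pre_one]; rfl
  | n + 2 =>
    rw [preariPow, cls_preari hA, pow_succ', Module.End.mul_apply]
    exact res_pre_congr _ rfl (cls_preariPow hA (n + 1) m)

theorem cls_expari {A : Mould} (hA : A ∈ ARI) (m : ℕ) :
    cls m (expari A) = res closed_indepWords (expPre (ev m A)) := by
  refine cls_eq_iff.2 fun w hw => ?_
  rw [eval_eq_hom hw, expari, map_sum]
  refine Finset.sum_congr rfl fun n _ => ?_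
  rw [WordFun.smul_apply, ← cls_eq_iff.1 (cls_preariPow hA n m) w hw, eval_eq_hom hw, rat_smul_eq,
    map_mul]
  simp

theorem expari_mem (A : Mould) : expari A ∈ GARI := by
  change expari A 0 = 1
  simp [expari, preariPow, unit]

theorem expari_injOn : Set.InjOn expari ARI := by
  intro A hA A' hA' h
  ext m
  induction m using Nat.strong_induction_on with
  | _ m ih =>
  cases m with
  | zero => exact (show A 0 = 0 from hA).trans (show A' 0 = 0 from hA').symm
  | succ n =>
    have h1 := expPre_sub_apply (ev_nil_of_mem_ARI hA (n + 1)) (ev_nil_of_mem_ARI hA' (n + 1))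
      (vanishBelow_ev_sub (n + 1) ih) (xWord_length (n + 1))
    rw [← cls_eq_iff.1 (cls_expari hA (n + 1)) _ (xWord_mem _),
      ← cls_eq_iff.1 (cls_expari hA' (n + 1)) _ (xWord_mem _), h, sub_self, ev_xWord,
      ev_xWord] at h1
    exact (sub_eq_zero.1 h1.symm)

theorem logari_expari {A : Mould} (hA : A ∈ ARI) : logari (expari A) = A := by
  have h := Classical.epsilon_spec (p := fun A' => A' ∈ ARI ∧ expari A' = expari A) ⟨A, hA, rfl⟩
  exact expari_injOn h.1 hA h.2

/-! ## The adjoint action -/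

/-- The relation `gari(B, S) = preari(S, A)` that characterizes `B = adari(S)(A)`. -/
def AdRel (S A B : Mould) : Prop := mul (garitLin S B) S = preari S A

theorem cls_garitLin_mul_eq {S A B : Mould} (hS : S ∈ GARI) (hA : A ∈ ARI)
    (h : AdRel S A B) (m : ℕ) :
    res closed_indepWords (subst (conjLetters m S) (ev m B)) * cls m S
      = res closed_indepWords (pre (ev m A) (ev m S)) := by
  rw [← cls_garitLin_mul hS, h, cls_preari hA]

/-- Exponentiating the linear relation gives `gari (expari B) S = gari S (expari A)`; then `S` is
cancelled in the group and `logari` undoes `expari`. -/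
theorem adari_eq {S A B : Mould} (hS : S ∈ GARI) (hA : A ∈ ARI) (hB : B ∈ ARI)
    (h : AdRel S A B) : adari S A = B := by
  have hconj : gari (expari B) S = gari S (expari A) := by
    refine ext_cls fun m => ?_
    have := charZero_lau m
    have hE := expari_mem A
    have h1 : res closed_indepWords (conjLetters m (expari A)) = res closed_indepWords
        (expPre (ev m A) * letters * ev m (mulInv (expari A))) := by
      rw [conjLetters, map_mul, map_mul, map_mul, map_mul, ← cls_expari hA]
      rfl
    have h2 : res closed_indepWords (expPre (ev m A))
        * res closed_indepWords (ev m (mulInv (expari A))) = 1 := by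
      rw [← cls_expari hA]
      exact cls_mul_mulInv hE m
    rw [gari_eq _ S (expari_mem B), gari_eq S _ hS, cls_garitLin_mul hS, cls_garitLin_mul hE,
      res_subst_congr closed_indepWords rfl (cls_expari hB m),
      res_subst_congr closed_indepWords h1 rfl, cls_expari hA]
    exact res_expPre_conj closed_indepWords (cls_mul_mulInv hS m) (cls_mulInv_mul hS m)
      (ev_nil_of_mem_ARI hA m) (ev_nil_of_mem_ARI hB m) h2 (cls_garitLin_mul_eq hS hA h m)
  have hi := invgari_spec hS
  rw [adari, ← hconj, gari_assoc (expari_mem B) hS hi.1, hi.2.1, gari_unit (expari_mem B),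
    logari_expari hB]

theorem preari_zero_apply (S A : Mould) : preari S A 0 = S 0 * A 0 := by
  rw [preari, Pi.add_apply, mul_zero_apply]
  simp [arit, xWord, triples, splits]

theorem exists_adRel {S A : Mould} (hS : S ∈ GARI) (hA : A ∈ ARI) :
    ∃ B ∈ ARI, AdRel S A B := by
  obtain ⟨B, h⟩ := (unitriangular_garitLin_mul hS).surjective (preari S A)
  refine ⟨B, ?_, h⟩
  have h0 := congrFun h 0
  change mul (garitLin S B) S 0 = _ at h0
  rw [mul_zero_apply, preari_zero_apply, show S 0 = 1 from hS, show A 0 = 0 from hA, mul_one,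
    mul_zero] at h0
  exact h0

theorem preari_eq {A : Mould} (hA : A ∈ ARI) (S : Mould) (m : ℕ) :
    preari S A m = pre (ev m A) (ev m S) (xWord m) := by
  rw [← eval_xWord (preari S A)]
  exact cls_eq_iff.1 (cls_preari hA S m) _ (xWord_mem m)

theorem preari_sub_apply {S A A' : Mould} (hS : S ∈ GARI) (hA : A ∈ ARI) (hA' : A' ∈ ARI)
    {m : ℕ} (h : ∀ k < m, A k = A' k) : preari S A m - preari S A' m = A m - A' m := by
  have h1 := pre_add_left (ev m A - ev m A') (ev m A') (ev m S)
  rw [sub_add_cancel] at h1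
  rw [preari_eq hA, preari_eq hA', h1, WordFun.add_apply, add_sub_cancel_right,
    pre_apply_of_vanishBelow (vanishBelow_ev_sub m h) _ (xWord_length m).le,
    ev_nil_of_mem_GARI hS, one_mul, WordFun.sub_apply, ev_xWord, ev_xWord]

theorem exists_adRel_right {S B : Mould} (hS : S ∈ GARI) (hB : B ∈ ARI) :
    ∃ A ∈ ARI, AdRel S A B := by
  -- The description of `preari` by operators needs `A` in ARI, so the constant term is cut off.
  -- Adding back `A - t A` keeps the map unitriangular in length zero and forces the solution into
  -- ARI.
  let t : Mould → Mould := fun A => Function.update A 0 0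
  have ht : ∀ A, t A ∈ ARI := fun A => Function.update_self 0 0 A
  have ht' : ∀ A m, m ≠ 0 → t A m = A m := fun A m hm => Function.update_of_ne hm _ _
  have hΨ : Unitriangular fun A => A - t A + preari S (t A) := by
    intro M N m h
    have h1 : ∀ k < m, t M k = t N k := by
      intro k hk
      rcases Nat.eq_zero_or_pos k with rfl | hk0
      · exact (ht M).trans (ht N).symm
      · rw [ht' M k hk0.ne', ht' N k hk0.ne', h k hk]
    have h2 := preari_sub_apply hS (ht M) (ht N) h1
    simp only [Pi.add_apply, Pi.sub_apply]
    linear_combination h2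
  obtain ⟨A, h⟩ := hΨ.surjective (mul (garitLin S B) S)
  have hA0 : A ∈ ARI := by
    have h0 := congrFun h 0
    simp only [Pi.add_apply, Pi.sub_apply] at h0
    rw [mul_zero_apply, preari_zero_apply, show t A 0 = 0 from ht A, garitLin_zero_apply,
      show B 0 = 0 from hB] at h0
    change A 0 = 0
    simpa using h0
  have htA : t A = A := by
    ext m
    rcases Nat.eq_zero_or_pos m with rfl | hm
    · exact (ht A).trans hA0.symm
    · exact ht' A m hm.ne'
  refine ⟨A, hA0, ?_⟩
  simp only [htA, sub_self, zero_add] at h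
  exact h.symm

/-- Both sides of the relation are additive in `B` and in `A`, a fact hidden by the exponentials in
the definition of `adari`. -/
theorem AdRel.add {S A B A' B' : Mould} (hS : S ∈ GARI) (hA : A ∈ ARI) (hA' : A' ∈ ARI)
    (h : AdRel S A B) (h' : AdRel S A' B') : AdRel S (A + A') (B + B') := by
  have hAA : A + A' ∈ ARI := by
    change A 0 + A' 0 = 0
    rw [show A 0 = 0 from hA, show A' 0 = 0 from hA', add_zero]
  refine ext_cls fun m => ?_
  have hadd : ∀ M N : Mould, res closed_indepWords (ev m (M + N))
      = res closed_indepWords (ev m M + ev m N) := fun M N => by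
    rw [map_add]
    exact cls_add M N m
  rw [cls_garitLin_mul hS, cls_preari hAA, res_subst_congr closed_indepWords rfl (hadd B B'),
    res_pre_congr closed_indepWords (hadd A A') rfl, pre_add_left, map_add, map_add, map_add,
    add_mul, cls_garitLin_mul_eq hS hA h, cls_garitLin_mul_eq hS hA' h']

/-- In each length both sides have the new component as leading term, so by induction `B` up to
length `N` is determined by `A` up to length `N`. -/
theorem AdRel.apply_eq {S A A' B B' : Mould} (hS : S ∈ GARI) (hA : A ∈ ARI) (hA' : A' ∈ ARI)
    (h : AdRel S A B) (h' : AdRel S A' B') {N : ℕ} (hAA : ∀ k ≤ N, A k = A' k) :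
    ∀ m ≤ N, B m = B' m := by
  intro m
  induction m using Nat.strong_induction_on with
  | _ m ih =>
  intro hm
  have h1 := unitriangular_garitLin_mul hS B B' m fun k hk => ih k hk (by omega)
  have h2 := preari_sub_apply hS hA hA' (m := m) fun k hk => hAA k (by omega)
  simp only [show mul (garitLin S B) S = preari S A from h,
    show mul (garitLin S B') S = preari S A' from h'] at h1
  rw [h1, hAA m hm, sub_self] at h2
  exact sub_eq_zero.1 h2

theorem leng_mem_ARI {r : ℕ} (hr : 1 ≤ r) (M : Mould) : leng r M ∈ ARI := by
  change (if 0 = r then M 0 else 0) = 0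
  rw [if_neg (by omega)]

/-- The adjoint action is compatible with the decomposition of a mould into its components. -/
theorem isSum_adari_leng {S B : Mould} (hS : S ∈ GARI) (hB : B ∈ ARI) :
    IsSum (fun r => adari S (leng r (adariInv S B))) B := by
  have hex : ∃ A, A ∈ ARI ∧ adari S A = B := by
    obtain ⟨A, hA, h⟩ := exists_adRel_right hS hB
    exact ⟨A, hA, adari_eq hS hA hB h⟩
  obtain ⟨hC, hCB⟩ := Classical.epsilon_spec hex
  change adariInv S B ∈ ARI at hC
  change adari S (adariInv S B) = B at hCB
  set C := adariInv S B
  -- Every element of ARI has a partner in the relation, and `adari_eq` identifies that partner with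
  -- `B`.
  have hrel : AdRel S C B := by
    obtain ⟨B', hB', h⟩ := exists_adRel hS hC
    rw [← hCB, adari_eq hS hC hB' h]
    exact h
  have hr : ∀ N, (∑ r ∈ Finset.Icc 1 N, leng r C) ∈ ARI ∧
      AdRel S (∑ r ∈ Finset.Icc 1 N, leng r C) (∑ r ∈ Finset.Icc 1 N, adari S (leng r C)) := by
    intro N
    induction N with
    | zero =>
      have h0 : (0 : Mould) ∈ ARI := rfl
      refine ⟨h0, ?_⟩
      have hz : ∀ m, res closed_indepWords (ev m 0) = res closed_indepWords 0 :=
        fun m => (cls_zero m).trans (map_zero _).symm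
      refine ext_cls fun m => ?_
      have hp : pre (0 : WordFun (LinForm m) (Lau m)) (ev m S) = 0 := by
        have := pre_add_left 0 0 (ev m S)
        rw [add_zero] at this
        exact left_eq_add.1 this
      change cls m (mul (garitLin S 0) S) = cls m (preari S 0)
      rw [cls_garitLin_mul hS, cls_preari h0, res_subst_congr closed_indepWords rfl (hz m),
        res_pre_congr closed_indepWords (hz m) rfl, map_zero, map_zero, zero_mul, hp, map_zero]
    | succ N ih =>
      have hl := leng_mem_ARI (r := N + 1) (by omega) C
      rw [Finset.sum_Icc_succ_top (by omega), Finset.sum_Icc_succ_top (by omega)]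
      refine ⟨?_, AdRel.add hS ih.1 hl ih.2 ?_⟩
      · change (∑ r ∈ Finset.Icc 1 N, leng r C) 0 + leng (N + 1) C 0 = 0
        rw [show (∑ r ∈ Finset.Icc 1 N, leng r C) 0 = 0 from ih.1,
          show leng (N + 1) C 0 = 0 from hl, add_zero]
      · obtain ⟨B', hB', h⟩ := exists_adRel hS hl
        rw [adari_eq hS hl hB' h]
        exact h
  intro m
  -- The truncation of `C` at `N` agrees with `C` up to length `N`, so the partial sums are exact in
  -- length `m` from `N = m` on.
  refine ⟨m, fun N hN => ?_⟩
  have hcomp : ∀ k ≤ N, (∑ r ∈ Finset.Icc 1 N, leng r C) k = C k := by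
    intro k hk
    rw [Finset.sum_apply]
    rcases Nat.eq_zero_or_pos k with rfl | hk0
    · rw [show C 0 = 0 from hC]
      exact Finset.sum_eq_zero fun r hr => leng_mem_ARI (Finset.mem_Icc.1 hr).1 C
    · rw [Finset.sum_eq_single k]
      · simp [leng]
      · intro r _ hrk
        simp [leng, hrk.symm]
      · intro h
        exact absurd (Finset.mem_Icc.2 ⟨hk0, hk⟩) h
  have h := AdRel.apply_eq hS (hr N).1 hC (hr N).2 hrel hcomp m hN
  rw [Finset.sum_apply] at h
  exact h

end Mould

namespace WordFun

/-! ## The adjoint action of `paj` on moulds of length one -/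

section Polar

variable {Λ K : Type} [AddCommMonoid Λ] [Field K] {V : Set (List Λ)} (hV : Closed V)
  (ℓ : Λ →+ K) (hℓ : ∀ w ∈ V, w ≠ [] → ℓ w.sum ≠ 0)

-- The equation reads `ℓ (v x) F (v x) = F v`, a recursion on the last letter with invertible
-- coefficient and zero initial value.
include hℓ in
theorem res_eq_zero_of_scale_eq_mul_letters {F : WordFun Λ K} (h0 : F [] = 0)
    (h : res hV (scale ℓ F) = res hV (F * letters)) : res hV F = 0 := by
  rw [res_eq] at h
  rw [← map_zero (res hV), res_eq]
  intro w
  induction w using List.reverseRecOn with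
  | nil => exact fun _ => h0
  | append_singleton v x ih =>
    intro hw
    have h1 := h _ hw
    rw [mul_letters_concat, ih (hV.left hw), scale_apply] at h1
    exact (mul_eq_zero.1 h1).resolve_left (hℓ _ hw (by simp))

include hℓ in
theorem res_eq_one_of_scale_eq_zero {F : WordFun Λ K} (h0 : F [] = 1)
    (h : res hV (scale ℓ F) = 0) : res hV F = 1 := by
  rw [← map_zero (res hV), res_eq] at h
  rw [← map_one (res hV), res_eq]
  intro w hw
  cases w with
  | nil => exact h0
  | cons x v =>
    rw [one_cons]
    exact (mul_eq_zero.1 (h _ hw)).resolve_left (hℓ _ hw (by simp))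

include hℓ in
/-- If multiplication by `ℓ` maps `P` to `P × letters`, then the adjoint action of `P` on the
conjugate by `P` of a function of length one is described by a linear equation. -/
theorem res_subst_mul_eq_pre {P P' Q Q' Y Z : WordFun Λ K} (f : Λ → K)
    (hP : res hV P * res hV P' = 1) (hP' : res hV P' * res hV P = 1)
    (hQ' : res hV Q' * res hV Q = 1) (hP0 : P [] = 1) (hQ0 : Q [] = 1)
    (hDP : res hV (scale ℓ P) = res hV P * res hV letters)
    (hDQ : res hV (scale ℓ Q) = -(res hV Q * res hV letters))
    (hY0 : Y [] = 0) (hZ0 : Z [] = 0)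
    (hY : res hV Y = res hV P' * res hV (scale f letters) * res hV P)
    (hZ : res hV (scale ℓ Z) = res hV (scale ℓ (scale f (Q * letters * Q'))
      - (letters * scale f (Q * letters * Q') - scale f (Q * letters * Q') * letters))) :
    res hV (subst (P * letters * P') Z) * res hV P = res hV (pre Y P) := by
  obtain ⟨L, hL⟩ : ∃ L, L = P * letters * P' := ⟨_, rfl⟩
  obtain ⟨T, hT⟩ : ∃ T, T = scale f (Q * letters * Q') := ⟨_, rfl⟩
  have hL0 : L [] = 0 := by simp [hL]
  have hrL : res hV L = res hV P * res hV letters * res hV P' := by rw [hL, map_mul, map_mul]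
  rw [← hL]
  rw [← hT] at hZ
  -- Under `subst L` the equation for `Q` becomes `D Q = -Q × L`, while `D P = P × I = L × P`. The
  -- product is therefore killed by `D` and equals its constant term.
  have hQP : res hV (subst L Q) * res hV P = 1 := by
    rw [← map_mul]
    refine res_eq_one_of_scale_eq_zero hV ℓ hℓ (by simp [hP0, hQ0]) ?_
    have h1 : res hV (scale ℓ (subst L Q)) = -(res hV (subst L Q) * res hV L) := by
      have h2 : res hV (scale ℓ Q) = res hV (-(Q * letters)) := by rw [hDQ, map_neg, map_mul]
      rw [← subst_scale, res_subst_congr hV rfl h2, map_neg, subst_mul, subst_letters hL0,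
        map_neg, map_mul]
    rw [scale_mul, map_add, map_mul, map_mul, h1, hDP, hrL, neg_mul]
    simp only [mul_assoc]
    rw [hP', mul_one, neg_add_cancel]
  have hQ1 : res hV (subst L Q) = res hV P' := by
    calc _ = res hV (subst L Q) * (res hV P * res hV P') := by rw [hP, mul_one]
      _ = _ := by rw [← mul_assoc, hQP, one_mul]
  have hQ2 : res hV (subst L Q') = res hV P := by
    have h1 : res hV (subst L Q') * res hV (subst L Q) = 1 := by
      rw [← map_mul, ← subst_mul, ← map_one (res hV), ← subst_one L]
      exact res_subst_congr hV rfl (by rw [map_mul, hQ', map_one])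
    calc _ = res hV (subst L Q') * (res hV (subst L Q) * res hV P) := by rw [hQP, mul_one]
      _ = _ := by rw [← mul_assoc, h1, one_mul]
  -- The conjugate `Q × I × Q'` goes to `P' × L × P = I`, so its rescaling by `f` goes to `scale f
  -- letters`.
  have hTA : res hV (subst L T) = res hV (scale f letters) := by
    rw [hT, subst_scale]
    refine res_scale_congr hV _ ?_
    rw [subst_mul, subst_mul, subst_letters hL0, map_mul, map_mul, hQ1, hQ2, hrL]
    simp only [mul_assoc, hP']
    rw [← mul_assoc, hP', one_mul, mul_one]
  obtain ⟨A, hA⟩ : ∃ A, A = scale f (letters : WordFun Λ K) := ⟨_, rfl⟩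
  rw [← hA] at hTA hY
  have hDZ : res hV (scale ℓ (subst L Z))
      = res hV (scale ℓ A) - (res hV L * res hV A - res hV A * res hV L) := by
    rw [← subst_scale, res_subst_congr hV rfl hZ]
    simp only [map_sub, map_mul, subst_mul, subst_letters hL0, hTA, subst_scale,
      res_scale_congr hV ℓ hTA]
  rw [← map_mul, ← sub_eq_zero, ← map_sub]
  -- The difference of the two sides has no constant term; it remains to verify the homogeneous
  -- equation `D G = G × I`.
  refine res_eq_zero_of_scale_eq_mul_letters hV ℓ hℓ (by simp [hZ0, pre_apply, hY0]) ?_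
  have hPY : res hV P * res hV Y = res hV A * res hV P := by
    rw [hY, ← mul_assoc, ← mul_assoc, hP, one_mul]
  have hDPY : res hV (scale ℓ (P * Y))
      = res hV (scale ℓ A) * res hV P + res hV A * (res hV P * res hV letters) := by
    have h1 : res hV (P * Y) = res hV (A * P) := by rw [map_mul, map_mul, hPY]
    rw [res_scale_congr hV ℓ h1, scale_mul, map_add, map_mul, map_mul, hDP]
  have hder : res hV (scale ℓ (der (bracket Y) P)) = res hV (der (bracket Y) P) * res hV letters
      + (res hV A * res hV P * res hV letters - res hV L * res hV A * res hV P) := by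
    have h2 : res hV (scale ℓ P) = res hV (P * letters) := by rw [hDP, map_mul]
    rw [← der_scale, res_der_congr hV rfl h2, der_mul, der_letters (bracket_nil Y), bracket]
    simp only [map_add, map_mul, map_sub, mul_sub]
    rw [← mul_assoc (res hV P) (res hV Y), hPY, hrL]
    congr 2
    rw [hY]
    simp only [mul_assoc]
  rw [scale_sub, scale_mul, pre_apply, scale_add, map_sub, map_add, map_add, map_mul, map_mul,
    hDZ, hder, hDPY, hDP, map_mul, map_sub, map_add, map_mul, map_mul, hPY, hrL]
  simp only [sub_mul, add_mul, mul_assoc, hP', mul_one]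
  abel

end Polar

/-! ### Explicit formulas -/

section Explicit

variable {Λ K : Type} [AddCommGroup Λ] [Field K] (ℓ : Λ →+ K)

/-- The function `1 / (u₁ (u₁ + u₂) ⋯ (u₁ + ⋯ + u_k))` of a word `u`. -/
def pajFun : WordFun Λ K := fun w =>
  ∏ i ∈ Finset.range w.length, (ℓ (w.take (i + 1)).sum)⁻¹

/-- The inverse of `pajFun` with respect to the product of functions on words. -/
def pajInvFun : WordFun Λ K := fun w =>
  ∏ i ∈ Finset.range w.length, (-ℓ (w.drop i).sum)⁻¹

@[simp] theorem pajFun_nil : pajFun ℓ [] = 1 := rfl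
@[simp] theorem pajInvFun_nil : pajInvFun ℓ [] = 1 := rfl

theorem pajFun_concat (v : List Λ) (x : Λ) :
    pajFun ℓ (v ++ [x]) = pajFun ℓ v * (ℓ (v ++ [x]).sum)⁻¹ := by
  rw [pajFun, List.length_append, List.length_singleton, Finset.prod_range_succ,
    List.take_of_length_le (by simp)]
  congr 1
  refine Finset.prod_congr rfl fun i hi => ?_
  rw [List.take_append_of_le_length (by simpa using hi)]

theorem pajInvFun_cons (x : Λ) (v : List Λ) :
    pajInvFun ℓ (x :: v) = pajInvFun ℓ v * (-ℓ (x :: v).sum)⁻¹ := by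
  rw [pajInvFun, List.length_cons, Finset.prod_range_succ']
  rfl

variable {V : Set (List Λ)} (hV : Closed V) (hℓ : ∀ w ∈ V, w ≠ [] → ℓ w.sum ≠ 0)

include hℓ in
theorem res_scale_pajFun :
    res hV (scale ℓ (pajFun ℓ)) = res hV (pajFun ℓ) * res hV letters := by
  rw [← map_mul, res_eq]
  intro w hw
  rcases List.eq_nil_or_concat w with rfl | ⟨v, x, rfl⟩
  · simp
  · rw [List.concat_eq_append] at hw ⊢
    rw [mul_letters_concat, scale_apply, pajFun_concat, mul_left_comm,
      mul_inv_cancel₀ (hℓ _ hw (by simp)), mul_one]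

include hℓ in
theorem res_scale_pajInvFun :
    res hV (scale ℓ (pajInvFun ℓ)) = -(res hV letters * res hV (pajInvFun ℓ)) := by
  rw [← map_mul, ← map_neg, res_eq]
  intro w hw
  cases w with
  | nil => simp
  | cons x v =>
    have h := hℓ _ hw (by simp)
    rw [neg_apply, letters_mul_cons, scale_apply, pajInvFun_cons]
    field_simp

-- `D` applied to the product gives `P × I × P'` twice with opposite signs, so only the constant
-- term remains.
include hℓ in
theorem res_pajFun_mul_pajInvFun : res hV (pajFun ℓ) * res hV (pajInvFun ℓ) = 1 := by
  rw [← map_mul]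
  refine res_eq_one_of_scale_eq_zero hV ℓ hℓ (by simp) ?_
  rw [scale_mul, map_add, map_mul, map_mul, res_scale_pajFun ℓ hV hℓ,
    res_scale_pajInvFun ℓ hV hℓ]
  noncomm_ring

theorem mul_scale_letters_mul_apply (F G : WordFun Λ K) (f : Λ → K) (w : List Λ) :
    (F * scale f letters * G) w
      = ∑ i ∈ Finset.range w.length, F (w.take i) * f (w.getD i 0) * G (w.drop (i + 1)) := by
  rw [mul_assoc]
  induction w generalizing F with
  | nil => simp
  | cons x v ih =>
    have h : shift x (scale f (letters : WordFun Λ K)) = f x • 1 := by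
      ext t
      cases t <;> simp
    rw [mul_cons, ih, mul_cons, h, smul_mul_assoc, one_mul, smul_apply, List.length_cons,
      Finset.sum_range_succ']
    simp
    ring

variable {w : List Λ} {x : ℕ → K} (hx : ∀ a ≤ w.length, x a = ℓ (w.take a).sum)
include hx

theorem map_sum_drop_take {i j : ℕ} (hij : i ≤ j) (hj : j ≤ w.length) :
    ℓ ((w.take j).drop i).sum = x j - x i := by
  rw [hx j hj, hx i (hij.trans hj), eq_sub_iff_add_eq, ← map_add, add_comm, ← List.sum_append]
  congr 2
  conv_rhs => rw [← List.take_append_drop i (w.take j), List.take_take, min_eq_left hij]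

/-- The partial sums of the factor between positions `i` and `j` are the differences `x a - x i`. -/
theorem pajFun_drop_take {i j : ℕ} (hij : i ≤ j) (hj : j ≤ w.length) :
    pajFun ℓ ((w.take j).drop i) = (∏ a ∈ Finset.Icc (i + 1) j, (x a - x i))⁻¹ := by
  have hl : ((w.take j).drop i).length = j - i := by simp [hj]
  have hI : Finset.Icc (i + 1) j = Finset.Ico (i + 1) (j + 1) := by
    ext a
    simp only [Finset.mem_Icc, Finset.mem_Ico]
    omega
  rw [pajFun, hl, ← Finset.prod_inv_distrib, hI, Finset.prod_Ico_eq_prod_range,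
    show j + 1 - (i + 1) = j - i by omega]
  refine Finset.prod_congr rfl fun k hk => ?_
  rw [Finset.mem_range] at hk
  have h1 : ((w.take j).drop i).take (k + 1) = (w.take (i + 1 + k)).drop i := by
    rw [List.take_drop, List.take_take, min_eq_left (by omega)]
    congr 2
    omega
  rw [h1, map_sum_drop_take ℓ hx (by omega) (by omega)]

theorem pajInvFun_drop_take {i j : ℕ} (hij : i ≤ j) (hj : j ≤ w.length) :
    pajInvFun ℓ ((w.take j).drop i) = (∏ a ∈ Finset.Ico i j, (x a - x j))⁻¹ := by
  have hl : ((w.take j).drop i).length = j - i := by simp [hj]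
  rw [pajInvFun, hl, ← Finset.prod_inv_distrib, Finset.prod_Ico_eq_prod_range]
  refine Finset.prod_congr rfl fun k hk => ?_
  rw [Finset.mem_range] at hk
  rw [List.drop_drop, map_sum_drop_take ℓ hx (by omega) hj, neg_sub]

end Explicit


/-! ### The polar solution as a function on words -/

section PolarSolution

variable {Λ K : Type} [Field K]

theorem letters_mul_apply (F : WordFun Λ K) {w : List Λ} (hw : w ≠ []) :
    (letters * F : WordFun Λ K) w = F (w.drop 1) := by
  cases w with
  | nil => exact absurd rfl hw
  | cons x v => exact letters_mul_cons F x v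

theorem mul_letters_apply (F : WordFun Λ K) {w : List Λ} (hw : w ≠ []) :
    (F * letters : WordFun Λ K) w = F (w.take (w.length - 1)) := by
  rcases List.eq_nil_or_concat w with rfl | ⟨v, x, rfl⟩
  · exact absurd rfl hw
  · rw [List.concat_eq_append, mul_letters_concat]
    simp

variable [AddCommGroup Λ]

theorem mul_letters_mul_apply (F G : WordFun Λ K) (w : List Λ) :
    (F * letters * G : WordFun Λ K) w
      = ∑ i ∈ Finset.range w.length, F (w.take i) * G (w.drop (i + 1)) := by
  have h : (letters : WordFun Λ K) = scale (fun _ => 1) letters := by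
    ext w
    simp
  rw [h, mul_scale_letters_mul_apply]
  simp

/-- The product of the differences `x a - x b` for `a ∈ A` and `b ∈ B`. -/
def diffProd (x : ℕ → K) (A B : Finset ℕ) : K := ∏ a ∈ A, ∏ b ∈ B, (x a - x b)

theorem diffProd_singleton (x : ℕ → K) (A : Finset ℕ) (b : ℕ) :
    diffProd x A {b} = ∏ a ∈ A, (x a - x b) := by
  simp [diffProd]

/-- The formula for the polar solution `ψ_{2n+1}` in length `d`, with values `x a` for the
variables. -/
def polarSum (n d : ℕ) (x : ℕ → K) : K :=
  ∑ i ∈ Finset.Icc 1 d,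
    ((x i - x (i - 1)) ^ (2 * n)
        / (diffProd x (Finset.range (i - 1)) {i - 1} * diffProd x (Finset.Icc (i + 1) d) {i})
      + x d ^ (2 * n)
        / (diffProd x (Finset.Icc 1 (i - 1)) {0} * diffProd x (Finset.Icc i (d - 1)) {d}))
  - ∑ i ∈ Finset.Icc 1 (d - 1),
    ((x 1 - x d) ^ (2 * n)
        / (diffProd x (Finset.Icc 2 i) {1}
            * diffProd x (insert 0 (Finset.Icc (i + 1) (d - 1))) {d})
      + x (d - 1) ^ (2 * n)
        / (diffProd x (insert d (Finset.Icc 1 (i - 1))) {0}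
            * diffProd x (Finset.Icc i (d - 2)) {d - 1}))

theorem map_diffProd {K' : Type} [Field K'] (φ : K →+* K') (x : ℕ → K) (A B : Finset ℕ) :
    φ (diffProd x A B) = diffProd (fun a => φ (x a)) A B := by
  simp [diffProd]

theorem map_polarSum {K' : Type} [Field K'] (φ : K →+* K') (n d : ℕ) (x : ℕ → K) :
    φ (polarSum n d x) = polarSum n d fun a => φ (x a) := by
  simp [polarSum, map_diffProd]

theorem sum_Icc_one {M : Type} [AddCommMonoid M] (d : ℕ) (g : ℕ → M) :
    ∑ i ∈ Finset.Icc 1 d, g i = ∑ k ∈ Finset.range d, g (k + 1) := by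
  induction d with
  | zero => simp
  | succ d ih => rw [Finset.sum_Icc_succ_top (by omega), ih, Finset.sum_range_succ]

variable (ℓ : Λ →+ K) (n : ℕ)

/-- The function `ℓ^(2n)` of the sum, times the conjugate of `letters` by `pajFun`. -/
def polarConj : WordFun Λ K :=
  scale (fun u => ℓ u ^ (2 * n)) (pajFun ℓ * letters * pajInvFun ℓ)

variable {w : List Λ} {x : ℕ → K} (hx : ∀ a ≤ w.length, x a = ℓ (w.take a).sum)
include hx

/-- When the `x a` are partial sums, the denominators are values of `pajFun` and `pajInvFun` on
factors of the word. The first terms of the first sum give the conjugate of `sa`, the second ones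
`polarConj` on the whole word. The subtracted sum gives `polarConj` on the word without its first or
its last letter, divided by the total sum. -/
theorem polarSum_eq : polarSum n w.length x
    = (pajInvFun ℓ * scale (fun u => ℓ u ^ (2 * n)) letters * pajFun ℓ) w
      + (polarConj ℓ n w + (ℓ w.sum)⁻¹
        * (polarConj ℓ n (w.drop 1) - polarConj ℓ n (w.take (w.length - 1)))) := by
  have hx0 : x 0 = 0 := by rw [hx 0 (Nat.zero_le _)]; simp
  have hxd : ℓ w.sum = x w.length := by rw [hx _ le_rfl, List.take_length]
  have hP : ∀ i ≤ w.length, pajFun ℓ (w.drop i)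
      = (∏ a ∈ Finset.Icc (i + 1) w.length, (x a - x i))⁻¹ := fun i hi => by
    have := pajFun_drop_take ℓ hx hi le_rfl
    rwa [List.take_length] at this
  have hP' : ∀ i ≤ w.length, pajInvFun ℓ (w.drop i)
      = (∏ a ∈ Finset.Ico i w.length, (x a - x w.length))⁻¹ := fun i hi => by
    have := pajInvFun_drop_take ℓ hx hi le_rfl
    rwa [List.take_length] at this
  have hI : ∀ i j, 1 ≤ j → Finset.Icc i (j - 1) = Finset.Ico i j := by
    intro i j hj
    ext a
    simp only [Finset.mem_Icc, Finset.mem_Ico]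
    omega
  simp only [polarConj, scale_apply, mul_letters_mul_apply, mul_scale_letters_mul_apply,
    List.length_drop, List.length_take, Nat.min_eq_left (Nat.sub_le _ _), Finset.mul_sum, mul_sub]
  rw [polarSum, sum_Icc_one, sum_Icc_one, Finset.sum_add_distrib, Finset.sum_add_distrib,
    add_sub_assoc]
  congr 1
  · refine Finset.sum_congr rfl fun k hk => ?_
    rw [Finset.mem_range] at hk
    have h1 : ℓ (w.getD k 0) = x (k + 1) - x k := by
      rw [← map_sum_drop_take ℓ hx (Nat.le_succ k) hk, List.drop_take, Nat.succ_eq_add_one,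
        Nat.add_sub_cancel_left, List.take_one, List.head?_drop, List.getD_eq_getElem?_getD,
        List.getElem?_eq_getElem hk]
      simp
    have h2 := pajInvFun_drop_take ℓ hx (Nat.zero_le k) hk.le
    rw [List.drop_zero, Nat.Ico_zero_eq_range] at h2
    rw [h1, h2, hP _ hk, diffProd_singleton, diffProd_singleton, Nat.add_sub_cancel, div_eq_mul_inv,
      mul_inv]
    ring
  rw [sub_eq_add_neg]
  congr 1
  · refine Finset.sum_congr rfl fun k hk => ?_
    rw [Finset.mem_range] at hk
    have h2 := pajFun_drop_take ℓ hx (Nat.zero_le k) hk.le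
    rw [List.drop_zero, zero_add] at h2
    rw [hxd, h2, hP' _ hk, diffProd_singleton, diffProd_singleton, Nat.add_sub_cancel,
      hI _ _ (by omega), div_eq_mul_inv, mul_inv]
  · rw [← Finset.sum_sub_distrib, ← Finset.sum_add_distrib, ← Finset.sum_neg_distrib]
    refine Finset.sum_congr rfl fun k hk => ?_
    rw [Finset.mem_range] at hk
    have h1 : pajFun ℓ ((w.drop 1).take k) = (∏ a ∈ Finset.Icc 2 (k + 1), (x a - x 1))⁻¹ := by
      rw [List.take_drop, add_comm 1 k]
      exact pajFun_drop_take ℓ hx (by omega) (by omega)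
    have h2 : pajInvFun ℓ ((w.drop 1).drop (k + 1))
        = (∏ a ∈ Finset.Ico (k + 2) w.length, (x a - x w.length))⁻¹ := by
      rw [List.drop_drop, add_comm 1 (k + 1)]
      exact hP' _ (by omega)
    have h3 : pajFun ℓ ((w.take (w.length - 1)).take k)
        = (∏ a ∈ Finset.Icc 1 k, (x a - x 0))⁻¹ := by
      rw [List.take_take, min_eq_left hk.le]
      exact pajFun_drop_take ℓ hx (Nat.zero_le k) (by omega)
    have h4 : pajInvFun ℓ ((w.take (w.length - 1)).drop (k + 1))
        = (∏ a ∈ Finset.Ico (k + 1) (w.length - 1), (x a - x (w.length - 1)))⁻¹ :=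
      pajInvFun_drop_take ℓ hx (by omega) (by omega)
    have h5 : ℓ (w.drop 1).sum = x w.length - x 1 := by
      rw [← map_sum_drop_take ℓ hx (by omega) le_rfl, List.take_length]
    have h6 : ℓ (w.take (w.length - 1)).sum = x (w.length - 1) := (hx _ (by omega)).symm
    -- The evenness of the exponent allows the difference to be reversed.
    have h7 : (x 1 - x w.length) ^ (2 * n) = (x w.length - x 1) ^ (2 * n) := by
      rw [← neg_sub, Even.neg_pow (even_two_mul n)]
    -- The extra index `0` contributes `-x_d`: its sign makes the term with the first letter removed
    -- appear positively, while `h9` contributes `x_d` and leaves the other term negative.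
    have h8 : diffProd x (insert 0 (Finset.Icc (k + 1 + 1) (w.length - 1))) {w.length}
        = -x w.length * ∏ a ∈ Finset.Ico (k + 2) w.length, (x a - x w.length) := by
      rw [diffProd_singleton, Finset.prod_insert (by simp), hx0, zero_sub, hI _ _ (by omega)]
    have h9 : diffProd x (insert w.length (Finset.Icc 1 (k + 1 - 1))) {0}
        = x w.length * ∏ a ∈ Finset.Icc 1 k, (x a - x 0) := by
      rw [diffProd_singleton, Nat.add_sub_cancel,
        Finset.prod_insert (by simp only [Finset.mem_Icc]; omega), hx0, sub_zero]
    have h10 : Finset.Icc (k + 1) (w.length - 2) = Finset.Ico (k + 1) (w.length - 1) :=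
      hI (k + 1) (w.length - 1) (by omega)
    rw [h1, h2, h3, h4, h5, h6, h7, h8, h9, h10, hxd, diffProd_singleton, diffProd_singleton]
    simp only [div_eq_mul_inv, mul_inv, inv_neg]
    ring

end PolarSolution

end WordFun

/-! ## Linear forms as Laurent series -/

/-- A linear form as a Laurent series. -/
def linLau (m : ℕ) : LinForm m →+ Lau m :=
  (algebraMap (MvPowerSeries (Fin m) ℚ) (Lau m)).toAddMonoidHom.comp (toSeriesHom m)

theorem linLau_single {m : ℕ} (i : Fin m) : linLau m (Pi.single i 1) = Lau.X i :=
  congrArg (algebraMap _ (Lau m)) (toSeries_single i)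

theorem substHom_linLau {k m : ℕ} {u : Fin k → LinForm m}
    (hu : Function.Injective (substSeries u)) (c : LinForm k) :
    substHom hu (linLau k c) = linLau m (push u c) :=
  (substHom_algebraMap hu c.toSeries).trans (congrArg (algebraMap _ (Lau m))
    (substSeries_toSeries u c))

theorem substHom_X {k m : ℕ} {u : Fin k → LinForm m}
    (hu : Function.Injective (substSeries u)) (i : Fin k) :
    substHom hu (Lau.X i) = linLau m (u i) := by
  rw [← linLau_single, substHom_linLau, push_single]

theorem linLau_ne_zero {m : ℕ} {v : LinForm m} (hv : v ≠ 0) : linLau m v ≠ 0 := by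
  classical
  intro h
  have h1 : v.toSeries = 0 :=
    (IsFractionRing.injective (MvPowerSeries (Fin m) ℚ) (Lau m)) (h.trans (map_zero _).symm)
  refine hv (funext fun i => ?_)
  have h2 := congrArg (MvPowerSeries.coeff (Finsupp.single i 1)) h1
  rw [LinForm.toSeries, map_sum, map_zero, Finset.sum_eq_single i] at h2
  · simpa using h2
  · intro j _ hj
    rw [map_smul, MvPowerSeries.coeff_X, if_neg, smul_zero]
    intro h3
    exact hj (Finsupp.single_left_injective one_ne_zero h3).symm
  · simp

theorem linLau_sum_ne_zero {m : ℕ} : ∀ w ∈ indepWords m, w ≠ [] → linLau m w.sum ≠ 0 :=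
  fun _ hw h => linLau_ne_zero (sum_ne_zero_of_mem_indepWords hw h)

theorem sum_take_xWord {m : ℕ} (k : ℕ) :
    ((xWord m).take k).sum = ∑ j : Fin m with j.val < k, Pi.single j 1 :=
  List.sum_take_ofFn _ k

theorem injective_partialSums {m : ℕ} : Function.Injective (substSeries
    fun i : Fin m => (∑ j ∈ Finset.Iic i, Pi.single j 1 : LinForm m)) := by
  have h : ∀ i k : Fin m, (∑ j ∈ Finset.Iic i, Pi.single j 1 : LinForm m) k
      = if k ≤ i then 1 else 0 := by
    intro i k
    simp [Finset.sum_apply, Pi.single_apply]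
  refine substSeries_injective_of_linearIndependent
    (Matrix.linearIndependent_rows_of_det_ne_zero
      (A := Matrix.of fun i : Fin m => (∑ j ∈ Finset.Iic i, Pi.single j 1 : LinForm m)) ?_)
  rw [Matrix.det_of_isLowerTriangular]
  · simp [h]
  · intro i k hik
    rw [Matrix.of_apply, h, if_neg (by simpa using hik)]

theorem sum_take_map_push {m : ℕ} (w : Word m) (v : Word w.length) (k : ℕ) :
    ((v.map (push w.get)).take k).sum = push w.get (v.take k).sum := by
  rw [← List.map_take, map_list_sum]

/-! ### The moulds `paj` and `sa` as functions on words. -/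

namespace Mould

open WordFun

theorem paj_mem_GARI : paj ∈ GARI := by
  change (1 : Lau 0) / ∏ i : Fin 0, _ = 1
  simp

theorem cls_paj (m : ℕ) : cls m paj = res closed_indepWords (pajFun (linLau m)) := by
  refine cls_eq_of_natural (fun m => pajFun (linLau m)) (fun m => ?_) (fun {m w} hw v _ => ?_) m
  · rw [pajFun, xWord_length, paj, one_div, ← Finset.prod_inv_distrib, ← Fin.prod_univ_eq_prod_range
      fun i => (linLau m ((xWord m).take (i + 1)).sum)⁻¹]
    refine Finset.prod_congr rfl fun i _ => ?_
    have h : (Finset.univ.filter fun j : Fin m => j.val < i.val + 1) = Finset.Iic i := by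
      ext j
      simp only [Finset.mem_filter, Finset.mem_univ, true_and, Finset.mem_Iic, Fin.le_def,
        Nat.lt_succ_iff]
    rw [sum_take_xWord, map_sum, h]
    simp only [linLau_single]
  · simp only [pajFun, List.length_map, map_prod, map_inv₀, sum_take_map_push, substHom_linLau]

theorem cls_mulInv_paj (m : ℕ) :
    cls m (mulInv paj) = res closed_indepWords (pajInvFun (linLau m)) := by
  have h1 := cls_mulInv_mul paj_mem_GARI m
  have h2 := res_pajFun_mul_pajInvFun (linLau m) closed_indepWords linLau_sum_ne_zero
  rw [cls_paj] at h1
  calc _ = cls m (mulInv paj) * (res closed_indepWords (pajFun (linLau m))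
        * res closed_indepWords (pajInvFun (linLau m))) := by rw [h2, mul_one]
    _ = _ := by rw [← mul_assoc, h1, one_mul]

theorem cls_sa (n m : ℕ) : cls m (sa (2 * n + 1))
    = res closed_indepWords (scale (fun u => linLau m u ^ (2 * n)) letters) := by
  refine cls_eq_iff.2 fun w hw => ?_
  rw [eval_eq_hom hw]
  match w with
  | [] => simp [sa]
  | [x] => simp [sa, substHom_X]
  | _ :: _ :: _ => simp [sa]

/-! ### The polar solution -/

/-- The partial sums of a word, as Laurent series. -/
def partialSum {m : ℕ} (w : Word m) (a : ℕ) : Lau m :=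
  if a ≤ w.length then linLau m (w.take a).sum else 0

theorem partialSum_of_le {m : ℕ} (w : Word m) : ∀ a ≤ w.length,
    partialSum w a = linLau m (w.take a).sum := fun _ h => if_pos h

theorem brownPsi_eq (n d : ℕ) : brownPsi n d = (2 : Lau d)⁻¹ * polarSum n d (brownX d) := by
  have h : ((1 / 2 : ℚ) : Lau d) = (2 : Lau d)⁻¹ := by
    have := charZero_lau d
    norm_num
  rw [polarSum, mul_sub, ← h, ← rat_smul_eq, ← rat_smul_eq]
  rfl

theorem cls_sharp_brownPsi (n m : ℕ) : cls m (sharp (brownPsi n)) = res closed_indepWords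
    (ofFun fun w => (2 : Lau m)⁻¹ * polarSum n w.length (partialSum w)) := by
  refine cls_eq_of_natural (fun m => ofFun fun w => (2 : Lau m)⁻¹ * polarSum n w.length
    (partialSum w)) (fun m => ?_) (fun {m w} hw v _ => ?_) m
  · rw [sharp, substLau_eq injective_partialSums, brownPsi_eq, ofFun_apply, map_mul, map_polarSum, xWord_length,
      map_inv₀, map_ofNat]
    congr 2
    ext a
    rw [partialSum, xWord_length, brownX]
    by_cases h1 : 1 ≤ a ∧ a ≤ m
    · rw [dif_pos h1, if_pos h1.2, substHom_X, sum_take_xWord]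
      congr 1
      refine Finset.sum_congr ?_ fun _ _ => rfl
      ext j
      simp only [Finset.mem_Iic, Fin.le_def, Finset.mem_filter, Finset.mem_univ, true_and]
      omega
    -- The remaining indices are `0`, where the partial sum is empty, and those beyond `m`, where
    -- both conventions give `0`.
    · rw [dif_neg h1, map_zero]
      split_ifs with h2
      · rw [show a = 0 by omega]
        simp
      · rfl
  · rw [ofFun_apply, ofFun_apply, map_mul, map_inv₀, map_ofNat, map_polarSum, List.length_map]
    congr 2
    ext a
    rw [partialSum, partialSum, List.length_map]
    split_ifs
    · rw [sum_take_map_push, substHom_linLau]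
    · rw [map_zero]

end Mould

/-! ## Changing the signs of all letters -/

namespace WordFun

section Reflect

variable {Λ K : Type} [AddCommGroup Λ] [CommRing K]

/-- Composition with the change of signs of all letters. -/
def reflect : WordFun Λ K →+* WordFun Λ K where
  toFun F := fun w => F (w.map Neg.neg)
  map_zero' := rfl
  map_add' _ _ := rfl
  map_one' := by
    ext w
    cases w <;> rfl
  map_mul' F G := by
    ext w
    exact splitSum_map Neg.neg (fun a b => F a * G b) w

theorem reflect_apply (F : WordFun Λ K) (w : List Λ) : reflect F w = F (w.map Neg.neg) := rfl

theorem reflect_reflect (F : WordFun Λ K) : reflect (reflect F) = F := by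
  ext w
  simp [reflect_apply]

theorem reflect_letters : reflect (letters : WordFun Λ K) = letters := by
  ext w
  match w with
  | [] => rfl
  | [_] => rfl
  | _ :: _ :: _ => rfl

theorem sum_map_neg' (w : List Λ) : (w.map Neg.neg).sum = -w.sum :=
  (map_list_sum (negAddMonoidHom : Λ →+ Λ) w).symm

theorem reflect_scale (h : Λ → K) (F : WordFun Λ K) :
    reflect (scale h F) = scale (fun u => h (-u)) (reflect F) := by
  ext w
  rw [reflect_apply, scale_apply, scale_apply, sum_map_neg', reflect_apply]

theorem reflect_scale_hom (h : Λ →+ K) (F : WordFun Λ K) :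
    reflect (scale h F) = -scale h (reflect F) := by
  rw [reflect_scale]
  ext w
  simp

theorem res_reflect_congr {K : Type} [Field K] {V : Set (List Λ)} (hV : Closed V)
    (hneg : ∀ w ∈ V, w.map Neg.neg ∈ V) {F G : WordFun Λ K} (h : res hV F = res hV G) :
    res hV (reflect F) = res hV (reflect G) := by
  rw [res_eq] at h ⊢
  exact fun w hw => h _ (hneg w hw)

end Reflect

end WordFun

theorem lincomb_map_neg {m : ℕ} (c : ℕ → ℤ) (w : Word m) :
    lincomb c (w.map Neg.neg) = -lincomb c w := by
  induction w generalizing c with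
  | nil => simp [lincomb]
  | cons x v ih => simp [lincomb, ih, add_comm]

theorem map_neg_mem_indepWords {m : ℕ} : ∀ w ∈ indepWords m, w.map Neg.neg ∈ indepWords m := by
  intro w hw c hc i hi
  rw [lincomb_map_neg, neg_eq_zero] at hc
  exact hw c hc i (by simpa using hi)

namespace Mould

open WordFun

theorem neg_eq_eval (M : Mould) (m : ℕ) : neg M m = M.eval ((xWord m).map Neg.neg) := by
  rw [xWord, List.map_ofFn, eval_ofFn]
  rfl

theorem cls_neg_mould (M : Mould) (m : ℕ) :
    cls m (neg M) = res closed_indepWords (reflect (ev m M)) := by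
  refine cls_eq_of_natural (fun m => reflect (ev m M)) (neg_eq_eval M)
    (fun {m w} hw v hv => ?_) m
  rw [reflect_apply, reflect_apply, ← ev_natural hw M _ (map_neg_mem_indepWords v hv),
    List.map_map, List.map_map]
  congr 2
  ext1 u
  simp [map_neg]

theorem neg_neg_mould (M : Mould) : neg (neg M) = M := by
  refine ext_cls fun m => ?_
  have h : res closed_indepWords (ev m (neg M)) = _ := cls_neg_mould M m
  rw [cls_neg_mould, res_reflect_congr closed_indepWords map_neg_mem_indepWords h, reflect_reflect]
  rfl

theorem neg_mem_ARI {M : Mould} (hM : M ∈ ARI) : neg M ∈ ARI := by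
  change neg M 0 = 0
  rw [neg_eq_eval]
  exact ev_nil_of_mem_ARI hM 0

/-! ## The singulator on moulds of length one -/

theorem brownPsi_zero (n : ℕ) : brownPsi n 0 = 0 := by
  rw [brownPsi_eq]
  simp [polarSum]

theorem sharp_mem_ARI {M : Mould} (hM : M ∈ ARI) : sharp M ∈ ARI := by
  change substLau _ (M 0) = 0
  rw [show M 0 = 0 from hM, substLau_eq injective_partialSums, map_zero]

/-- The conjugate `paj⁻¹ × sa_{2n+1} × paj`. -/
def conjSa (n : ℕ) : Mould := mul (mul (mulInv paj) (sa (2 * n + 1))) paj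

theorem conjSa_mem_ARI (n : ℕ) : conjSa n ∈ ARI := by
  change conjSa n 0 = 0
  rw [conjSa, mul_zero_apply, mul_zero_apply, show sa (2 * n + 1) 0 = 0 from rfl, mul_zero,
    zero_mul]

/-- The even part that the singulator adds to `conjSa n`. -/
def sangDefect (n : ℕ) : Mould := sharp (brownPsi n) + sharp (brownPsi n) - conjSa n

theorem sangDefect_mem_ARI (n : ℕ) : sangDefect n ∈ ARI := by
  have h : sharp (brownPsi n) 0 = 0 := sharp_mem_ARI (brownPsi_zero n)
  change sharp (brownPsi n) 0 + sharp (brownPsi n) 0 - conjSa n 0 = 0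
  rw [h, show conjSa n 0 = 0 from conjSa_mem_ARI n, add_zero, sub_zero]

theorem cls_conjSa (n m : ℕ) : cls m (conjSa n) = res closed_indepWords
    (pajInvFun (linLau m) * scale (fun u => linLau m u ^ (2 * n)) letters * pajFun (linLau m)) := by
  rw [conjSa, cls_mul, cls_mul, cls_paj, cls_mulInv_paj, cls_sa, map_mul, map_mul]

theorem cls_sangDefect (n m : ℕ) : cls m (sangDefect n) = res closed_indepWords
    (ofFun fun w => polarConj (linLau m) n w + (linLau m w.sum)⁻¹
      * (polarConj (linLau m) n (w.drop 1) - polarConj (linLau m) n (w.take (w.length - 1)))) := by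
  have := charZero_lau m
  rw [sangDefect, cls_sub, cls_add, cls_conjSa, cls_sharp_brownPsi, ← map_add, ← map_sub]
  congr 1
  ext w
  rw [WordFun.sub_apply, WordFun.add_apply, ofFun_apply, ofFun_apply,
    polarSum_eq (linLau m) n (partialSum_of_le w)]
  ring

/-- Multiplying by the total sum clears the denominator, and removing the first or the last letter
is multiplication by `letters` on the left or on the right. -/
theorem res_scale_sangDefect (n m : ℕ) : res closed_indepWords
      (scale (linLau m) (ev m (sangDefect n)))
    = res closed_indepWords (scale (linLau m) (polarConj (linLau m) n)
      + letters * polarConj (linLau m) n - polarConj (linLau m) n * letters) := by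
  rw [res_scale_congr closed_indepWords _ (cls_sangDefect n m), res_eq]
  intro w hw
  rcases eq_or_ne w [] with rfl | h
  · simp
  · have h0 := linLau_sum_ne_zero w hw h
    rw [WordFun.sub_apply, WordFun.add_apply, scale_apply, scale_apply, letters_mul_apply _ h,
      mul_letters_apply _ h, ofFun_apply]
    field_simp
    ring

/-- The abstract lemma `res_subst_mul_eq_pre` is applied with `P = paj`, `Q = neg(paj)`, and `f` the
`2n`-th power of the linear form. Since `D` anticommutes with the change of signs and `f` is even,
the equation for the defect becomes the required one for its image under `neg`. -/
theorem adRel_paj_conjSa (n : ℕ) : AdRel paj (conjSa n) (neg (sangDefect n)) := by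
  refine ext_cls fun m => ?_
  have hP := cls_mul_mulInv paj_mem_GARI m
  have hP' := cls_mulInv_mul paj_mem_GARI m
  have hrP : res closed_indepWords (ev m paj) = _ := cls_paj m
  have hDP : res closed_indepWords (scale (linLau m) (ev m paj))
      = cls m paj * res closed_indepWords letters := by
    rw [res_scale_congr closed_indepWords _ hrP,
      res_scale_pajFun _ closed_indepWords linLau_sum_ne_zero, cls_paj]
  have hrefl : ∀ {F G : WordFun (LinForm m) (Lau m)},
      res closed_indepWords F = res closed_indepWords G →
        res closed_indepWords (reflect F) = res closed_indepWords (reflect G) :=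
    fun h => res_reflect_congr closed_indepWords map_neg_mem_indepWords h
  have heven : reflect (scale (fun u => linLau m u ^ (2 * n))
      (ev m paj * letters * ev m (mulInv paj))) = scale (fun u => linLau m u ^ (2 * n))
      (reflect (ev m paj) * letters * reflect (ev m (mulInv paj))) := by
    rw [reflect_scale, map_mul, map_mul, reflect_letters]
    simp only [map_neg, Even.neg_pow (even_two_mul n)]
  have hT : res closed_indepWords (polarConj (linLau m) n) = res closed_indepWords
      (scale (fun u => linLau m u ^ (2 * n)) (ev m paj * letters * ev m (mulInv paj))) := by
    refine res_scale_congr closed_indepWords _ ?_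
    rw [map_mul, map_mul, map_mul, map_mul, ← cls_paj, ← cls_mulInv_paj]
    rfl
  rw [cls_garitLin_mul paj_mem_GARI, cls_preari (conjSa_mem_ARI n)]
  refine res_subst_mul_eq_pre closed_indepWords (linLau m) linLau_sum_ne_zero
    (fun u => linLau m u ^ (2 * n)) hP hP' (Q := reflect (ev m paj))
    (Q' := reflect (ev m (mulInv paj))) ?_ (ev_nil_of_mem_GARI paj_mem_GARI m)
    (ev_nil_of_mem_GARI paj_mem_GARI m) hDP ?_ (ev_nil_of_mem_ARI (conjSa_mem_ARI n) m)
    (ev_nil_of_mem_ARI (neg_mem_ARI (sangDefect_mem_ARI n)) m) ?_ ?_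
  · rw [← map_mul, ← map_mul, ← map_one (res closed_indepWords), ← map_one reflect]
    refine hrefl ?_
    rw [map_mul, map_one]
    exact hP'
  · have h : scale (linLau m) (reflect (ev m paj)) = -reflect (scale (linLau m) (ev m paj)) := by
      rw [reflect_scale_hom, neg_neg]
    have h2 : res closed_indepWords (scale (linLau m) (ev m paj))
        = res closed_indepWords (ev m paj * letters) := by
      rw [hDP, map_mul]
      rfl
    rw [h, map_neg, hrefl h2, map_mul, reflect_letters, map_mul]
  · change cls m (conjSa n) = _
    rw [conjSa, cls_mul, cls_mul, cls_sa]
    rfl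
  · have h : scale (linLau m) (reflect (ev m (sangDefect n)))
        = -reflect (scale (linLau m) (ev m (sangDefect n))) := by
      rw [reflect_scale_hom, neg_neg]
    rw [res_scale_congr closed_indepWords _ (cls_neg_mould (sangDefect n) m), h, map_neg,
      hrefl (res_scale_sangDefect n m)]
    have h2 : res closed_indepWords (scale (linLau m) (polarConj (linLau m) n)
        + letters * polarConj (linLau m) n - polarConj (linLau m) n * letters)
        = res closed_indepWords (scale (linLau m) (scale (fun u => linLau m u ^ (2 * n))
          (ev m paj * letters * ev m (mulInv paj)))
          + letters * scale (fun u => linLau m u ^ (2 * n))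
            (ev m paj * letters * ev m (mulInv paj))
          - scale (fun u => linLau m u ^ (2 * n))
            (ev m paj * letters * ev m (mulInv paj)) * letters) := by
      simp only [map_sub, map_add, map_mul _ (letters : WordFun (LinForm m) (Lau m)),
        map_mul _ _ (letters : WordFun (LinForm m) (Lau m)), hT,
        res_scale_congr closed_indepWords (linLau m) hT]
    -- The sign change reverses only the `D` term; together with the global minus sign this turns `D
    -- T + [I, T]` into `D T - [I, T]`.
    rw [hrefl h2, map_sub, map_add, map_mul, map_mul, reflect_scale_hom, heven, reflect_letters,
      ← map_neg]
    congr 1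
    abel

theorem sang_sa (n : ℕ) : sang (sa (2 * n + 1)) = sharp (brownPsi n) := by
  change (1 / 2 : ℚ) • (conjSa n + neg (adari paj (conjSa n))) = _
  rw [adari_eq paj_mem_GARI (conjSa_mem_ARI n) (neg_mem_ARI (sangDefect_mem_ARI n))
    (adRel_paj_conjSa n), neg_neg_mould, sangDefect, add_sub_cancel, ← two_smul ℚ, smul_smul]
  norm_num

/-! ## The mould `pal` -/

theorem dur_ne_zero {m : ℕ} (hm : m ≠ 0) : dur m ≠ 0 := by
  have h : dur m = linLau m (xWord m).sum := by
    have := sum_take_xWord (m := m) m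
    rw [List.take_of_length_le (xWord_length m).le] at this
    rw [this, map_sum]
    simp only [linLau_single, Fin.is_lt, Finset.filter_true]
    rfl
  rw [h]
  refine linLau_sum_ne_zero _ (xWord_mem m) fun h => hm ?_
  rw [← xWord_length m, h, List.length_nil]

theorem dupal_mem_ARI : dupal ∈ ARI := by
  change _ • (_ * ∑ k : Fin 0, _) = (0 : Lau 0)
  simp

/-- The constant term of `dupal` vanishes, so the defining relation determines each component from
shorter ones after division by the sum of the variables, which is nonzero in positive length. -/
theorem pal_mem_GARI : pal ∈ GARI := by
  refine (Classical.epsilon_spec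
    (p := fun P : Mould => P ∈ GARI ∧ (fun m => dur m * P m) = mul P dupal) ?_).1
  -- In length zero the divisor is `0` and the quotient is `0` by convention, so solving for the
  -- value `unit` encodes both the constant term `1` and the recursion.
  have hΨ : Unitriangular fun P m => P m - mul P dupal m / dur m := by
    intro M N m h
    have h1 : mul M dupal m = mul N dupal m := by
      rw [← sub_eq_zero, mul_eq, mul_eq, ← WordFun.sub_apply, ← sub_mul,
        apply_mul_of_vanishBelow (vanishBelow_ev_sub m h) (xWord_length m).le,
        ev_nil_of_mem_ARI dupal_mem_ARI, mul_zero]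
    simp only [h1]
    ring
  obtain ⟨P, hP⟩ := hΨ.surjective unit
  have h0 : dur 0 = 0 := Finset.sum_empty
  refine ⟨P, ?_, ?_⟩
  · have := congrFun hP 0
    simp only [h0, div_zero, sub_zero] at this
    exact this
  · ext m
    rcases eq_or_ne m 0 with rfl | hm
    · rw [h0, zero_mul, mul_zero_apply, show dupal 0 = 0 from dupal_mem_ARI, mul_zero]
    · have h1 : P m - mul P dupal m / dur m = 0 := by
        obtain ⟨k, rfl⟩ := Nat.exists_eq_succ_of_ne_zero hm
        exact congrFun hP (k + 1)
      have := dur_ne_zero hm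
      field_simp at h1
      linear_combination h1

end Mould

end MouldTheory

end

theorem theorem2p3 (n : ℕ) (hn : 1 ≤ n) :
    MouldTheory.Mould.sharp (MouldTheory.brownPsi n) = MouldTheory.sang (MouldTheory.sa (2 * n + 1)) ∧
    MouldTheory.Mould.IsSum (fun r => MouldTheory.slang r (MouldTheory.sa (2 * n + 1)))
      (MouldTheory.sang (MouldTheory.sa (2 * n + 1))) := by
  have h := MouldTheory.Mould.sang_sa n
  refine ⟨h.symm, MouldTheory.Mould.isSum_adari_leng MouldTheory.Mould.pal_mem_GARI ?_⟩
  rw [h]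
  exact MouldTheory.Mould.sharp_mem_ARI (MouldTheory.Mould.brownPsi_zero n)
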